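/- Let $f:\mathbb R\to\mathbb R$ be of class $C^2$ with $f''$ bounded, let $\varepsilon>0$, and let $f_\varepsilon$ be the piecewise affine interpolation of $f$ at the points of $\varepsilon\mathbb Z$. Let $\bar u_\varepsilon\in BV(\mathbb R)$ be right continuous, compactly supported, with values in $\varepsilon\mathbb Z$, and let $u_\varepsilon$ be the wavefront tracking solution of $u_t+f_\varepsilon(u)_x=0$ with datum $\bar u_\varepsilon$: the Riemann problems at the jumps are solved with flux $f_\varepsilon$ (by the convex envelope of $f_\varepsilon$ between the two states at an upward jump and the concave envelope at a downward jump), and re-solved whenever wavefronts collide. Let $t_1<t_2<\dots$ be the collision times and $t_0=0$; assume that at each $t_j$, $j\ge1$, exactly two wavefronts collide, at a point $x_j$. The point $(t_j,x_j)$ is an *interaction point* if the jumps of the two colliding wavefronts have the same sign. *Waves.* Put $U(x)=\mathrm{Tot.Var.}(\bar u_\varepsilon;(-\infty,x])$ and $\mathcal W=\{1,\dots,\mathrm{Tot.Var.}(\bar u_\varepsilon)/\varepsilon\}$. The wave $s\in\mathcal W$ has strength $|s|=\varepsilon$, initial position $\mathtt x(0,s)=\inf\{x:\varepsilon s\le U(x)\}$,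 sign $\mathcal S(s)=\operatorname{sign}[\bar u_\varepsilon(\mathtt x(0,s))-\bar u_\varepsilon(\mathtt x(0,s)-)]$ and right state $\hat u(s)=\bar u_\varepsilon(\mathtt x(0,s)-)+\mathcal S(s)[\varepsilon s-U(\mathtt x(0,s)-)]$. Its cell is $(\hat u(s)-\varepsilon,\hat u(s))$ if $\mathcal S(s)=1$ and $(\hat u(s),\hat u(s)+\varepsilon)$ if $\mathcal S(s)=-1$. For an interval $I$ containing the cell of $s$, with endpoints in $\varepsilon\mathbb Z$, let $\sigma(I,s)$ be the constant value on this cell of $\frac{d}{du}\operatorname{conv}_If_\varepsilon$ if $\mathcal S(s)=1$, and of $\frac{d}{du}\operatorname{conc}_If_\varepsilon$ if $\mathcal S(s)=-1$. Inductively in $j$, $\sigma(t_j,s)=\sigma(I,s)$, where $I$ is the interval with endpoints $u_\varepsilon(t_j,\mathtt x(t_j,s)-)$ and $u_\varepsilon(t_j,\mathtt x(t_j,s))$; and $\mathtt x(t,s)=\mathtt x(t_j,s)+\sigma(t_j,s)(t-t_j)$ for $t_j\le t\le t_{j+1}$ (for all $t\ge t_j$ if there is no further collision), except that at time $t_{j+1}$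 a wave arriving at $x_{j+1}$ is removed ($\mathtt x(t,s)=+\infty$ for all $t\ge t_{j+1}$) unless $$\mathcal S(s)u_\varepsilon(t_{j+1},x_{j+1}-)\le\mathcal S(s)\hat u(s)-\varepsilon\quad\text{and}\quad\mathcal S(s)\hat u(s)\le\mathcal S(s)u_\varepsilon(t_{j+1},x_{j+1}).$$ Let $\mathcal W(t)=\{s\in\mathcal W:\mathtt x(t,s)<+\infty\}$. *The functional.* Two waves $s,s'\in\mathcal W(t)$ have already interacted at time $t$ if $\mathtt x(r,s)=\mathtt x(r,s')$ for some $r\in[0,t]$. In this case let $\mathcal I(t,s,s')$ be the interval of states occupied by the closures of the cells of all waves $p\in\mathcal W(t)$ that have already interacted at time $t$ with both $s$ and $s'$. For $s<s'$ in $\mathcal W(t)$ set $$\mathfrak q(t,s,s')=\frac{|\sigma(\mathcal I(t,s,s'),s')-\sigma(\mathcal I(t,s,s'),s)|}{|\hat u(s')-(\hat u(s)-\mathcal S(s)\varepsilon)|}$$ if $s,s'$ have already interacted at time $t$, and $\mathfrak q(t,s,s')=\|f''\|_{L^\infty}$ otherwise. Put $$\mathfrak Q(t)=\sum_{s,s'\in\mathcal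 W(t),\ s<s'}\mathfrak q(t,s,s')\,|s||s'|.$$ **Theorem.** For every interaction point $(t_j,x_j)$, $j\ge1$, $$\sum_{s\in\mathcal W(t_j)}|\sigma(t_j,s)-\sigma(t_{j-1},s)|\,|s|\le 2\big[\mathfrak Q(t_{j-1})-\mathfrak Q(t_j)\big].$$ -/

import Mathlib

open Set

noncomputable section

namespace WavefrontTracking

/-! ### Convex envelopes and the Riemann solver -/

/-- The convex envelope of `g` on `[a, b]`: the supremum of the convex functions on `[a, b]`
lying below `g`. -/
def convEnv (g : ℝ → ℝ) (a b u : ℝ) : ℝ :=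
  sSup {y | ∃ h : ℝ → ℝ, ConvexOn ℝ (Icc a b) h ∧ (∀ w ∈ Icc a b, h w ≤ g w) ∧ h u = y}

/-- The concave envelope of `g` on `[a, b]`: the infimum of the concave functions on `[a, b]`
lying above `g`. -/
def concEnv (g : ℝ → ℝ) (a b u : ℝ) : ℝ :=
  sInf {y | ∃ h : ℝ → ℝ, ConcaveOn ℝ (Icc a b) h ∧ (∀ w ∈ Icc a b, g w ≤ h w) ∧ h u = y}

/-- The piecewise affine interpolation of `f` with grid size `ε`: it is affine on each
`[kε, (k+1)ε]` and coincides with `f` at the points `kε`, `k ∈ ℤ`. -/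
def interp (f : ℝ → ℝ) (ε u : ℝ) : ℝ :=
  f (⌊u / ε⌋ * ε) + (f ((⌊u / ε⌋ + 1) * ε) - f (⌊u / ε⌋ * ε)) / ε * (u - ⌊u / ε⌋ * ε)

/-- The slope of the convex envelope on `[a, b]` of the interpolated flux, on the grid cell with
centre `c`. (The envelope is affine on each grid cell contained in `[a, b]`, so its derivative is
constant there and is read off at the centre.) -/
def convSlope (f : ℝ → ℝ) (ε a b c : ℝ) : ℝ := deriv (convEnv (interp f ε) a b) c

/-- The slope of the concave envelope on `[a, b]` of the interpolated flux, on the grid cell with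
centre `c`. -/
def concSlope (f : ℝ → ℝ) (ε a b c : ℝ) : ℝ := deriv (concEnv (interp f ε) a b) c

/-- The right continuous profile `ξ = x / t ↦ u` of the self-similar entropy solution of the
Riemann problem with left state `a`, right state `b` (both in `ℤ ε`) and flux `interp f ε`.
If `a ≤ b` the value at `ξ` is the largest grid value `w ∈ [a, b]` such that the cell
`(w - ε, w)` has speed at most `ξ` in the convex envelope on `[a, b]` (and `a` if there is none);
if `b < a` it is the least grid value `w ∈ [b, a]` such that the cell `(w, w + ε)` has speed at
most `ξ` in the concave envelope on `[b, a]` (and `a` if there is none). -/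
def riemann (f : ℝ → ℝ) (ε a b ξ : ℝ) : ℝ :=
  if a ≤ b then
    sSup (insert a {w | w ∈ Ioc a b ∧ (∃ m : ℤ, w = m * ε) ∧ convSlope f ε a b (w - ε / 2) ≤ ξ})
  else
    sInf (insert a {w | w ∈ Ico b a ∧ (∃ m : ℤ, w = m * ε) ∧ concSlope f ε b a (w + ε / 2) ≤ ξ})

/-! ### Wavefronts leaving a piecewise constant profile, and their first collision -/

/-- The Riemann profile generated at the point `y` by the profile `v`. -/
def riemannAt (f : ℝ → ℝ) (ε : ℝ) (v : ℝ → ℝ) (y ξ : ℝ) : ℝ :=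
  riemann f ε (Function.leftLim v y) (v y) ξ

/-- The jump `u(right) - u(left)` across the line leaving `w.1` with speed `w.2` in the solution
of the Riemann problem of `v` at `w.1`. -/
def frontJump (f : ℝ → ℝ) (ε : ℝ) (v : ℝ → ℝ) (w : ℝ × ℝ) : ℝ :=
  riemannAt f ε v w.1 w.2 - Function.leftLim (riemannAt f ε v w.1) w.2

/-- The wavefronts leaving the profile `v`: pairs (starting point, speed) of the discontinuity
lines of the Riemann problems of `v`. -/
def fronts (f : ℝ → ℝ) (ε : ℝ) (v : ℝ → ℝ) : Set (ℝ × ℝ) := {w | frontJump f ε v w ≠ 0}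

/-- The position of the front `w` after a time `τ`. -/
def frontPos (w : ℝ × ℝ) (τ : ℝ) : ℝ := w.1 + τ * w.2

/-- The times `τ > 0` at which two different fronts leaving `v` would be at the same point. -/
def meetingTimes (f : ℝ → ℝ) (ε : ℝ) (v : ℝ → ℝ) : Set ℝ :=
  {τ | 0 < τ ∧ ∃ w ∈ fronts f ε v, ∃ w' ∈ fronts f ε v, w ≠ w' ∧ frontPos w τ = frontPos w' τ}

/-- The time until the first collision of fronts leaving `v` (if there is a collision). -/
def firstMeeting (f : ℝ → ℝ) (ε : ℝ) (v : ℝ → ℝ) : ℝ := sInf (meetingTimes f ε v)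

/-- The fronts leaving `v` that take part in the first collision(s). -/
def colliding (f : ℝ → ℝ) (ε : ℝ) (v : ℝ → ℝ) : Set (ℝ × ℝ) :=
  {w | w ∈ fronts f ε v ∧ ∃ w' ∈ fronts f ε v, w ≠ w' ∧
    frontPos w (firstMeeting f ε v) = frontPos w' (firstMeeting f ε v)}

/-- The point(s) at which the first collision(s) of fronts leaving `v` take place. -/
def collisionPoints (f : ℝ → ℝ) (ε : ℝ) (v : ℝ → ℝ) : Set ℝ :=
  (fun w => frontPos w (firstMeeting f ε v)) '' colliding f ε v

/-- The profile at time `τ > 0` obtained from the compactly supported piecewise constant profile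
`v` by solving all its Riemann problems; meaningful up to and including the first collision.
As the Riemann solutions do not overlap before that, gluing them amounts to adding the variations
`riemannAt … - v(y-)` they produce. -/
def evolve (f : ℝ → ℝ) (ε : ℝ) (v : ℝ → ℝ) (τ x : ℝ) : ℝ :=
  ∑ᶠ y : ℝ, (riemannAt f ε v y ((x - y) / τ) - Function.leftLim v y)

/-! ### The wavefront tracking solution -/

open Classical in
/-- The profile `u_ε(t_j, ·)` of the wavefront tracking solution with datum `u₀` at the `j`-th
collision time, where `t_0 = 0`. -/
def profile (f : ℝ → ℝ) (ε : ℝ) (u₀ : ℝ → ℝ) : ℕ → ℝ → ℝ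
  | 0 => u₀
  | j + 1 =>
    if (meetingTimes f ε (profile f ε u₀ j)).Nonempty then
      evolve f ε (profile f ε u₀ j) (firstMeeting f ε (profile f ε u₀ j))
    else profile f ε u₀ j

/-- The `j`-th collision time `t_j`, with `t_0 = 0`. -/
def time (f : ℝ → ℝ) (ε : ℝ) (u₀ : ℝ → ℝ) : ℕ → ℝ
  | 0 => 0
  | j + 1 => time f ε u₀ j + firstMeeting f ε (profile f ε u₀ j)

/-- There are at least `j` collision times in the wavefront tracking solution, i.e. `t_j` is
defined. -/
def Occurs (f : ℝ → ℝ) (ε : ℝ) (u₀ : ℝ → ℝ) (j : ℕ) : Prop :=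
  ∀ i < j, (meetingTimes f ε (profile f ε u₀ i)).Nonempty

/-- At each collision time exactly two fronts collide (so there is one collision point, in which
exactly two discontinuity lines meet). -/
def BinaryCollisions (f : ℝ → ℝ) (ε : ℝ) (u₀ : ℝ → ℝ) : Prop :=
  ∀ j, Occurs f ε u₀ (j + 1) → (colliding f ε (profile f ε u₀ j)).ncard = 2

/-- For `j ≥ 1`, the `j`-th collision point is an interaction point: the fronts colliding there
have the same sign. -/
def IsInteraction (f : ℝ → ℝ) (ε : ℝ) (u₀ : ℝ → ℝ) (j : ℕ) : Prop :=
  1 ≤ j ∧ Occurs f ε u₀ j ∧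
    ∀ w ∈ colliding f ε (profile f ε u₀ (j - 1)), ∀ w' ∈ colliding f ε (profile f ε u₀ (j - 1)),
      0 < frontJump f ε (profile f ε u₀ (j - 1)) w * frontJump f ε (profile f ε u₀ (j - 1)) w'

/-! ### Enumeration of the waves of the datum -/

/-- The total variation of `u₀` on `(-∞, x]`. -/
def totVar (u₀ : ℝ → ℝ) (x : ℝ) : ℝ := (eVariationOn u₀ (Iic x)).toReal

/-- The set of waves `{1, …, TV(u₀) / ε}`. -/
def waves (ε : ℝ) (u₀ : ℝ → ℝ) : Finset ℕ :=
  Finset.Icc 1 ⌊(eVariationOn u₀ univ).toReal / ε⌋₊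

/-- The initial position of the wave `s`. -/
def initPos (ε : ℝ) (u₀ : ℝ → ℝ) (s : ℕ) : ℝ := sInf {x | ε * s ≤ totVar u₀ x}

/-- The sign of the wave `s`. -/
def waveSign (ε : ℝ) (u₀ : ℝ → ℝ) (s : ℕ) : ℝ :=
  Real.sign (u₀ (initPos ε u₀ s) - Function.leftLim u₀ (initPos ε u₀ s))

/-- The right state of the wave `s`. -/
def rightState (ε : ℝ) (u₀ : ℝ → ℝ) (s : ℕ) : ℝ :=
  Function.leftLim u₀ (initPos ε u₀ s) +
    waveSign ε u₀ s * (ε * s - Function.leftLim (totVar u₀) (initPos ε u₀ s))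

open Classical in
/-- The speed given to the wave `s` by the Riemann problem of the profile `v` at the point `z`. -/
def speedAt (f : ℝ → ℝ) (ε : ℝ) (u₀ v : ℝ → ℝ) (z : ℝ) (s : ℕ) : ℝ :=
  if waveSign ε u₀ s = 1 then
    convSlope f ε (Function.leftLim v z) (v z) (rightState ε u₀ s - ε / 2)
  else
    concSlope f ε (v z) (Function.leftLim v z) (rightState ε u₀ s + ε / 2)

/-- The wave `s`, located at `z`, is not canceled: it is part of the jump of `v` at `z`. -/
def Survives (ε : ℝ) (u₀ v : ℝ → ℝ) (z : ℝ) (s : ℕ) : Prop :=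
  waveSign ε u₀ s * Function.leftLim v z ≤ waveSign ε u₀ s * rightState ε u₀ s - ε ∧
    waveSign ε u₀ s * rightState ε u₀ s ≤ waveSign ε u₀ s * v z

/-! ### Position and speed of the waves -/

open Classical in
/-- The position `x(t_j, s)` of the wave `s` at the `j`-th collision time; it is `⊤` if the wave
has been removed. -/
def stagePos (f : ℝ → ℝ) (ε : ℝ) (u₀ : ℝ → ℝ) : ℕ → ℕ → WithTop ℝ
  | 0, s => (initPos ε u₀ s : ℝ)
  | j + 1, s =>
    if stagePos f ε u₀ j s = ⊤ then ⊤
    else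
      let v := profile f ε u₀ j
      let y := (stagePos f ε u₀ j s).untopD 0
      let z := y + speedAt f ε u₀ v y s * firstMeeting f ε v
      if z ∈ collisionPoints f ε v ∧ ¬ Survives ε u₀ (profile f ε u₀ (j + 1)) z s then ⊤
      else (z : ℝ)

/-- The speed `σ(t_j, s)` of the wave `s` at the `j`-th collision time. The value is irrelevant if
the wave has been removed. -/
def stageSpeed (f : ℝ → ℝ) (ε : ℝ) (u₀ : ℝ → ℝ) (j s : ℕ) : ℝ :=
  speedAt f ε u₀ (profile f ε u₀ j) ((stagePos f ε u₀ j s).untopD 0) s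

/-- The index of the last collision time not larger than `t`. -/
def stage (f : ℝ → ℝ) (ε : ℝ) (u₀ : ℝ → ℝ) (t : ℝ) : ℕ :=
  sSup {j | Occurs f ε u₀ j ∧ time f ε u₀ j ≤ t}

/-- The speed `σ(t, s)` of the wave `s` at time `t ≥ 0`. -/
def speed (f : ℝ → ℝ) (ε : ℝ) (u₀ : ℝ → ℝ) (t : ℝ) (s : ℕ) : ℝ :=
  stageSpeed f ε u₀ (stage f ε u₀ t) s

/-- The position `x(t, s)` of the wave `s` at time `t ≥ 0`. -/
def pos (f : ℝ → ℝ) (ε : ℝ) (u₀ : ℝ → ℝ) (t : ℝ) (s : ℕ) : WithTop ℝ :=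
  (stagePos f ε u₀ (stage f ε u₀ t) s).map
    fun y => y + speed f ε u₀ t s * (t - time f ε u₀ (stage f ε u₀ t))

open Classical in
/-- The set `W(t)` of the real waves at time `t`. -/
def realWaves (f : ℝ → ℝ) (ε : ℝ) (u₀ : ℝ → ℝ) (t : ℝ) : Finset ℕ :=
  (waves ε u₀).filter fun s => pos f ε u₀ t s ≠ ⊤

/-! ### Common history, artificial speeds and the quadratic functional -/

/-- The real waves `s`, `s'` have already interacted at time `t`: at some time `r ≤ t` they were
at the same point. -/
def Interacted (f : ℝ → ℝ) (ε : ℝ) (u₀ : ℝ → ℝ) (t : ℝ) (s s' : ℕ) : Prop :=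
  s ∈ realWaves f ε u₀ t ∧ s' ∈ realWaves f ε u₀ t ∧
    ∃ r, 0 ≤ r ∧ r ≤ t ∧ pos f ε u₀ r s = pos f ε u₀ r s'

open Classical in
/-- The interval of waves `I(t, s, s')`: the real waves that have already interacted at time `t`
both with `s` and with `s'`. -/
def history (f : ℝ → ℝ) (ε : ℝ) (u₀ : ℝ → ℝ) (t : ℝ) (s s' : ℕ) : Finset ℕ :=
  (realWaves f ε u₀ t).filter fun p => Interacted f ε u₀ t p s ∧ Interacted f ε u₀ t p s'

open Classical in
/-- The interval of states occupied by the wave `s`. -/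
def waveCell (ε : ℝ) (u₀ : ℝ → ℝ) (s : ℕ) : Set ℝ :=
  if waveSign ε u₀ s = 1 then Ioc (rightState ε u₀ s - ε) (rightState ε u₀ s)
  else Ico (rightState ε u₀ s) (rightState ε u₀ s + ε)

/-- The set of states occupied by the waves in `I`. -/
def stateSet (ε : ℝ) (u₀ : ℝ → ℝ) (I : Finset ℕ) : Set ℝ := ⋃ p ∈ I, waveCell ε u₀ p

open Classical in
/-- The artificial speed given to the wave `s` by the Riemann problem `I`. -/
def artSpeed (f : ℝ → ℝ) (ε : ℝ) (u₀ : ℝ → ℝ) (I : Finset ℕ) (s : ℕ) : ℝ :=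
  if waveSign ε u₀ s = 1 then
    convSlope f ε (sInf (stateSet ε u₀ I)) (sSup (stateSet ε u₀ I)) (rightState ε u₀ s - ε / 2)
  else
    concSlope f ε (sInf (stateSet ε u₀ I)) (sSup (stateSet ε u₀ I)) (rightState ε u₀ s + ε / 2)

open Classical in
/-- The weight `q(t, s, s')` of the pair of waves `s < s'` at time `t`. The second value is the
supremum norm of `f''`. -/
def weight (f : ℝ → ℝ) (ε : ℝ) (u₀ : ℝ → ℝ) (t : ℝ) (s s' : ℕ) : ℝ :=
  if Interacted f ε u₀ t s s' then
    |artSpeed f ε u₀ (history f ε u₀ t s s') s' - artSpeed f ε u₀ (history f ε u₀ t s s') s| /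
      |rightState ε u₀ s' - (rightState ε u₀ s - waveSign ε u₀ s * ε)|
  else ⨆ u, |deriv (deriv f) u|

/-- The quadratic functional `Q(t)`; every wave has strength `ε`. -/
def Q (f : ℝ → ℝ) (ε : ℝ) (u₀ : ℝ → ℝ) (t : ℝ) : ℝ :=
  ∑ s ∈ realWaves f ε u₀ t, ∑ s' ∈ (realWaves f ε u₀ t).filter (fun s' => s < s'),
    weight f ε u₀ t s s' * ε * ε

end WavefrontTracking

end

/-! At an interaction point no wave is lost. A left front of `l` waves with speed `σ₁` and a right
front of `r` waves with speed `σ₂ < σ₁` merge into one front. Its speed is the mean of `σ₁` and `σ₂`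
with weights `l` and `r`, and no other wave changes speed. The total change of speed is therefore
exactly `2 ε (σ₁ - σ₂) l r / (l + r)` (`IsDatum.sum_speed_sub`).

On the side of the functional, no weight increases: the common history of a pair that has met can
only grow when nothing is removed, and differences of slopes of a convex envelope decrease when the
interval grows (`IsEnvSlope.sub_le_sub`, `IsDatum.weight_anti`). In the merged front the flux lies
above a chord, so all weights inside it vanish (`IsDatum.weight_eq_zero`). Hence every pair across
the two fronts that had never met releases `‖f''‖ ε²`.

It remains to bound `(σ₁ - σ₂) l r` by `‖f''‖ ε (l + r)` times the number of such pairs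
(`IsDatum.speed_sub_le`). If the two adjacent waves of the fronts have not met, then no pair across
has, and the mean value theorem suffices. Otherwise the key is `IsDatum.hasContact`: the state
separating two neighbouring fronts that have met is a contact point of the flux with its envelope
over all waves that have met both neighbours. If `x` waves on the left and `w` on the right have not
met the opposite neighbour, the slope at the contact lies between those of the remaining parts,
whence `σ₁ - σ₂ ≤ ‖f''‖ ε (x + w)`. At least `x r + (l - x) w` pairs are new, and `mul_le_of_le_add`
concludes. The contact property is proved by induction over the collisions.

All this takes place on integers. `IsWaveRep` says that the profile is the sum of the signs of its
waves; `gridFlux` orients the state variable by the sign, so that only convex envelopes occur;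
`IsWaveRep.riemannAt_eq` and `IsWaveRep.evolve_eq` express the Riemann solver and the evolution
through the waves. `IsDatum.isWaveRep` propagates the representation through every collision. -/

namespace WavefrontTracking

/-! ### Slopes of discrete convex envelopes -/

/-- The number `σ` is the slope on the cell `[m, m + 1]` of the convex envelope on `[a, b]` of the
sequence `F`: some line of slope `σ` lies below `F` on `[a, b]` and touches it on both sides of
the cell. -/
def IsEnvSlope (F : ℤ → ℝ) (a b m : ℤ) (σ : ℝ) : Prop :=
  ∃ i k : ℤ, a ≤ i ∧ i ≤ m ∧ m < k ∧ k ≤ b ∧ F k = F i + σ * (k - i) ∧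
    ∀ n : ℤ, a ≤ n → n ≤ b → F i + σ * (n - i) ≤ F n

/-- The chord of `F` over `[a, b]`, of slope `σ`, lies below `F`. -/
def IsChord (F : ℤ → ℝ) (a b : ℤ) (σ : ℝ) : Prop :=
  F b = F a + σ * (b - a) ∧ ∀ n : ℤ, a ≤ n → n ≤ b → F a + σ * (n - a) ≤ F n

/-- Among the chords joining a point up to `m` with a point after `m`, take one that is lowest over
the middle of the cell. A point of the sequence strictly below its line could replace the end on its
own side and give a lower chord. -/
theorem exists_isEnvSlope (F : ℤ → ℝ) {a b m : ℤ} (ham : a ≤ m) (hmb : m < b) :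
    ∃ σ, IsEnvSlope F a b m σ := by
  -- Any point inside the cell would do: what matters is that `k - c` and `c - i` are positive for
  -- all admissible ends.
  set c : ℝ := m + 1 / 2 with hc
  obtain ⟨⟨i, k⟩, hik, hmin⟩ := Finset.exists_min_image
    (Finset.Icc a m ×ˢ Finset.Icc (m + 1) b)
    (fun p : ℤ × ℤ => (F p.1 * (p.2 - c) + F p.2 * (c - p.1)) / ((p.2 : ℝ) - p.1))
    ⟨(a, b), by simp only [Finset.mem_product, Finset.mem_Icc]; omega⟩
  simp only [Finset.mem_product, Finset.mem_Icc] at hik hmin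
  obtain ⟨⟨hai, him⟩, hmk, hkb⟩ := hik
  have him' : (i : ℝ) ≤ m := by exact_mod_cast him
  have hmk' : (m : ℝ) + 1 ≤ k := by exact_mod_cast hmk
  have hpos : (0 : ℝ) < k - i := by linarith
  set σ : ℝ := (F k - F i) / (k - i) with hσ
  have hFk : F k = F i + σ * (k - i) := by rw [hσ]; field_simp; ring
  have hval : (F i * (k - c) + F k * (c - i)) / ((k : ℝ) - i) = F i + σ * (c - i) := by
    rw [hFk]; field_simp; ring
  refine ⟨σ, i, k, hai, him, by omega, hkb, hFk, fun n han hnb => ?_⟩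
  rcases le_or_gt n m with hnm | hnm
  · have h := hmin (n, k) ⟨⟨han, hnm⟩, hmk, hkb⟩
    simp only at h
    have hnm' : (n : ℝ) ≤ m := by exact_mod_cast hnm
    have hpos' : (0 : ℝ) < k - n := by linarith
    rw [hval, le_div_iff₀ hpos', hFk] at h
    have h2 : 0 ≤ (F n - (F i + σ * (n - i))) * (k - c) := by linarith
    have h3 : (0 : ℝ) < k - c := by rw [hc]; linarith
    linarith [nonneg_of_mul_nonneg_left h2 h3]
  · have h := hmin (i, n) ⟨⟨hai, him⟩, hnm, hnb⟩
    simp only at h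
    have hnm' : (m : ℝ) + 1 ≤ n := by exact_mod_cast hnm
    have hpos' : (0 : ℝ) < n - i := by linarith
    rw [hval, le_div_iff₀ hpos'] at h
    have h2 : 0 ≤ (F n - (F i + σ * (n - i))) * (c - i) := by linarith
    have h3 : (0 : ℝ) < c - i := by rw [hc]; linarith
    linarith [nonneg_of_mul_nonneg_left h2 h3]

/-- Each supporting line is tested at a contact point of the other; the two inequalities add up to
`(τ - σ) (k' - i) ≥ 0`. -/
theorem IsEnvSlope.mono {F : ℤ → ℝ} {a b m n : ℤ} {σ τ : ℝ} (h : IsEnvSlope F a b m σ)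
    (h' : IsEnvSlope F a b n τ) (hmn : m ≤ n) : σ ≤ τ := by
  obtain ⟨i, k, hai, him, hmk, hkb, hk, hl⟩ := h
  obtain ⟨i', k', hai', him', hmk', hkb', hk', hl'⟩ := h'
  have h1 := hl k' (by omega) hkb'
  have h2 := hl' i hai (by omega)
  have h3 : (0 : ℝ) < k' - i := by
    have : i < k' := by omega
    have : (i : ℝ) < k' := by exact_mod_cast this
    linarith
  have h4 : 0 ≤ (τ - σ) * (k' - i) := by nlinarith
  linarith [nonneg_of_mul_nonneg_left h4 h3]

theorem IsEnvSlope.unique {F : ℤ → ℝ} {a b m : ℤ} {σ τ : ℝ} (h : IsEnvSlope F a b m σ)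
    (h' : IsEnvSlope F a b m τ) : σ = τ :=
  le_antisymm (h.mono h' le_rfl) (h'.mono h le_rfl)

/-- When the interval grows, the differences of slopes decrease. -/
theorem IsEnvSlope.sub_le_sub {F : ℤ → ℝ} {a b a' b' m n : ℤ} {σ τ σ' τ' : ℝ}
    (hm : IsEnvSlope F a b m σ) (hn : IsEnvSlope F a b n τ)
    (hm' : IsEnvSlope F a' b' m σ') (hn' : IsEnvSlope F a' b' n τ')
    (ha : a' ≤ a) (hb : b ≤ b') (hmn : m ≤ n) : τ' - σ' ≤ τ - σ := by
  rcases le_or_gt τ' σ' with h | h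
  · linarith [hm.mono hn hmn]
  have hmn' := hm'
  have hnn' := hn'
  obtain ⟨i, k, hai, him, hmk, hkb, hk, hl⟩ := hm
  obtain ⟨i₂, k₂, hai₂, him₂, hmk₂, hkb₂, hk₂, hl₂⟩ := hn
  obtain ⟨i', k', hai', him', hmk', hkb', hk', hl'⟩ := hm'
  obtain ⟨i₂', k₂', hai₂', him₂', hmk₂', hkb₂', hk₂', hl₂'⟩ := hn'
  -- Since the two slopes on the larger interval differ, the line of slope `σ'` does not reach its
  -- right contact beyond `n`, nor that of slope `τ'` its left contact before `m + 1`. Both contacts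
  -- therefore lie in the smaller interval and can be tested there.
  have hk'n : k' ≤ n := by
    by_contra hcon
    have : IsEnvSlope F a' b' n σ' := ⟨i', k', hai', by omega, by omega, hkb', hk', hl'⟩
    linarith [this.unique hnn']
  have him₂'' : m < i₂' := by
    by_contra hcon
    have : IsEnvSlope F a' b' m τ' :=
      ⟨i₂', k₂', hai₂', by omega, by omega, hkb₂', hk₂', hl₂'⟩
    linarith [this.unique hmn']
  have e1 : σ ≤ σ' := by
    have h1 := hl k' (by omega) (by omega)
    have h2 := hl' i (by omega) (by omega)
    have h3 : (0 : ℝ) < k' - i := by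
      have : i < k' := by omega
      have : (i : ℝ) < k' := by exact_mod_cast this
      linarith
    have h4 : 0 ≤ (σ' - σ) * (k' - i) := by nlinarith
    linarith [nonneg_of_mul_nonneg_left h4 h3]
  have e2 : τ' ≤ τ := by
    have h1 := hl₂ i₂' (by omega) (by omega)
    have h2 := hl₂' k₂ (by omega) (by omega)
    have h3 : (0 : ℝ) < k₂ - i₂' := by
      have : i₂' < k₂ := by omega
      have : (i₂' : ℝ) < k₂ := by exact_mod_cast this
      linarith
    have h4 : 0 ≤ (τ - τ') * (k₂ - i₂') := by nlinarith
    linarith [nonneg_of_mul_nonneg_left h4 h3]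
  linarith

theorem IsChord.isEnvSlope {F : ℤ → ℝ} {a b m : ℤ} {σ : ℝ} (h : IsChord F a b σ) (ha : a ≤ m)
    (hb : m < b) : IsEnvSlope F a b m σ :=
  ⟨a, b, le_rfl, ha, hb, le_rfl, h.1, h.2⟩

/-- A maximal interval on which the slope of the envelope is constant is spanned by a chord. -/
theorem isChord_of_isEnvSlope {F : ℤ → ℝ} {a b α β : ℤ} {σ : ℝ} (haα : a ≤ α) (hαβ : α < β)
    (hβb : β ≤ b) (h : ∀ m, a ≤ m → m < b → (IsEnvSlope F a b m σ ↔ α ≤ m ∧ m < β)) :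
    IsChord F α β σ := by
  obtain ⟨i, k, hai, him, hmk, hkb, hk, hl⟩ := (h α haα (by omega)).2 ⟨le_rfl, hαβ⟩
  obtain ⟨i', k', hai', him', hmk', hkb', hk', hl'⟩ :=
    (h (β - 1) (by omega) (by omega)).2 ⟨by omega, by omega⟩
  -- A contact point outside the interval would give the slope `σ` to further cells.
  have hi : i = α := by
    have := ((h i hai (by omega)).1 ⟨i, k, hai, le_rfl, by omega, hkb, hk, hl⟩).1
    omega
  have hk'β : k' = β := by
    have := ((h (k' - 1) (by omega) (by omega)).1
      ⟨i', k', hai', by omega, by omega, hkb', hk', hl'⟩).2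
    omega
  subst hi hk'β
  have h1 := hl i' hai' (by omega)
  have h2 := hl' i hai (by omega)
  have h3 := hl k' (by omega) (by omega)
  refine ⟨by linarith, fun n hn hn' => hl n (by omega) (by omega)⟩

/-- If the slope of the envelope jumps at `m + 1`, it touches `F` there. -/
theorem IsEnvSlope.contact {F : ℤ → ℝ} {a b m : ℤ} {σ τ : ℝ} (h : IsEnvSlope F a b m σ)
    (h' : IsEnvSlope F a b (m + 1) τ) (hne : σ ≠ τ) (n : ℤ) (han : a ≤ n) (hnb : n ≤ b) :
    F (m + 1) + τ * (n - (m + 1 : ℤ)) ≤ F n := by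
  obtain ⟨i, k, hai, him, hmk, hkb, hk, hl⟩ := h'
  -- A left contact before `m + 1` would give the cell `m` the slope `τ` too.
  have : i = m + 1 := by
    by_contra hcon
    exact hne (h.unique ⟨i, k, hai, by omega, by omega, hkb, hk, hl⟩)
  subst this
  exact hl n han hnb

/-- When the slope drops at `b`, the broken line is concave and so lies above the segment joining
its ends. This is the algebra of two fronts merging. -/
theorem IsChord.merge {F : ℤ → ℝ} {a b c : ℤ} {σ τ : ℝ} (h : IsChord F a b σ)
    (h' : IsChord F b c τ) (hab : a < b) (hbc : b < c) (hτσ : τ ≤ σ) :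
    IsChord F a c ((σ * (b - a) + τ * (c - b)) / (c - a)) := by
  have hab' : (a : ℝ) < b := by exact_mod_cast hab
  have hbc' : (b : ℝ) < c := by exact_mod_cast hbc
  have hpos : (0 : ℝ) < c - a := by linarith
  obtain ⟨h1, h2⟩ := h
  obtain ⟨h3, h4⟩ := h'
  set ρ := (σ * (b - a) + τ * (c - b)) / ((c : ℝ) - a) with hρ
  have hρ' : ρ * (c - a) = σ * (b - a) + τ * (c - b) := by rw [hρ]; field_simp
  have hρσ : ρ ≤ σ := by
    rw [hρ, div_le_iff₀ hpos]; nlinarith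
  have hτρ : τ ≤ ρ := by
    rw [hρ, le_div_iff₀ hpos]; nlinarith
  refine ⟨by linarith, fun n hn hn' => ?_⟩
  rcases le_or_gt n b with hnb | hnb
  · have := h2 n hn hnb
    have hn2 : (a : ℝ) ≤ n := by exact_mod_cast hn
    nlinarith
  · have := h4 n hnb.le hn'
    have hn2 : (n : ℝ) ≤ c := by exact_mod_cast hn'
    nlinarith

/-! ### Envelopes of the interpolated flux -/

theorem interp_eq (f : ℝ → ℝ) {ε : ℝ} (hε : 0 < ε) (n : ℤ) {θ : ℝ} (h0 : 0 ≤ θ) (h1 : θ < 1) :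
    interp f ε ((n + θ) * ε) = (1 - θ) * f (n * ε) + θ * f ((n + 1) * ε) := by
  have hfl : ⌊(n + θ) * ε / ε⌋ = n := by
    rw [mul_div_cancel_right₀ _ hε.ne', Int.floor_eq_iff]
    constructor <;> linarith
  unfold interp
  rw [hfl]
  field_simp
  ring

theorem interp_grid (f : ℝ → ℝ) {ε : ℝ} (hε : 0 < ε) (n : ℤ) :
    interp f ε (n * ε) = f (n * ε) := by
  have := interp_eq f hε n le_rfl one_pos
  simpa using this

/-- Inside a cell both the line and the interpolant are the same convex combination of their values
at the ends. -/
theorem line_le_interp {f : ℝ → ℝ} {ε : ℝ} (hε : 0 < ε) {a b : ℤ} {A σ : ℝ}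
    (h : ∀ n : ℤ, a ≤ n → n ≤ b → A + σ * (n * ε) ≤ f (n * ε)) {u : ℝ}
    (hu : u ∈ Icc (a * ε) (b * ε)) : A + σ * u ≤ interp f ε u := by
  set n := ⌊u / ε⌋ with hn
  set θ := Int.fract (u / ε) with hθ
  have hun : u = (n + θ) * ε := by
    rw [hn, hθ, Int.floor_add_fract]; field_simp
  have h0 : 0 ≤ θ := Int.fract_nonneg _
  have h1 : θ < 1 := Int.fract_lt_one _
  have han : a ≤ n := by
    rw [hn, Int.le_floor, le_div_iff₀ hε]; exact hu.1
  have hnb : n ≤ b := by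
    have : (n : ℝ) ≤ b := (Int.floor_le _).trans (by rw [div_le_iff₀ hε]; exact hu.2)
    exact_mod_cast this
  rw [hun, interp_eq f hε n h0 h1]
  have e1 := h n han hnb
  -- At the right end of the interval the grid point `n + 1` is out of range, but there its weight
  -- `θ` is zero.
  rcases eq_or_lt_of_le hnb with hb | hb
  · have hθ0 : θ = 0 := by
      have : (n + θ) * ε ≤ b * ε := hun ▸ hu.2
      have := le_of_mul_le_mul_right this hε
      rw [← hb] at this
      linarith
    rw [hθ0]; simpa using e1
  · have e2 := h (n + 1) (by omega) (by omega)
    push_cast at e2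
    nlinarith

/-- The supporting line is itself an admissible minorant. Any other convex minorant, minus the line,
is nonpositive at the two contacts and hence between them. -/
theorem convEnv_eq {f : ℝ → ℝ} {ε : ℝ} (hε : 0 < ε) {a b i k : ℤ} {A σ : ℝ}
    (hai : a ≤ i) (hik : i ≤ k) (hkb : k ≤ b) (hi : f (i * ε) = A + σ * (i * ε))
    (hk : f (k * ε) = A + σ * (k * ε))
    (h : ∀ n : ℤ, a ≤ n → n ≤ b → A + σ * (n * ε) ≤ f (n * ε)) {u : ℝ}
    (hu : u ∈ Icc (i * ε) (k * ε)) :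
    convEnv (interp f ε) (a * ε) (b * ε) u = A + σ * u := by
  have hin : ∀ n : ℤ, a ≤ n → n ≤ b → (n * ε : ℝ) ∈ Icc (a * ε : ℝ) (b * ε) := fun n h1 h2 =>
    ⟨mul_le_mul_of_nonneg_right (by exact_mod_cast h1) hε.le,
      mul_le_mul_of_nonneg_right (by exact_mod_cast h2) hε.le⟩
  have hi' := hin i hai (by omega)
  have hk' := hin k (by omega) hkb
  apply IsGreatest.csSup_eq
  constructor
  · refine ⟨fun w => A + σ * w, ⟨convex_Icc _ _, fun x _ y _ p q _ _ hpq => ?_⟩,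
      fun w hw => line_le_interp hε h hw, rfl⟩
    simp only [smul_eq_mul]
    have : p = 1 - q := by linarith
    subst this
    exact le_of_eq (by ring)
  · rintro y ⟨g, hg, hgle, rfl⟩
    have hconv : ConvexOn ℝ (Icc (a * ε : ℝ) (b * ε)) (fun w => g w - (A + σ * w)) := by
      refine ⟨hg.1, fun x hx y hy p q hp hq hpq => ?_⟩
      have := hg.2 hx hy hp hq hpq
      simp only [smul_eq_mul] at this ⊢
      have hp1 : p = 1 - q := by linarith
      subst hp1
      linarith
    have hmax := hconv.le_max_of_mem_Icc hi' hk' hu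
    have e1 := hgle _ hi'
    have e2 := hgle _ hk'
    rw [interp_grid f hε] at e1 e2
    have : max (g (i * ε) - (A + σ * (i * ε))) (g (k * ε) - (A + σ * (k * ε))) ≤ 0 :=
      max_le (by linarith) (by linarith)
    linarith

/-- Links the discrete slopes with the derivative of the envelope, which is affine between the
contacts and so near the centre of the cell. Dividing the flux by `ε` makes a slope per index equal
to a slope in the state variable. -/
theorem convSlope_eq {f : ℝ → ℝ} {ε : ℝ} (hε : 0 < ε) {a b m : ℤ} {σ c : ℝ}
    (h : IsEnvSlope (fun n : ℤ => f (n * ε) / ε) a b m σ) (hc : c = m * ε + ε / 2) :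
    convSlope f ε (a * ε) (b * ε) c = σ := by
  obtain ⟨i, k, hai, him, hmk, hkb, hk, hl⟩ := h
  set A : ℝ := f (i * ε) - σ * (i * ε) with hA
  have hk2 : f (k * ε) = A + σ * (k * ε) := by
    simp only at hk
    have : f (k * ε) = (f (i * ε) / ε + σ * (k - i)) * ε := by rw [← hk]; field_simp
    rw [this, hA]; field_simp; ring
  have hl2 : ∀ n : ℤ, a ≤ n → n ≤ b → A + σ * (n * ε) ≤ f (n * ε) := by
    intro n h1 h2
    have h3 := hl n h1 h2
    rw [le_div_iff₀ hε] at h3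
    have : (f (i * ε) / ε + σ * (n - i)) * ε = A + σ * (n * ε) := by
      rw [hA]; field_simp; ring
    linarith
  have him' : (i * ε : ℝ) ≤ m * ε := mul_le_mul_of_nonneg_right (by exact_mod_cast him) hε.le
  have hmk' : ((m + 1 : ℤ) * ε : ℝ) ≤ k * ε :=
    mul_le_mul_of_nonneg_right (by exact_mod_cast hmk) hε.le
  push_cast at hmk'
  have hev : convEnv (interp f ε) (a * ε) (b * ε) =ᶠ[nhds c] fun w => A + σ * w := by
    filter_upwards [Icc_mem_nhds (a := (i * ε : ℝ)) (b := k * ε) (x := c)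
      (by linarith) (by linarith)] with w hw
    exact convEnv_eq hε hai (by omega) hkb (by rw [hA]; ring) hk2 hl2 hw
  unfold convSlope
  rw [hev.deriv_eq]
  simp

theorem concEnv_eq_neg (g : ℝ → ℝ) (a b u : ℝ) :
    concEnv g a b u = -convEnv (fun w => -g w) a b u := by
  unfold concEnv convEnv
  rw [Real.sInf_def]
  congr 2
  ext y
  simp only [Set.mem_neg, Set.mem_ofPred_eq]
  constructor
  · rintro ⟨h, h1, h2, h3⟩
    exact ⟨-h, h1.neg, fun w hw => neg_le_neg (h2 w hw), by simp [h3]⟩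
  · rintro ⟨h, h1, h2, h3⟩
    exact ⟨-h, h1.neg, fun w hw => by simpa using neg_le_neg (h2 w hw), by simp [h3]⟩

theorem concSlope_eq_neg (f : ℝ → ℝ) (ε a b c : ℝ) :
    concSlope f ε a b c = -convSlope (fun w => -f w) ε a b c := by
  unfold concSlope convSlope
  have h1 : interp (fun w => -f w) ε = fun u => -interp f ε u := by
    ext u; unfold interp; ring
  have h2 : concEnv (interp f ε) a b = fun u => -convEnv (interp (fun w => -f w) ε) a b u := by
    ext u; rw [concEnv_eq_neg, h1]
  rw [h2, deriv.fun_neg]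

/-- The flux on the grid, in the coordinate oriented by the sign `S`. -/
noncomputable def gridFlux (f : ℝ → ℝ) (ε : ℝ) (S n : ℤ) : ℝ := S * f (S * n * ε) / ε

theorem convSlope_gridFlux {f : ℝ → ℝ} {ε : ℝ} (hε : 0 < ε) {a b m : ℤ} {σ c : ℝ}
    (h : IsEnvSlope (gridFlux f ε 1) a b m σ) (hc : c = m * ε + ε / 2) :
    convSlope f ε (a * ε) (b * ε) c = σ := by
  refine convSlope_eq hε ?_ hc
  convert h using 2 with n
  simp [gridFlux]

/-- Argument and value of the flux both change sign, so the slope is preserved while concave becomes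
convex. The cell `[m, m + 1]` is reflected to `[-m - 1, -m]`, whence the index `-m - 1`. -/
theorem concSlope_gridFlux {f : ℝ → ℝ} {ε : ℝ} (hε : 0 < ε) {a b m : ℤ} {σ c : ℝ}
    (h : IsEnvSlope (gridFlux f ε (-1)) a b m σ) (hc : c = -(m * ε + ε / 2)) :
    concSlope f ε ((-b : ℤ) * ε) ((-a : ℤ) * ε) c = σ := by
  rw [concSlope_eq_neg, convSlope_eq (σ := -σ) (m := -m - 1) hε ?_ (by rw [hc]; push_cast; ring),
    neg_neg]
  obtain ⟨i, k, hai, him, hmk, hkb, hk, hl⟩ := h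
  have key : ∀ n : ℤ, -f ((-n : ℤ) * ε) / ε = gridFlux f ε (-1) n := by
    intro n; simp [gridFlux]
  refine ⟨-k, -i, by omega, by omega, by omega, by omega, ?_, fun n h1 h2 => ?_⟩
  · beta_reduce
    rw [key, key]; push_cast; linarith
  · have h3 := hl (-n) (by omega) (by omega)
    have h4 := key (-n)
    rw [neg_neg] at h4
    beta_reduce
    rw [key, h4]
    push_cast at h3 ⊢
    linarith

end WavefrontTracking

namespace WavefrontTracking

/-! ### Representation of a profile by waves -/

open Classical in
/-- The sign of the wave `s` as an integer. -/
noncomputable def sgn (ε : ℝ) (u₀ : ℝ → ℝ) (s : ℕ) : ℤ := if waveSign ε u₀ s = 1 then 1 else -1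

/-- The right state of the wave `s` in units of `ε`. -/
noncomputable def height (ε : ℝ) (u₀ : ℝ → ℝ) (s : ℕ) : ℤ := round (rightState ε u₀ s / ε)

/-- The left end of the cell of the wave `s`, in the coordinate oriented by its sign. -/
noncomputable def cell (ε : ℝ) (u₀ : ℝ → ℝ) (s : ℕ) : ℤ := sgn ε u₀ s * height ε u₀ s - 1

theorem sgn_eq (ε : ℝ) (u₀ : ℝ → ℝ) (s : ℕ) : sgn ε u₀ s = 1 ∨ sgn ε u₀ s = -1 := by
  unfold sgn; split_ifs <;> simp

theorem sgn_mul_self (ε : ℝ) (u₀ : ℝ → ℝ) (s : ℕ) : sgn ε u₀ s * sgn ε u₀ s = 1 := by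
  rcases sgn_eq ε u₀ s with h | h <;> rw [h] <;> norm_num

theorem sgn_ne_zero (ε : ℝ) (u₀ : ℝ → ℝ) (s : ℕ) : sgn ε u₀ s ≠ 0 := by
  rcases sgn_eq ε u₀ s with h | h <;> rw [h] <;> norm_num

theorem height_eq (ε : ℝ) (u₀ : ℝ → ℝ) (s : ℕ) :
    height ε u₀ s = sgn ε u₀ s * (cell ε u₀ s + 1) := by
  unfold cell; linear_combination (-height ε u₀ s) * sgn_mul_self ε u₀ s

/-- The waves of `W`, at the positions `y`, make up the profile `v`. -/
structure IsWaveRep (ε : ℝ) (u₀ v : ℝ → ℝ) (W : Finset ℕ) (y : ℕ → ℝ) : Prop where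
  waveSign_eq : ∀ s ∈ W, waveSign ε u₀ s = sgn ε u₀ s
  rightState_eq : ∀ s ∈ W, rightState ε u₀ s = height ε u₀ s * ε
  val : ∀ x, v x = (∑ s ∈ W with y s ≤ x, sgn ε u₀ s : ℤ) * ε
  mono : ∀ s ∈ W, ∀ s' ∈ W, s ≤ s' → y s ≤ y s'
  same : ∀ s ∈ W, ∀ s' ∈ W, y s = y s' → sgn ε u₀ s = sgn ε u₀ s'
  height_sum : ∀ s ∈ W, height ε u₀ s = ∑ p ∈ W with p ≤ s, sgn ε u₀ p

/-- The left limits of a function with finitely many jumps. -/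
theorem leftLim_sum (B : Finset ℕ) (g : ℕ → ℝ) (c : ℕ → ℤ) (A : ℤ) (ε z : ℝ) :
    Function.leftLim (fun x => ((A + ∑ p ∈ B with g p ≤ x, c p : ℤ) : ℝ) * ε) z =
      (A + ∑ p ∈ B with g p < z, c p : ℤ) * ε := by
  have hev : ∀ᶠ x in nhdsWithin z (Iio z), ∀ p ∈ B, (g p ≤ x ↔ g p < z) := by
    rw [Filter.eventually_all_finset]
    intro p _
    rcases lt_or_ge (g p) z with h | h
    · filter_upwards [Ioo_mem_nhdsLT h] with x hx
      exact ⟨fun _ => h, fun _ => hx.1.le⟩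
    · filter_upwards [self_mem_nhdsWithin] with x hx
      have hx' : x < z := hx
      exact ⟨fun h' => absurd h' (by linarith), fun h' => absurd h' (by linarith)⟩
  apply leftLim_eq_of_tendsto
  apply Filter.Tendsto.congr' _ tendsto_const_nhds
  filter_upwards [hev] with x hx
  rw [Finset.filter_congr (fun p hp => hx p hp)]

theorem IsWaveRep.leftLim {ε : ℝ} {u₀ v : ℝ → ℝ} {W : Finset ℕ} {y : ℕ → ℝ}
    (h : IsWaveRep ε u₀ v W y) (z : ℝ) :
    Function.leftLim v z = (∑ s ∈ W with y s < z, sgn ε u₀ s : ℤ) * ε := by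
  have hv : v = fun x => ((0 + ∑ s ∈ W with y s ≤ x, sgn ε u₀ s : ℤ) : ℝ) * ε := by
    ext x; rw [h.val x, zero_add]
  conv_lhs => rw [hv]
  rw [leftLim_sum, zero_add]

/-! ### Runs of waves of one sign and their consecutive cells. -/

section Heights

variable {ε : ℝ} {u₀ : ℝ → ℝ} {W : Finset ℕ}

/-- The heights of the waves are the partial sums of their signs. -/
def HeightSum (ε : ℝ) (u₀ : ℝ → ℝ) (W : Finset ℕ) : Prop :=
  ∀ s ∈ W, height ε u₀ s = ∑ p ∈ W with p ≤ s, sgn ε u₀ p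

/-- Along a run of one sign every further wave adds that sign to the height, that is, one unit to
the oriented coordinate. -/
theorem HeightSum.cell_sub (h : HeightSum ε u₀ W) {s s' : ℕ} (hs : s ∈ W) (hs' : s' ∈ W)
    (hle : s ≤ s') (hsg : ∀ p ∈ W, s ≤ p → p ≤ s' → sgn ε u₀ p = sgn ε u₀ s) :
    cell ε u₀ s' = cell ε u₀ s + (W.filter fun p => s < p ∧ p ≤ s').card := by
  have h1 : ∑ p ∈ W with p ≤ s', sgn ε u₀ p =
      (∑ p ∈ W with p ≤ s, sgn ε u₀ p) + ∑ p ∈ W with (s < p ∧ p ≤ s'), sgn ε u₀ p := by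
    rw [← Finset.sum_union]
    · congr 1
      ext p
      simp only [Finset.mem_union, Finset.mem_filter]
      constructor
      · rintro ⟨hp, hp'⟩
        rcases le_or_gt p s with h | h
        · exact Or.inl ⟨hp, h⟩
        · exact Or.inr ⟨hp, h, hp'⟩
      · rintro (⟨hp, h⟩ | ⟨hp, h, h'⟩)
        · exact ⟨hp, h.trans hle⟩
        · exact ⟨hp, h'⟩
    · rw [Finset.disjoint_left]
      intro p hp hp'
      simp only [Finset.mem_filter] at hp hp'
      omega
  have h2 : ∑ p ∈ W with (s < p ∧ p ≤ s'), sgn ε u₀ p =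
      (W.filter fun p => s < p ∧ p ≤ s').card * sgn ε u₀ s := by
    rw [Finset.sum_congr rfl (g := fun _ => sgn ε u₀ s), Finset.sum_const, nsmul_eq_mul]
    intro p hp
    simp only [Finset.mem_filter] at hp
    exact hsg p hp.1 hp.2.1.le hp.2.2
  unfold cell
  rw [h s' hs', h1, ← h s hs, h2, hsg s' hs' hle le_rfl]
  linear_combination ((W.filter fun p => s < p ∧ p ≤ s').card : ℤ) * sgn_mul_self ε u₀ s

theorem HeightSum.cell_lt (h : HeightSum ε u₀ W) {s s' : ℕ} (hs : s ∈ W) (hs' : s' ∈ W)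
    (hlt : s < s') (hsg : ∀ p ∈ W, s ≤ p → p ≤ s' → sgn ε u₀ p = sgn ε u₀ s) :
    cell ε u₀ s < cell ε u₀ s' := by
  rw [h.cell_sub hs hs' hlt.le hsg]
  have : 0 < (W.filter fun p => s < p ∧ p ≤ s').card :=
    Finset.card_pos.2 ⟨s', by simp [hs', hlt]⟩
  omega

/-- Neighbouring waves of the same sign have neighbouring cells. -/
theorem HeightSum.cell_succ (h : HeightSum ε u₀ W) {s s' : ℕ} (hs : s ∈ W) (hs' : s' ∈ W)
    (hlt : s < s') (hcons : ∀ p ∈ W, ¬ (s < p ∧ p < s')) (hsg : sgn ε u₀ s' = sgn ε u₀ s) :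
    cell ε u₀ s' = cell ε u₀ s + 1 := by
  rw [h.cell_sub hs hs' hlt.le]
  · have : W.filter (fun p => s < p ∧ p ≤ s') = {s'} := by
      ext p
      simp only [Finset.mem_filter, Finset.mem_singleton]
      constructor
      · rintro ⟨hp, h1, h2⟩
        by_contra hne
        exact hcons p hp ⟨h1, lt_of_le_of_ne h2 hne⟩
      · rintro rfl
        exact ⟨hs', hlt, le_rfl⟩
    rw [this]; simp
  · intro p hp h1 h2
    rcases eq_or_lt_of_le h1 with rfl | h1
    · rfl
    rcases eq_or_lt_of_le h2 with rfl | h2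
    · exact hsg
    · exact absurd ⟨h1, h2⟩ (hcons p hp)

/-- The cells of a block of waves of the same sign fill an interval. -/
theorem HeightSum.image_cell (h : HeightSum ε u₀ W) {s s' : ℕ} (hs : s ∈ W) (hs' : s' ∈ W)
    (hle : s ≤ s') (hsg : ∀ p ∈ W, s ≤ p → p ≤ s' → sgn ε u₀ p = sgn ε u₀ s) :
    (W.filter fun p => s ≤ p ∧ p ≤ s').image (cell ε u₀) =
        Finset.Icc (cell ε u₀ s) (cell ε u₀ s') ∧
      Set.InjOn (cell ε u₀) (W.filter fun p => s ≤ p ∧ p ≤ s' : Finset ℕ) := by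
  have hlt : ∀ p ∈ W, ∀ q ∈ W, s ≤ p → p < q → q ≤ s' → cell ε u₀ p < cell ε u₀ q := by
    intro p hp q hq h1 h2 h3
    refine h.cell_lt hp hq h2 fun r hr h4 h5 => ?_
    rw [hsg r hr (h1.trans h4) (h5.trans h3), hsg p hp h1 (h2.le.trans h3)]
  have hinj : Set.InjOn (cell ε u₀) (W.filter fun p => s ≤ p ∧ p ≤ s' : Finset ℕ) := by
    intro p hp q hq hpq
    simp only [Finset.coe_filter, Set.mem_ofPred_eq] at hp hq
    rcases lt_trichotomy p q with hh | hh | hh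
    · exact absurd hpq (hlt p hp.1 q hq.1 hp.2.1 hh hq.2.2).ne
    · exact hh
    · exact absurd hpq (hlt q hq.1 p hp.1 hq.2.1 hh hp.2.2).ne'
  have hmono : ∀ p ∈ W, ∀ q ∈ W, s ≤ p → p ≤ q → q ≤ s' → cell ε u₀ p ≤ cell ε u₀ q := by
    intro p hp q hq h1 h2 h3
    rcases eq_or_lt_of_le h2 with rfl | h2
    · exact le_rfl
    · exact (hlt p hp q hq h1 h2 h3).le
  refine ⟨Finset.eq_of_subset_of_card_le ?_ ?_, hinj⟩
  · intro n hn
    simp only [Finset.mem_image, Finset.mem_filter] at hn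
    obtain ⟨p, ⟨hp, h1, h2⟩, rfl⟩ := hn
    rw [Finset.mem_Icc]
    exact ⟨hmono s hs p hp le_rfl h1 h2, hmono p hp s' hs' h1 h2 le_rfl⟩
  · rw [Finset.card_image_of_injOn hinj, Int.card_Icc, h.cell_sub hs hs' hle hsg]
    have : (W.filter fun p => s ≤ p ∧ p ≤ s') =
        insert s (W.filter fun p => s < p ∧ p ≤ s') := by
      ext p
      simp only [Finset.mem_insert, Finset.mem_filter]
      constructor
      · rintro ⟨hp, h1, h2⟩
        rcases eq_or_lt_of_le h1 with rfl | h1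
        · exact Or.inl rfl
        · exact Or.inr ⟨hp, h1, h2⟩
      · rintro (rfl | ⟨hp, h1, h2⟩)
        · exact ⟨hs, le_rfl, hle⟩
        · exact ⟨hp, h1.le, h2⟩
    rw [this, Finset.card_insert_of_notMem (by simp)]
    omega

theorem HeightSum.exists_cell_eq (h : HeightSum ε u₀ W) {s s' : ℕ} (hs : s ∈ W) (hs' : s' ∈ W)
    (hle : s ≤ s') (hsg : ∀ p ∈ W, s ≤ p → p ≤ s' → sgn ε u₀ p = sgn ε u₀ s) {n : ℤ}
    (h1 : cell ε u₀ s ≤ n) (h2 : n ≤ cell ε u₀ s') :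
    ∃ p ∈ W, s ≤ p ∧ p ≤ s' ∧ cell ε u₀ p = n := by
  have : n ∈ (W.filter fun p => s ≤ p ∧ p ≤ s').image (cell ε u₀) := by
    rw [(h.image_cell hs hs' hle hsg).1, Finset.mem_Icc]; exact ⟨h1, h2⟩
  simp only [Finset.mem_image, Finset.mem_filter] at this
  obtain ⟨p, ⟨hp, h3, h4⟩, h5⟩ := this
  exact ⟨p, hp, h3, h4, h5⟩

end Heights

/-! ### Jumps of a represented profile and the speeds of their waves. -/

section Rep

variable {f : ℝ → ℝ} {ε : ℝ} {u₀ v : ℝ → ℝ} {W : Finset ℕ} {y : ℕ → ℝ}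

theorem IsWaveRep.lt_of_pos_lt (h : IsWaveRep ε u₀ v W y) {s s' : ℕ} (hs : s ∈ W) (hs' : s' ∈ W)
    (hlt : y s < y s') : s < s' := by
  by_contra hcon
  exact absurd (h.mono s' hs' s hs (by omega)) (by linarith)

/-- First and last wave at the position of a given wave. -/
theorem IsWaveRep.exists_ends (h : IsWaveRep ε u₀ v W y) {s : ℕ} (hs : s ∈ W) :
    ∃ a ∈ W, ∃ b ∈ W, y a = y s ∧ y b = y s ∧ a ≤ s ∧ s ≤ b ∧
      (∀ p ∈ W, y p = y s ↔ a ≤ p ∧ p ≤ b) ∧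
      (∑ p ∈ W with y p < y s, sgn ε u₀ p = sgn ε u₀ s * cell ε u₀ a) ∧
      ∑ p ∈ W with y p ≤ y s, sgn ε u₀ p = sgn ε u₀ s * (cell ε u₀ b + 1) := by
  set B := W.filter fun p => y p = y s with hB
  have hsB : s ∈ B := by simp [hB, hs]
  have hne : B.Nonempty := ⟨s, hsB⟩
  have ha := B.min'_mem hne
  have hb := B.max'_mem hne
  have has : B.min' hne ≤ s := B.min'_le s hsB
  have hsb : s ≤ B.max' hne := B.le_max' s hsB
  have hmin : ∀ p ∈ B, B.min' hne ≤ p := fun p hp => B.min'_le p hp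
  have hmax : ∀ p ∈ B, p ≤ B.max' hne := fun p hp => B.le_max' p hp
  generalize B.min' hne = a at *
  generalize B.max' hne = b at *
  have ha' := ha
  have hb' := hb
  rw [hB, Finset.mem_filter] at ha hb
  have hblock : ∀ p ∈ W, y p = y s ↔ a ≤ p ∧ p ≤ b := by
    intro p hp
    constructor
    · intro hps
      have hpB : p ∈ B := by simp [hB, hp, hps]
      exact ⟨hmin p hpB, hmax p hpB⟩
    · rintro ⟨h1, h2⟩
      have e1 := h.mono a ha.1 p hp h1
      have e2 := h.mono p hp b hb.1 h2
      linarith [ha.2, hb.2]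
  refine ⟨a, ha.1, b, hb.1, ha.2, hb.2, has, hsb, hblock, ?_, ?_⟩
  · have h1 := h.height_sum a ha.1
    have h2 : W.filter (fun p => p ≤ a) = insert a (W.filter fun p => y p < y s) := by
      ext p
      simp only [Finset.mem_insert, Finset.mem_filter]
      constructor
      · rintro ⟨hp, hpa⟩
        rcases eq_or_lt_of_le hpa with rfl | hlt
        · exact Or.inl rfl
        · refine Or.inr ⟨hp, lt_of_le_of_ne ((h.mono p hp a ha.1 hpa).trans ha.2.le) ?_⟩
          intro hps
          have := ((hblock p hp).1 hps).1
          omega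
      · rintro (rfl | ⟨hp, hlt⟩)
        · exact ⟨ha.1, le_rfl⟩
        · exact ⟨hp, (h.lt_of_pos_lt hp ha.1 (by linarith [ha.2])).le⟩
    rw [h2, Finset.sum_insert (by simp [ha.2]), height_eq, h.same a ha.1 s hs ha.2] at h1
    linarith
  · have h1 := h.height_sum b hb.1
    have h2 : W.filter (fun p => p ≤ b) = W.filter fun p => y p ≤ y s := by
      ext p
      simp only [Finset.mem_filter, and_congr_right_iff]
      intro hp
      constructor
      · intro hpb
        exact (h.mono p hp b hb.1 hpb).trans hb.2.le
      · intro hle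
        rcases eq_or_lt_of_le hle with heq | hlt
        · exact ((hblock p hp).1 heq).2
        · exact (h.lt_of_pos_lt hp hb.1 (by linarith [hb.2])).le
    rw [h2, height_eq, h.same b hb.1 s hs hb.2] at h1
    linarith

/-- The speed of a wave is a slope of the envelope over its jump. -/
theorem IsWaveRep.speedAt_eq (hε : 0 < ε) (h : IsWaveRep ε u₀ v W y) {s : ℕ} (hs : s ∈ W)
    {α β : ℤ} (hα : ∑ p ∈ W with y p < y s, sgn ε u₀ p = sgn ε u₀ s * α)
    (hβ : ∑ p ∈ W with y p ≤ y s, sgn ε u₀ p = sgn ε u₀ s * β) {σ : ℝ}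
    (hσ : IsEnvSlope (gridFlux f ε (sgn ε u₀ s)) α β (cell ε u₀ s) σ) :
    speedAt f ε u₀ v (y s) s = σ := by
  unfold speedAt
  rw [h.leftLim, h.val, hα, hβ, h.waveSign_eq s hs, h.rightState_eq s hs, height_eq]
  rcases sgn_eq ε u₀ s with hsg | hsg
  · rw [hsg] at hσ ⊢
    rw [if_pos (by norm_num), one_mul, one_mul, one_mul]
    exact convSlope_gridFlux hε hσ (by push_cast; ring)
  · rw [hsg] at hσ ⊢
    rw [if_neg (by norm_num), neg_one_mul, neg_one_mul, neg_one_mul]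
    exact concSlope_gridFlux hε hσ (by push_cast; ring)

/-- The waves at the position of a given wave, and their speeds. -/
theorem IsWaveRep.exists_jump (f : ℝ → ℝ) (hε : 0 < ε) (h : IsWaveRep ε u₀ v W y) {s : ℕ}
    (hs : s ∈ W) :
    ∃ a ∈ W, ∃ b ∈ W, y a = y s ∧ y b = y s ∧ a ≤ s ∧ s ≤ b ∧
      (∀ p ∈ W, y p = y s ↔ a ≤ p ∧ p ≤ b) ∧
      (∑ p ∈ W with y p < y s, sgn ε u₀ p = sgn ε u₀ s * cell ε u₀ a) ∧
      (∑ p ∈ W with y p ≤ y s, sgn ε u₀ p = sgn ε u₀ s * (cell ε u₀ b + 1)) ∧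
      (∀ p ∈ W, y p = y s → sgn ε u₀ p = sgn ε u₀ s ∧ cell ε u₀ a ≤ cell ε u₀ p ∧
        cell ε u₀ p ≤ cell ε u₀ b ∧
        IsEnvSlope (gridFlux f ε (sgn ε u₀ s)) (cell ε u₀ a) (cell ε u₀ b + 1) (cell ε u₀ p)
          (speedAt f ε u₀ v (y p) p)) ∧
      (∀ n, cell ε u₀ a ≤ n → n ≤ cell ε u₀ b → ∃ p ∈ W, y p = y s ∧ cell ε u₀ p = n) ∧
      (∀ p ∈ W, ∀ q ∈ W, y p = y s → y q = y s → (p ≤ q ↔ cell ε u₀ p ≤ cell ε u₀ q)) := by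
  obtain ⟨a, ha, b, hb, hya, hyb, has, hsb, hblock, hlo, hhi⟩ := h.exists_ends hs
  have hsgn : ∀ p ∈ W, a ≤ p → p ≤ b → sgn ε u₀ p = sgn ε u₀ a := fun p hp h1 h2 =>
    h.same p hp a ha (((hblock p hp).2 ⟨h1, h2⟩).trans hya.symm)
  have himg := HeightSum.image_cell h.height_sum ha hb (has.trans hsb) hsgn
  have hlt : ∀ p ∈ W, ∀ q ∈ W, y p = y s → y q = y s → p < q → cell ε u₀ p < cell ε u₀ q := by
    intro p hp q hq hpy hqy hpq
    refine HeightSum.cell_lt h.height_sum hp hq hpq fun r hr h1 h2 => ?_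
    have hr1 := h.mono p hp r hr h1
    have hr2 := h.mono r hr q hq h2
    exact h.same r hr p hp (by linarith)
  have hle : ∀ p ∈ W, ∀ q ∈ W, y p = y s → y q = y s →
      (p ≤ q ↔ cell ε u₀ p ≤ cell ε u₀ q) := by
    intro p hp q hq hpy hqy
    constructor
    · intro hpq
      rcases eq_or_lt_of_le hpq with rfl | hpq
      · exact le_rfl
      · exact (hlt p hp q hq hpy hqy hpq).le
    · intro hc
      by_contra hcon
      exact absurd (hlt q hq p hp hqy hpy (by omega)) (by omega)
  refine ⟨a, ha, b, hb, hya, hyb, has, hsb, hblock, hlo, hhi, ?_, ?_, hle⟩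
  · intro p hp hpy
    have hsgp := h.same p hp s hs hpy
    have h1 := (hle a ha p hp hya hpy).1 ((hblock p hp).1 hpy).1
    have h2 := (hle p hp b hb hpy hyb).1 ((hblock p hp).1 hpy).2
    obtain ⟨σ, hσ⟩ := exists_isEnvSlope (gridFlux f ε (sgn ε u₀ s)) h1 (Int.lt_add_one_of_le h2)
    refine ⟨hsgp, h1, h2, ?_⟩
    rw [h.speedAt_eq hε hp (α := cell ε u₀ a) (β := cell ε u₀ b + 1) (by rw [hpy, hsgp, hlo])
      (by rw [hpy, hsgp, hhi]) (by rw [hsgp]; exact hσ)]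
    exact hσ
  · intro n h1 h2
    obtain ⟨p, hp, h3, h4, h5⟩ := HeightSum.exists_cell_eq h.height_sum ha hb (has.trans hsb) hsgn
      h1 h2
    exact ⟨p, hp, (hblock p hp).2 ⟨h3, h4⟩, h5⟩

/-- In the oriented coordinate the cells of a jump increase with the label for either sign, and
slopes of a convex envelope increase with the cell. -/
theorem IsWaveRep.speedAt_mono (f : ℝ → ℝ) (hε : 0 < ε) (h : IsWaveRep ε u₀ v W y) {s s' : ℕ}
    (hs : s ∈ W) (hs' : s' ∈ W) (hle : s ≤ s') (hy : y s = y s') :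
    speedAt f ε u₀ v (y s) s ≤ speedAt f ε u₀ v (y s') s' := by
  obtain ⟨a, ha, b, hb, -, -, -, -, -, -, -, hsp, -, hmono⟩ := h.exists_jump f hε hs
  exact (hsp s hs rfl).2.2.2.mono (hsp s' hs' hy.symm).2.2.2 ((hmono s hs s' hs' rfl hy.symm).1 hle)

end Rep

end WavefrontTracking

namespace WavefrontTracking

/-! ### Fronts and their evolution in terms of waves -/

/-- The position after a time `τ` of the wave `p` of the profile `v`. -/
noncomputable def advance (f : ℝ → ℝ) (ε : ℝ) (u₀ v : ℝ → ℝ) (y : ℕ → ℝ) (τ : ℝ) (p : ℕ) : ℝ :=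
  y p + speedAt f ε u₀ v (y p) p * τ

variable {f : ℝ → ℝ} {ε : ℝ} {u₀ v : ℝ → ℝ} {W : Finset ℕ} {y : ℕ → ℝ}

/-- Speeds increase along a jump, so the waves not faster than `ξ` form an initial block. `N` is the
cell just after its last wave, or the first cell of the jump if the block is empty. -/
theorem IsWaveRep.exists_count (hε : 0 < ε) (h : IsWaveRep ε u₀ v W y) {s : ℕ}
    (hs : s ∈ W) {a b : ℕ} (ha : a ∈ W) (hya : y a = y s)
    (hblock : ∀ p ∈ W, y p = y s ↔ a ≤ p ∧ p ≤ b)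
    (hle : ∀ p ∈ W, ∀ q ∈ W, y p = y s → y q = y s → (p ≤ q ↔ cell ε u₀ p ≤ cell ε u₀ q))
    (hb : ∀ p ∈ W, y p = y s → cell ε u₀ a ≤ cell ε u₀ p ∧ cell ε u₀ p ≤ cell ε u₀ b) (ξ : ℝ) :
    ∃ N : ℤ, cell ε u₀ a ≤ N ∧ N ≤ cell ε u₀ b + 1 ∧
      (∑ p ∈ (W.filter fun p => y p = y s) with speedAt f ε u₀ v (y p) p ≤ ξ, sgn ε u₀ p) =
        sgn ε u₀ s * (N - cell ε u₀ a) ∧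
      ∀ p ∈ W, y p = y s → (speedAt f ε u₀ v (y p) p ≤ ξ ↔ cell ε u₀ p < N) := by
  set T := (W.filter fun p => y p = y s).filter fun p => speedAt f ε u₀ v (y p) p ≤ ξ with hT
  have hsum : ∑ p ∈ T, sgn ε u₀ p = T.card * sgn ε u₀ s := by
    rw [Finset.sum_congr rfl (g := fun _ => sgn ε u₀ s), Finset.sum_const, nsmul_eq_mul]
    intro p hp
    simp only [hT, Finset.mem_filter] at hp
    exact h.same p hp.1.1 s hs hp.1.2
  rcases T.eq_empty_or_nonempty with hemp | hne
  · have h1 := hb a ha hya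
    refine ⟨cell ε u₀ a, le_rfl, by omega, ?_, ?_⟩
    · rw [hsum, hemp]; simp
    · intro p hp hpy
      have h2 := hb p hp hpy
      constructor
      · intro hsp
        have : p ∈ T := by simp [hT, hp, hpy]; rwa [← hpy]
        rw [hemp] at this
        simp at this
      · intro hlt; omega
  · have hq := T.max'_mem hne
    have hmax : ∀ p ∈ T, p ≤ T.max' hne := fun p hp => T.le_max' p hp
    generalize T.max' hne = q at *
    simp only [hT, Finset.mem_filter] at hq
    obtain ⟨⟨hqW, hqy⟩, hqξ⟩ := hq
    have haq := ((hblock q hqW).1 hqy).1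
    have hcq := hb q hqW hqy
    have hTeq : T = W.filter fun p => a ≤ p ∧ p ≤ q := by
      ext p
      constructor
      · intro hp
        have h1 := hmax p hp
        simp only [hT, Finset.mem_filter] at hp
        rw [Finset.mem_filter]
        exact ⟨hp.1.1, ((hblock p hp.1.1).1 hp.1.2).1, h1⟩
      · intro hp
        rw [Finset.mem_filter] at hp
        have hpy : y p = y s := (hblock p hp.1).2
          ⟨hp.2.1, hp.2.2.trans ((hblock q hqW).1 hqy).2⟩
        simp only [hT, Finset.mem_filter]
        exact ⟨⟨hp.1, hpy⟩,
          (h.speedAt_mono f hε hp.1 hqW hp.2.2 (hpy.trans hqy.symm)).trans hqξ⟩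
    have himg := HeightSum.image_cell h.height_sum ha hqW haq fun p hp h1 h2 =>
      h.same p hp a ha (((hblock p hp).2
        ⟨h1, h2.trans ((hblock q hqW).1 hqy).2⟩).trans hya.symm)
    have hcard : (T.card : ℤ) = cell ε u₀ q + 1 - cell ε u₀ a := by
      have h1 := Finset.card_image_of_injOn himg.2
      rw [himg.1, Int.card_Icc, ← hTeq] at h1
      omega
    refine ⟨cell ε u₀ q + 1, by omega, by omega, by rw [hsum, hcard]; ring, ?_⟩
    intro p hp hpy
    rw [Int.lt_add_one_iff, ← hle p hp q hqW hpy hqy]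
    constructor
    · intro hsp
      exact hmax p (by simp only [hT, Finset.mem_filter]; exact ⟨⟨hp, hpy⟩, hsp⟩)
    · intro hpq
      exact (h.speedAt_mono f hε hp hqW hpq (hpy.trans hqy.symm)).trans hqξ

/-- The extreme grid value chosen by the Riemann solver is the end of the block of waves not faster
than `ξ`. Thus the state seen along the ray is the left state plus the signs of the waves left
behind the ray. -/
theorem IsWaveRep.riemannAt_eq (hε : 0 < ε) (h : IsWaveRep ε u₀ v W y) (z ξ : ℝ) :
    riemannAt f ε v z ξ = ((∑ p ∈ W with y p < z, sgn ε u₀ p) +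
      ∑ p ∈ (W.filter fun p => y p = z) with speedAt f ε u₀ v (y p) p ≤ ξ, sgn ε u₀ p : ℤ) * ε := by
  by_cases hz : ∃ s ∈ W, y s = z
  · obtain ⟨s, hs, rfl⟩ := hz
    obtain ⟨a, ha, b, hb, hya, hyb, has, hsb, hblock, hlo, hhi, hsp, hsurj, hle⟩ :=
      h.exists_jump f hε hs
    obtain ⟨N, hN1, hN2, hN3, hN4⟩ := h.exists_count (f := f) hε hs ha hya hblock hle
      (fun p hp hpy => ⟨(hsp p hp hpy).2.1, (hsp p hp hpy).2.2.1⟩) ξ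
    have hab := (hsp b hb hyb).2.1
    rw [hN3, hlo]
    unfold riemannAt riemann
    rw [h.leftLim, h.val, hlo, hhi]
    rcases sgn_eq ε u₀ s with hsg | hsg
    · rw [hsg]
      have hcs : ∀ p ∈ W, y p = y s → convSlope f ε (cell ε u₀ a * ε)
          ((cell ε u₀ b + 1 : ℤ) * ε) ((cell ε u₀ p + 1 : ℤ) * ε - ε / 2) =
            speedAt f ε u₀ v (y p) p := by
        intro p hp hpy
        have h1 := (hsp p hp hpy).2.2.2
        rw [hsg] at h1
        exact convSlope_gridFlux hε h1 (by push_cast; ring)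
      simp only [one_mul]
      rw [if_pos (mul_le_mul_of_nonneg_right (by exact_mod_cast (by omega)) hε.le)]
      have : (cell ε u₀ a + (N - cell ε u₀ a) : ℤ) = N := by ring
      rw [this]
      apply IsGreatest.csSup_eq
      constructor
      · rcases eq_or_lt_of_le hN1 with heq | hlt
        · left; rw [heq]
        · right
          obtain ⟨p, hp, hpy, hpc⟩ := hsurj (N - 1) (by omega) (by omega)
          refine ⟨⟨mul_lt_mul_of_pos_right (by exact_mod_cast hlt) hε,
            mul_le_mul_of_nonneg_right (by exact_mod_cast hN2) hε.le⟩, ⟨N, rfl⟩, ?_⟩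
          have h2 := hcs p hp hpy
          rw [hpc, sub_add_cancel] at h2
          rw [h2, hN4 p hp hpy]
          omega
      · rintro w (rfl | ⟨⟨hw1, hw2⟩, ⟨m, rfl⟩, hw3⟩)
        · exact mul_le_mul_of_nonneg_right (by exact_mod_cast hN1) hε.le
        · have hm1 : cell ε u₀ a < m := by exact_mod_cast lt_of_mul_lt_mul_right hw1 hε.le
          have hm2 : m ≤ cell ε u₀ b + 1 := by exact_mod_cast le_of_mul_le_mul_right hw2 hε
          obtain ⟨p, hp, hpy, hpc⟩ := hsurj (m - 1) (by omega) (by omega)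
          have h2 := hcs p hp hpy
          rw [hpc, sub_add_cancel] at h2
          rw [h2, hN4 p hp hpy] at hw3
          exact mul_le_mul_of_nonneg_right (by exact_mod_cast (by omega)) hε.le
    · rw [hsg]
      have hcs : ∀ p ∈ W, y p = y s → concSlope f ε ((-(cell ε u₀ b + 1) : ℤ) * ε)
          ((-cell ε u₀ a : ℤ) * ε) ((-(cell ε u₀ p + 1) : ℤ) * ε + ε / 2) =
            speedAt f ε u₀ v (y p) p := by
        intro p hp hpy
        have h1 := (hsp p hp hpy).2.2.2
        rw [hsg] at h1
        exact concSlope_gridFlux hε h1 (by push_cast; ring)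
      simp only [neg_one_mul]
      rw [if_neg (not_le.2 (mul_lt_mul_of_pos_right (by exact_mod_cast (by omega)) hε))]
      have : (-cell ε u₀ a + -(N - cell ε u₀ a) : ℤ) = -N := by ring
      rw [this]
      apply IsLeast.csInf_eq
      constructor
      · rcases eq_or_lt_of_le hN1 with heq | hlt
        · left; rw [heq]
        · right
          obtain ⟨p, hp, hpy, hpc⟩ := hsurj (N - 1) (by omega) (by omega)
          refine ⟨⟨mul_le_mul_of_nonneg_right (by exact_mod_cast (by omega)) hε.le,
            mul_lt_mul_of_pos_right (by exact_mod_cast (by omega)) hε⟩, ⟨-N, rfl⟩, ?_⟩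
          have h2 := hcs p hp hpy
          rw [hpc, sub_add_cancel] at h2
          rw [h2, hN4 p hp hpy]
          omega
      · rintro w (rfl | ⟨⟨hw1, hw2⟩, ⟨m, rfl⟩, hw3⟩)
        · exact mul_le_mul_of_nonneg_right (by exact_mod_cast (by omega)) hε.le
        · have hm1 : m < -cell ε u₀ a := by exact_mod_cast lt_of_mul_lt_mul_right hw2 hε.le
          have hm2 : -(cell ε u₀ b + 1) ≤ m := by exact_mod_cast le_of_mul_le_mul_right hw1 hε
          -- For a downward jump the grid value `m` is the lower end of the cell whose oriented
          -- index is `-m - 1`.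
          obtain ⟨p, hp, hpy, hpc⟩ := hsurj (-m - 1) (by omega) (by omega)
          have h2 := hcs p hp hpy
          rw [hpc, sub_add_cancel, neg_neg] at h2
          rw [h2, hN4 p hp hpy] at hw3
          exact mul_le_mul_of_nonneg_right (by exact_mod_cast (by omega)) hε.le
  · push Not at hz
    have h1 : W.filter (fun p => y p = z) = ∅ := Finset.filter_eq_empty_iff.2 fun p hp => hz p hp
    have h2 : W.filter (fun p => y p ≤ z) = W.filter fun p => y p < z :=
      Finset.filter_congr fun p hp => ⟨fun hh => lt_of_le_of_ne hh (hz p hp), le_of_lt⟩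
    unfold riemannAt riemann
    rw [h.leftLim, h.val, h1, h2]
    simp

theorem IsWaveRep.frontJump_eq (hε : 0 < ε) (h : IsWaveRep ε u₀ v W y) (w : ℝ × ℝ) :
    frontJump f ε v w =
      (∑ p ∈ W with (y p = w.1 ∧ speedAt f ε u₀ v (y p) p = w.2), sgn ε u₀ p : ℤ) * ε := by
  unfold frontJump
  have h1 : riemannAt f ε v w.1 = fun ξ => ((∑ p ∈ W with y p < w.1, sgn ε u₀ p) +
      ∑ p ∈ (W.filter fun p => y p = w.1) with speedAt f ε u₀ v (y p) p ≤ ξ,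
        sgn ε u₀ p : ℤ) * ε := by
    ext ξ; exact h.riemannAt_eq hε _ _
  rw [h1, leftLim_sum]
  beta_reduce
  rw [← sub_mul, ← Int.cast_sub, add_sub_add_left_eq_sub]
  congr 2
  rw [sub_eq_iff_eq_add, ← Finset.sum_union]
  · congr 1
    ext p
    simp only [Finset.mem_union, Finset.mem_filter, le_iff_lt_or_eq]
    tauto
  · rw [Finset.disjoint_left]
    intro p hp hp'
    simp only [Finset.mem_filter] at hp hp'
    exact absurd hp'.2 (by linarith [hp.2.2])

theorem IsWaveRep.frontJump_wave (hε : 0 < ε) (h : IsWaveRep ε u₀ v W y) {s : ℕ} (hs : s ∈ W) :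
    ∃ n : ℕ, 0 < n ∧
      frontJump f ε v (y s, speedAt f ε u₀ v (y s) s) = n * (sgn ε u₀ s * ε) := by
  refine ⟨(W.filter fun p => y p = y s ∧
    speedAt f ε u₀ v (y p) p = speedAt f ε u₀ v (y s) s).card,
    Finset.card_pos.2 ⟨s, by simp [hs]⟩, ?_⟩
  rw [h.frontJump_eq hε, Finset.sum_congr rfl (g := fun _ => sgn ε u₀ s), Finset.sum_const,
    nsmul_eq_mul]
  · push_cast; ring
  · intro p hp
    simp only [Finset.mem_filter] at hp
    exact h.same p hp.1 s hs hp.2.1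

theorem IsWaveRep.mem_fronts (hε : 0 < ε) (h : IsWaveRep ε u₀ v W y) (w : ℝ × ℝ) :
    w ∈ fronts f ε v ↔ ∃ s ∈ W, w = (y s, speedAt f ε u₀ v (y s) s) := by
  constructor
  · intro hw
    have hw' : frontJump f ε v w ≠ 0 := hw
    rw [h.frontJump_eq hε] at hw'
    by_contra hcon
    push Not at hcon
    apply hw'
    rw [Finset.sum_eq_zero, Int.cast_zero, zero_mul]
    intro p hp
    simp only [Finset.mem_filter] at hp
    exact absurd (Prod.ext hp.2.1.symm hp.2.2.symm) (hcon p hp.1)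
  · rintro ⟨s, hs, rfl⟩
    obtain ⟨n, hn, heq⟩ := h.frontJump_wave (f := f) hε hs
    change frontJump f ε v _ ≠ 0
    rw [heq]
    have h1 : (sgn ε u₀ s : ℝ) ≠ 0 := by exact_mod_cast sgn_ne_zero ε u₀ s
    have h2 : (n : ℝ) ≠ 0 := by exact_mod_cast hn.ne'
    exact mul_ne_zero h2 (mul_ne_zero h1 hε.ne')

/-- The gluing sum is a sum over starting points, and each wave contributes only at its own. For `τ
> 0` the condition that its speed is at most `(x - y) / τ` says that it is at or left of `x` at time
`τ`. -/
theorem IsWaveRep.evolve_eq (hε : 0 < ε) (h : IsWaveRep ε u₀ v W y) {τ : ℝ} (hτ : 0 < τ) (x : ℝ) :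
    evolve f ε v τ x = (∑ p ∈ W with advance f ε u₀ v y τ p ≤ x, sgn ε u₀ p : ℤ) * ε := by
  unfold evolve
  have h1 : ∀ z : ℝ, riemannAt f ε v z ((x - z) / τ) - Function.leftLim v z =
      ((∑ p ∈ (W.filter fun p => advance f ε u₀ v y τ p ≤ x) with y p = z, sgn ε u₀ p : ℤ) : ℝ)
        * ε := by
    intro z
    rw [h.riemannAt_eq hε, h.leftLim, ← sub_mul, ← Int.cast_sub, add_sub_cancel_left]
    congr 3
    ext p
    simp only [Finset.mem_filter]
    constructor
    · rintro ⟨⟨hp, rfl⟩, hsp⟩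
      rw [le_div_iff₀ hτ] at hsp
      exact ⟨⟨hp, by unfold advance; linarith⟩, rfl⟩
    · rintro ⟨⟨hp, hsp⟩, rfl⟩
      refine ⟨⟨hp, rfl⟩, ?_⟩
      rw [le_div_iff₀ hτ]
      unfold advance at hsp
      linarith
  simp_rw [h1]
  rw [finsum_eq_sum_of_support_subset (s := W.image y)]
  · rw [← Finset.sum_mul, ← Int.cast_sum, Finset.sum_fiberwise_of_maps_to]
    intro p hp
    exact Finset.mem_image_of_mem _ (Finset.mem_filter.1 hp).1
  · intro z hz
    rw [Function.mem_support] at hz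
    by_contra hcon
    apply hz
    rw [Finset.sum_eq_zero, Int.cast_zero, zero_mul]
    intro p hp
    simp only [Finset.mem_filter] at hp
    exact absurd (Finset.mem_coe.2 (Finset.mem_image.2 ⟨p, hp.1.1, hp.2⟩)) hcon

theorem IsWaveRep.mem_meetingTimes (hε : 0 < ε) (h : IsWaveRep ε u₀ v W y) (τ : ℝ) :
    τ ∈ meetingTimes f ε v ↔ 0 < τ ∧ ∃ p ∈ W, ∃ q ∈ W,
      (y p ≠ y q ∨ speedAt f ε u₀ v (y p) p ≠ speedAt f ε u₀ v (y q) q) ∧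
      advance f ε u₀ v y τ p = advance f ε u₀ v y τ q := by
  unfold meetingTimes
  rw [Set.mem_ofPred_eq, and_congr_right_iff]
  intro _
  constructor
  · rintro ⟨w, hw, w', hw', hne, heq⟩
    rw [h.mem_fronts hε] at hw hw'
    obtain ⟨p, hp, rfl⟩ := hw
    obtain ⟨q, hq, rfl⟩ := hw'
    refine ⟨p, hp, q, hq, ?_, ?_⟩
    · by_contra hcon
      push Not at hcon
      exact hne (Prod.ext hcon.1 hcon.2)
    · unfold frontPos at heq
      unfold advance
      simp only at heq
      linarith
  · rintro ⟨p, hp, q, hq, hne, heq⟩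
    refine ⟨_, (h.mem_fronts hε _).2 ⟨p, hp, rfl⟩, _, (h.mem_fronts hε _).2 ⟨q, hq, rfl⟩, ?_, ?_⟩
    · intro hcon
      rw [Prod.ext_iff] at hcon
      rcases hne with hne | hne
      · exact hne hcon.1
      · exact hne hcon.2
    · unfold frontPos
      unfold advance at heq
      simp only
      linarith

/-- Waves of different fronts that are to meet have different speeds, so each pair has at most one
meeting time. Finiteness makes the infimum `firstMeeting` an attained one. -/
theorem IsWaveRep.meetingTimes_finite (hε : 0 < ε) (h : IsWaveRep ε u₀ v W y) :
    (meetingTimes f ε v).Finite := by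
  refine ((W ×ˢ W).image fun r : ℕ × ℕ => (y r.2 - y r.1) /
    (speedAt f ε u₀ v (y r.1) r.1 - speedAt f ε u₀ v (y r.2) r.2)).finite_toSet.subset ?_
  intro τ hτ
  obtain ⟨hpos, p, hp, q, hq, hne, heq⟩ := (h.mem_meetingTimes hε τ).1 hτ
  rw [Finset.mem_coe, Finset.mem_image]
  refine ⟨(p, q), Finset.mem_product.2 ⟨hp, hq⟩, ?_⟩
  unfold advance at heq
  have hsp : speedAt f ε u₀ v (y p) p - speedAt f ε u₀ v (y q) q ≠ 0 := by
    intro h0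
    have h1 : speedAt f ε u₀ v (y p) p = speedAt f ε u₀ v (y q) q := by linarith
    rw [h1] at heq
    rcases hne with hne | hne
    · exact hne (by linarith)
    · exact hne h1
  simp only
  rw [div_eq_iff hsp]
  linarith

theorem IsWaveRep.firstMeeting_mem (hε : 0 < ε) (h : IsWaveRep ε u₀ v W y)
    (hne : (meetingTimes f ε v).Nonempty) : firstMeeting f ε v ∈ meetingTimes f ε v :=
  hne.csInf_mem (h.meetingTimes_finite hε)

theorem firstMeeting_le {f : ℝ → ℝ} {ε : ℝ} {v : ℝ → ℝ} {τ : ℝ} (hτ : τ ∈ meetingTimes f ε v) :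
    firstMeeting f ε v ≤ τ :=
  csInf_le ⟨0, fun _ ht => ht.1.le⟩ hτ

theorem IsWaveRep.eq_of_advance_eq (hε : 0 < ε) (h : IsWaveRep ε u₀ v W y) {τ : ℝ} (h0 : 0 < τ)
    (h1 : τ < firstMeeting f ε v) {p q : ℕ} (hp : p ∈ W) (hq : q ∈ W)
    (heq : advance f ε u₀ v y τ p = advance f ε u₀ v y τ q) :
    y p = y q ∧ speedAt f ε u₀ v (y p) p = speedAt f ε u₀ v (y q) q := by
  by_contra hcon
  have := firstMeeting_le ((h.mem_meetingTimes (f := f) hε τ).2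
    ⟨h0, p, hp, q, hq, by tauto, heq⟩)
  linarith

/-- Waves from one point are ordered by speed. Waves from different points could exchange their
order only after a meeting, which would come before the first one. -/
theorem IsWaveRep.advance_mono (hε : 0 < ε) (h : IsWaveRep ε u₀ v W y)
    (hne : (meetingTimes f ε v).Nonempty) {p q : ℕ} (hp : p ∈ W) (hq : q ∈ W) (hpq : p ≤ q) :
    advance f ε u₀ v y (firstMeeting f ε v) p ≤ advance f ε u₀ v y (firstMeeting f ε v) q := by
  have hT := (h.firstMeeting_mem hε hne).1
  set T := firstMeeting f ε v with hTdef
  rcases eq_or_lt_of_le (h.mono p hp q hq hpq) with heq | hlt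
  · have := h.speedAt_mono f hε hp hq hpq heq
    unfold advance
    nlinarith
  · by_contra hcon
    unfold advance at hcon
    push Not at hcon
    set α := speedAt f ε u₀ v (y p) p
    set β := speedAt f ε u₀ v (y q) q
    have hd : 0 < α - β := by
      by_contra h0
      nlinarith
    have h3 : (y q - y p) / (α - β) < T := by
      rw [div_lt_iff₀ hd]; linarith
    have h4 := (h.eq_of_advance_eq (f := f) hε (div_pos (by linarith) hd) h3 hp hq (by
      unfold advance
      change y p + α * _ = y q + β * _
      field_simp
      ring)).1
    linarith

end WavefrontTracking

namespace WavefrontTracking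

/-! ### The first collision -/

/-- The waves `p` and `q` of the profile `v` belong to the same front. -/
def SameFront (f : ℝ → ℝ) (ε : ℝ) (u₀ v : ℝ → ℝ) (y : ℕ → ℝ) (p q : ℕ) : Prop :=
  y p = y q ∧ speedAt f ε u₀ v (y p) p = speedAt f ε u₀ v (y q) q

section

variable {f : ℝ → ℝ} {ε : ℝ} {u₀ v : ℝ → ℝ} {W : Finset ℕ} {y : ℕ → ℝ}

theorem SameFront.symm {p q : ℕ} (h : SameFront f ε u₀ v y p q) : SameFront f ε u₀ v y q p :=
  ⟨h.1.symm, h.2.symm⟩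

theorem SameFront.trans {p q r : ℕ} (h : SameFront f ε u₀ v y p q)
    (h' : SameFront f ε u₀ v y q r) : SameFront f ε u₀ v y p r :=
  ⟨h.1.trans h'.1, h.2.trans h'.2⟩

theorem SameFront.refl (p : ℕ) : SameFront f ε u₀ v y p p := ⟨rfl, rfl⟩

theorem SameFront.advance_eq {p q : ℕ} (h : SameFront f ε u₀ v y p q) (τ : ℝ) :
    advance f ε u₀ v y τ p = advance f ε u₀ v y τ q := by
  unfold advance; rw [h.2, h.1]

theorem IsWaveRep.sameFront_of_between (hε : 0 < ε) (h : IsWaveRep ε u₀ v W y) {p q r : ℕ}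
    (hp : p ∈ W) (hq : q ∈ W) (hr : r ∈ W) (hpq : p ≤ q) (hqr : q ≤ r)
    (hpr : SameFront f ε u₀ v y p r) : SameFront f ε u₀ v y q r := by
  have e1 := h.mono p hp q hq hpq
  have e2 := h.mono q hq r hr hqr
  have e3 : y q = y r := le_antisymm e2 (hpr.1 ▸ e1)
  have e4 := h.speedAt_mono f hε hp hq hpq (hpr.1.trans e3.symm)
  have e5 := h.speedAt_mono f hε hq hr hqr e3
  exact ⟨e3, le_antisymm e5 (hpr.2 ▸ e4)⟩

/-- A front is a block of waves of one sign, whose cells are spanned by a chord of the flux. -/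
theorem IsWaveRep.exists_front_ends (f : ℝ → ℝ) (hε : 0 < ε) (h : IsWaveRep ε u₀ v W y) {s : ℕ}
    (hs : s ∈ W) :
    ∃ a ∈ W, ∃ b ∈ W, SameFront f ε u₀ v y a s ∧ SameFront f ε u₀ v y b s ∧ a ≤ s ∧ s ≤ b ∧
      (∀ p ∈ W, SameFront f ε u₀ v y p s ↔ a ≤ p ∧ p ≤ b) ∧
      (∀ p ∈ W, a ≤ p → p ≤ b → sgn ε u₀ p = sgn ε u₀ s) ∧
      IsChord (gridFlux f ε (sgn ε u₀ s)) (cell ε u₀ a) (cell ε u₀ b + 1)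
        (speedAt f ε u₀ v (y s) s) := by
  classical
  set B := W.filter fun p => SameFront f ε u₀ v y p s with hB
  have hsB : s ∈ B := by rw [hB, Finset.mem_filter]; exact ⟨hs, .refl s⟩
  have hne : B.Nonempty := ⟨s, hsB⟩
  have ha := B.min'_mem hne
  have hb := B.max'_mem hne
  have hmin : ∀ p ∈ B, B.min' hne ≤ p := fun p hp => B.min'_le p hp
  have hmax : ∀ p ∈ B, p ≤ B.max' hne := fun p hp => B.le_max' p hp
  generalize B.min' hne = a at *
  generalize B.max' hne = b at *
  have has := hmin s hsB
  have hsb := hmax s hsB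
  rw [hB, Finset.mem_filter] at ha hb
  have hblock : ∀ p ∈ W, SameFront f ε u₀ v y p s ↔ a ≤ p ∧ p ≤ b := by
    intro p hp
    constructor
    · intro hps
      have hpB : p ∈ B := by rw [hB, Finset.mem_filter]; exact ⟨hp, hps⟩
      exact ⟨hmin p hpB, hmax p hpB⟩
    · rintro ⟨h1, h2⟩
      exact (h.sameFront_of_between hε ha.1 hp hb.1 h1 h2 (ha.2.trans hb.2.symm)).trans hb.2
  refine ⟨a, ha.1, b, hb.1, ha.2, hb.2, has, hsb, hblock, fun p hp h1 h2 =>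
    h.same p hp s hs ((hblock p hp).2 ⟨h1, h2⟩).1, ?_⟩
  obtain ⟨a', ha', b', hb', hya', hyb', -, -, hblock', -, -, hsp, hsurj, hle⟩ :=
    h.exists_jump f hε hs
  have hca := hsp a ha.1 ha.2.1
  have hcb := hsp b hb.1 hb.2.1
  have hab := (hle a ha.1 b hb.1 ha.2.1 hb.2.1).1 (has.trans hsb)
  refine isChord_of_isEnvSlope (a := cell ε u₀ a') (b := cell ε u₀ b' + 1) hca.2.1 (by omega)
    (by omega) fun m h1 h2 => ?_
  obtain ⟨p, hp, hpy, rfl⟩ := hsurj m h1 (by omega)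
  have hpsl := (hsp p hp hpy).2.2.2
  constructor
  · intro hsl
    have hps : SameFront f ε u₀ v y p s := ⟨hpy, hpsl.unique hsl⟩
    obtain ⟨h3, h4⟩ := (hblock p hp).1 hps
    exact ⟨(hle a ha.1 p hp ha.2.1 hpy).1 h3,
      Int.lt_add_one_of_le ((hle p hp b hb.1 hpy hb.2.1).1 h4)⟩
  · rintro ⟨h3, h4⟩
    have hps := (hblock p hp).2 ⟨(hle a ha.1 p hp ha.2.1 hpy).2 h3,
      (hle p hp b hb.1 hpy hb.2.1).2 (by omega)⟩
    rw [← hps.2]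
    exact hpsl

/-- The two fronts colliding at the first collision, represented by one wave of each. -/
theorem IsWaveRep.exists_collision (hε : 0 < ε) (h : IsWaveRep ε u₀ v W y)
    (hne : (meetingTimes f ε v).Nonempty) (hbin : (colliding f ε v).ncard = 2) :
    ∃ a ∈ W, ∃ b ∈ W, y a < y b ∧
      advance f ε u₀ v y (firstMeeting f ε v) a = advance f ε u₀ v y (firstMeeting f ε v) b ∧
      collisionPoints f ε v = {advance f ε u₀ v y (firstMeeting f ε v) a} ∧
      (∀ p ∈ W, advance f ε u₀ v y (firstMeeting f ε v) p =
          advance f ε u₀ v y (firstMeeting f ε v) a →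
        SameFront f ε u₀ v y p a ∨ SameFront f ε u₀ v y p b) ∧
      (∀ p ∈ W, ∀ q ∈ W, advance f ε u₀ v y (firstMeeting f ε v) p =
          advance f ε u₀ v y (firstMeeting f ε v) q →
        SameFront f ε u₀ v y p q ∨ advance f ε u₀ v y (firstMeeting f ε v) p =
          advance f ε u₀ v y (firstMeeting f ε v) a) ∧
      (y a, speedAt f ε u₀ v (y a) a) ∈ colliding f ε v ∧
      (y b, speedAt f ε u₀ v (y b) b) ∈ colliding f ε v := by
  have hT := (h.firstMeeting_mem hε hne).1
  set T := firstMeeting f ε v with hTdef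
  have hadv : ∀ p, advance f ε u₀ v y T p = frontPos (y p, speedAt f ε u₀ v (y p) p) T := by
    intro p; unfold advance frontPos; ring
  -- The cardinality hypothesis gives an unordered pair; the front starting on the left is taken
  -- first.
  suffices key : ∀ w₁ w₂ : ℝ × ℝ, colliding f ε v = {w₁, w₂} → w₁ ≠ w₂ → w₁.1 ≤ w₂.1 →
      ∃ a ∈ W, ∃ b ∈ W, y a < y b ∧ advance f ε u₀ v y T a = advance f ε u₀ v y T b ∧
      collisionPoints f ε v = {advance f ε u₀ v y T a} ∧
      (∀ p ∈ W, advance f ε u₀ v y T p = advance f ε u₀ v y T a →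
        SameFront f ε u₀ v y p a ∨ SameFront f ε u₀ v y p b) ∧
      (∀ p ∈ W, ∀ q ∈ W, advance f ε u₀ v y T p = advance f ε u₀ v y T q →
        SameFront f ε u₀ v y p q ∨ advance f ε u₀ v y T p = advance f ε u₀ v y T a) ∧
      (y a, speedAt f ε u₀ v (y a) a) ∈ colliding f ε v ∧
      (y b, speedAt f ε u₀ v (y b) b) ∈ colliding f ε v by
    obtain ⟨w₁, w₂, hw, heq⟩ := Set.ncard_eq_two.1 hbin
    rcases le_total w₁.1 w₂.1 with hle | hle
    · exact key w₁ w₂ heq hw hle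
    · exact key w₂ w₁ (by rw [heq, Set.pair_comm]) hw.symm hle
  intro w₁ w₂ hcol hw hle
  have hw₁ : w₁ ∈ colliding f ε v := by rw [hcol]; simp
  have hw₂ : w₂ ∈ colliding f ε v := by rw [hcol]; simp
  have hmeet : frontPos w₁ T = frontPos w₂ T := by
    obtain ⟨hf, w', hw', hne', heq'⟩ := hw₁
    have : w' ∈ colliding f ε v := ⟨hw', w₁, hf, hne'.symm, heq'.symm⟩
    rw [hcol] at this
    rcases this with rfl | rfl
    · exact absurd rfl hne'
    · exact heq'
  obtain ⟨a, ha, hwa⟩ := (h.mem_fronts hε w₁).1 hw₁.1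
  obtain ⟨b, hb, hwb⟩ := (h.mem_fronts hε w₂).1 hw₂.1
  have hab : advance f ε u₀ v y T a = advance f ε u₀ v y T b := by
    rw [hadv, hadv, ← hwa, ← hwb, hmeet]
  have hcolf : ∀ p ∈ W, ∀ q ∈ W, advance f ε u₀ v y T p = advance f ε u₀ v y T q →
      ¬ SameFront f ε u₀ v y p q → (y p, speedAt f ε u₀ v (y p) p) ∈ colliding f ε v := by
    intro p hp q hq hpq hnot
    refine ⟨(h.mem_fronts hε _).2 ⟨p, hp, rfl⟩, _, (h.mem_fronts hε _).2 ⟨q, hq, rfl⟩, ?_, ?_⟩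
    · intro hcon
      rw [Prod.ext_iff] at hcon
      exact hnot hcon
    · rw [← hadv, ← hadv]; exact hpq
  have hmem : ∀ p, (y p, speedAt f ε u₀ v (y p) p) ∈ colliding f ε v →
      SameFront f ε u₀ v y p a ∨ SameFront f ε u₀ v y p b := by
    intro p hp
    rw [hcol, hwa, hwb] at hp
    rcases hp with hp | hp
    · left; rw [Prod.ext_iff] at hp; exact hp
    · right; rw [Set.mem_singleton_iff, Prod.ext_iff] at hp; exact hp
  refine ⟨a, ha, b, hb, ?_, hab, ?_, ?_, ?_, by rw [← hwa]; exact hw₁, by rw [← hwb]; exact hw₂⟩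
  -- With a common starting point, meeting again at `T > 0` would force equal speeds, so the fronts
  -- would coincide.
  · have h1 : y a ≤ y b := by rw [hwa, hwb] at hle; exact hle
    refine lt_of_le_of_ne h1 fun heq => hw ?_
    rw [hwa, hwb]
    unfold advance at hab
    rw [heq] at hab ⊢
    have h2 : speedAt f ε u₀ v (y b) a * T = speedAt f ε u₀ v (y b) b * T := by linarith
    rw [mul_right_cancel₀ hT.ne' h2]
  · unfold collisionPoints
    rw [hcol, Set.image_pair, ← hTdef, ← hmeet, Set.pair_eq_singleton, hadv, ← hwa]
  · intro p hp hpa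
    by_cases hsf : SameFront f ε u₀ v y p a
    · exact Or.inl hsf
    · exact hmem p (hcolf p hp a ha hpa hsf)
  · intro p hp q hq hpq
    by_cases hsf : SameFront f ε u₀ v y p q
    · exact Or.inl hsf
    · right
      rcases hmem p (hcolf p hp q hq hpq hsf) with h1 | h1
      · exact h1.advance_eq T
      · rw [h1.advance_eq T, hab]

/-- All waves of a representation survive. -/
theorem IsWaveRep.survives (hε : 0 < ε) (h : IsWaveRep ε u₀ v W y) {s : ℕ} (hs : s ∈ W) :
    Survives ε u₀ v (y s) s := by
  obtain ⟨a, ha, b, hb, hya, hyb, has, hsb, hblock, hlo, hhi⟩ := h.exists_ends hs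
  have hsg : ∀ p ∈ W, a ≤ p → p ≤ b → sgn ε u₀ p = sgn ε u₀ s := fun p hp h1 h2 =>
    h.same p hp s hs ((hblock p hp).2 ⟨h1, h2⟩)
  have h1 : cell ε u₀ a ≤ cell ε u₀ s := by
    rw [HeightSum.cell_sub h.height_sum ha hs has fun p hp h1 h2 => by
      rw [hsg p hp h1 (h2.trans hsb), hsg a ha le_rfl (has.trans hsb)]]
    omega
  have h2 : cell ε u₀ s ≤ cell ε u₀ b := by
    rw [HeightSum.cell_sub h.height_sum hs hb hsb fun p hp h1 h2 => hsg p hp (has.trans h1) h2]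
    omega
  have h1' : (cell ε u₀ a * ε : ℝ) ≤ cell ε u₀ s * ε :=
    mul_le_mul_of_nonneg_right (by exact_mod_cast h1) hε.le
  have h2' : ((cell ε u₀ s + 1) * ε : ℝ) ≤ (cell ε u₀ b + 1) * ε :=
    mul_le_mul_of_nonneg_right (by exact_mod_cast (by omega)) hε.le
  have hss : (sgn ε u₀ s * sgn ε u₀ s : ℝ) = 1 := by exact_mod_cast sgn_mul_self ε u₀ s
  unfold Survives
  rw [h.leftLim, h.val, hlo, hhi, h.waveSign_eq s hs, h.rightState_eq s hs, height_eq]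
  push_cast
  constructor
  · linear_combination h1' + (cell ε u₀ a * ε - (cell ε u₀ s + 1) * ε) * hss
  · linear_combination h2' + ((cell ε u₀ s + 1) * ε - (cell ε u₀ b + 1) * ε) * hss

end

end WavefrontTracking

/-! ### Binary collisions: survival and cancellation of waves. -/

namespace WavefrontTracking

/-- The first collision of fronts of `v` is the one of the front of the waves `a₁, …, a₂` with the
front of the waves `b₁, …, b₂` on its right. -/
structure IsCollision (f : ℝ → ℝ) (ε : ℝ) (u₀ v : ℝ → ℝ) (W : Finset ℕ) (y : ℕ → ℝ)
    (a₁ a₂ b₁ b₂ : ℕ) : Prop where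
  ha₁ : a₁ ∈ W
  ha₂ : a₂ ∈ W
  hb₁ : b₁ ∈ W
  hb₂ : b₂ ∈ W
  ha : a₁ ≤ a₂
  hab : a₂ < b₁
  hb : b₁ ≤ b₂
  mem_iff : ∀ p ∈ W, advance f ε u₀ v y (firstMeeting f ε v) p =
    advance f ε u₀ v y (firstMeeting f ε v) a₁ ↔ a₁ ≤ p ∧ p ≤ b₂
  dichotomy : ∀ p ∈ W, p ≤ a₂ ∨ b₁ ≤ p
  left_iff : ∀ p ∈ W, SameFront f ε u₀ v y p a₁ ↔ a₁ ≤ p ∧ p ≤ a₂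
  right_iff : ∀ p ∈ W, SameFront f ε u₀ v y p b₁ ↔ b₁ ≤ p ∧ p ≤ b₂
  left_sgn : ∀ p ∈ W, a₁ ≤ p → p ≤ a₂ → sgn ε u₀ p = sgn ε u₀ a₁
  right_sgn : ∀ p ∈ W, b₁ ≤ p → p ≤ b₂ → sgn ε u₀ p = sgn ε u₀ b₁
  points : collisionPoints f ε v = {advance f ε u₀ v y (firstMeeting f ε v) a₁}
  single : ∀ p ∈ W, ∀ q ∈ W, advance f ε u₀ v y (firstMeeting f ε v) p =
    advance f ε u₀ v y (firstMeeting f ε v) q → SameFront f ε u₀ v y p q ∨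
      advance f ε u₀ v y (firstMeeting f ε v) p = advance f ε u₀ v y (firstMeeting f ε v) a₁
  pos_lt : y a₁ < y b₁
  speed_lt : speedAt f ε u₀ v (y b₁) b₁ < speedAt f ε u₀ v (y a₁) a₁
  left_chord : IsChord (gridFlux f ε (sgn ε u₀ a₁)) (cell ε u₀ a₁) (cell ε u₀ a₂ + 1)
    (speedAt f ε u₀ v (y a₁) a₁)
  right_chord : IsChord (gridFlux f ε (sgn ε u₀ b₁)) (cell ε u₀ b₁) (cell ε u₀ b₂ + 1)
    (speedAt f ε u₀ v (y b₁) b₁)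
  left_mem : (y a₁, speedAt f ε u₀ v (y a₁) a₁) ∈ colliding f ε v
  right_mem : (y b₁, speedAt f ε u₀ v (y b₁) b₁) ∈ colliding f ε v

variable {f : ℝ → ℝ} {ε : ℝ} {u₀ v : ℝ → ℝ} {W : Finset ℕ} {y : ℕ → ℝ}

theorem IsWaveRep.exists_isCollision (hε : 0 < ε) (h : IsWaveRep ε u₀ v W y)
    (hne : (meetingTimes f ε v).Nonempty) (hbin : (colliding f ε v).ncard = 2) :
    ∃ a₁ a₂ b₁ b₂, IsCollision f ε u₀ v W y a₁ a₂ b₁ b₂ := by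
  have hT := (h.firstMeeting_mem hε hne).1
  have hmono := fun p (hp : p ∈ W) q (hq : q ∈ W) hpq => h.advance_mono (f := f) hε hne hp hq hpq
  obtain ⟨a, ha, b, hb, hyab, hzab, hpts, hcol, hsing, hca, hcb⟩ := h.exists_collision hε hne hbin
  obtain ⟨a₁, ha₁, a₂, ha₂, hsa₁, hsa₂, h1a, h2a, hblA, hsgA, hchA⟩ := h.exists_front_ends f hε ha
  obtain ⟨b₁, hb₁, b₂, hb₂, hsb₁, hsb₂, h1b, h2b, hblB, hsgB, hchB⟩ := h.exists_front_ends f hε hb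
  set T := firstMeeting f ε v
  have hza₁ : advance f ε u₀ v y T a₁ = advance f ε u₀ v y T a := hsa₁.advance_eq T
  have hzb₂ : advance f ε u₀ v y T b₂ = advance f ε u₀ v y T a := by
    rw [hsb₂.advance_eq T, hzab]
  have hab : a₂ < b₁ := h.lt_of_pos_lt ha₂ hb₁ (by rw [hsa₂.1, hsb₁.1]; exact hyab)
  have hmem : ∀ p ∈ W, advance f ε u₀ v y T p = advance f ε u₀ v y T a ↔ a₁ ≤ p ∧ p ≤ b₂ := by
    intro p hp
    constructor
    · intro hpa
      rcases hcol p hp hpa with h1 | h1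
      · have := (hblA p hp).1 h1
        exact ⟨this.1, by omega⟩
      · have := (hblB p hp).1 h1
        exact ⟨by omega, this.2⟩
    · rintro ⟨h1, h2⟩
      have e1 := hmono a₁ ha₁ p hp h1
      have e2 := hmono p hp b₂ hb₂ h2
      exact le_antisymm (e2.trans hzb₂.le) (hza₁ ▸ e1)
  refine ⟨a₁, a₂, b₁, b₂, ha₁, ha₂, hb₁, hb₂, h1a.trans h2a, hab, h1b.trans h2b, ?_, ?_, ?_, ?_,
    ?_, ?_, ?_, ?_, ?_, ?_, ?_, ?_, ?_, ?_⟩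
  · intro p hp; rw [hza₁]; exact hmem p hp
  · intro p hp
    by_contra hcon
    push Not at hcon
    rcases hcol p hp ((hmem p hp).2 ⟨by omega, by omega⟩) with h1 | h1
    · have := (hblA p hp).1 h1; omega
    · have := (hblB p hp).1 h1; omega
  · intro p hp
    rw [← hblA p hp]
    exact ⟨fun h1 => h1.trans hsa₁, fun h1 => h1.trans hsa₁.symm⟩
  · intro p hp
    rw [← hblB p hp]
    exact ⟨fun h1 => h1.trans hsb₁, fun h1 => h1.trans hsb₁.symm⟩
  · intro p hp h1 h2
    rw [hsgA p hp h1 h2, hsgA a₁ ha₁ le_rfl (h1a.trans h2a)]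
  · intro p hp h1 h2
    rw [hsgB p hp h1 h2, hsgB b₁ hb₁ le_rfl (h1b.trans h2b)]
  · rw [hza₁]; exact hpts
  · rw [hza₁]; exact hsing
  · rw [hsa₁.1, hsb₁.1]; exact hyab
  · rw [hsa₁.2, hsb₁.2]
    unfold advance at hzab
    by_contra hcon
    push Not at hcon
    nlinarith [mul_le_mul_of_nonneg_right hcon hT.le]
  · rw [hsa₁.2, hsgA a₁ ha₁ le_rfl (h1a.trans h2a)]; exact hchA
  · rw [hsb₁.2, hsgB b₁ hb₁ le_rfl (h1b.trans h2b)]; exact hchB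
  · rw [hsa₁.2, hsa₁.1]; exact hca
  · rw [hsb₁.2, hsb₁.1]; exact hcb

open Classical in
/-- The waves of `W` that are not removed at the first collision of the profile `v`. -/
noncomputable def survivors (f : ℝ → ℝ) (ε : ℝ) (u₀ v : ℝ → ℝ) (W : Finset ℕ) (y : ℕ → ℝ) :
    Finset ℕ :=
  W.filter fun p => ¬ (advance f ε u₀ v y (firstMeeting f ε v) p ∈ collisionPoints f ε v ∧
    ¬ Survives ε u₀ (evolve f ε v (firstMeeting f ε v))
      (advance f ε u₀ v y (firstMeeting f ε v) p) p)

theorem mem_survivors_iff (p : ℕ) : p ∈ survivors f ε u₀ v W y ↔ p ∈ W ∧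
    ¬ (advance f ε u₀ v y (firstMeeting f ε v) p ∈ collisionPoints f ε v ∧
      ¬ Survives ε u₀ (evolve f ε v (firstMeeting f ε v))
        (advance f ε u₀ v y (firstMeeting f ε v) p) p) := by
  classical
  unfold survivors
  rw [Finset.mem_filter]

section Step

variable {a₁ a₂ b₁ b₂ : ℕ}

/-- At an interaction, all waves survive. -/
theorem IsCollision.isWaveRep_of_sgn_eq (hε : 0 < ε) (h : IsWaveRep ε u₀ v W y)
    (hne : (meetingTimes f ε v).Nonempty) (hc : IsCollision f ε u₀ v W y a₁ a₂ b₁ b₂)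
    (hsg : sgn ε u₀ a₁ = sgn ε u₀ b₁) :
    IsWaveRep ε u₀ (evolve f ε v (firstMeeting f ε v)) W
        (advance f ε u₀ v y (firstMeeting f ε v)) ∧
      survivors f ε u₀ v W y = W := by
  have hT := (h.firstMeeting_mem hε hne).1
  have hrep : IsWaveRep ε u₀ (evolve f ε v (firstMeeting f ε v)) W
        (advance f ε u₀ v y (firstMeeting f ε v)) := by
    refine ⟨h.waveSign_eq, h.rightState_eq, fun x => h.evolve_eq hε hT x, fun s hs s' hs' hle =>
      h.advance_mono hε hne hs hs' hle, ?_, h.height_sum⟩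
    have hC : ∀ p ∈ W, advance f ε u₀ v y (firstMeeting f ε v) p =
        advance f ε u₀ v y (firstMeeting f ε v) a₁ → sgn ε u₀ p = sgn ε u₀ a₁ := by
      intro p hp hpa
      obtain ⟨h1, h2⟩ := (hc.mem_iff p hp).1 hpa
      rcases hc.dichotomy p hp with h3 | h3
      · exact hc.left_sgn p hp h1 h3
      · rw [hc.right_sgn p hp h3 h2, hsg]
    intro s hs s' hs' heq
    rcases hc.single s hs s' hs' heq with h1 | h1
    · exact h.same s hs s' hs' h1.1
    · rw [hC s hs h1, hC s' hs' (heq ▸ h1)]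
  refine ⟨hrep, ?_⟩
  ext p
  rw [mem_survivors_iff]
  exact ⟨And.left, fun hp => ⟨hp, fun hnot => hnot.2 (hrep.survives hε hp)⟩⟩

theorem IsCollision.cell_left_le (h : IsWaveRep ε u₀ v W y)
    (hc : IsCollision f ε u₀ v W y a₁ a₂ b₁ b₂) {p q : ℕ} (hp : p ∈ W) (hq : q ∈ W)
    (h1 : a₁ ≤ p) (h2 : p ≤ q) (h3 : q ≤ a₂) : cell ε u₀ p ≤ cell ε u₀ q := by
  rw [HeightSum.cell_sub h.height_sum hp hq h2 fun r hr h4 h5 => by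
    rw [hc.left_sgn r hr (h1.trans h4) (h5.trans h3), hc.left_sgn p hp h1 (h2.trans h3)]]
  omega

theorem IsCollision.cell_right_le (h : IsWaveRep ε u₀ v W y)
    (hc : IsCollision f ε u₀ v W y a₁ a₂ b₁ b₂) {p q : ℕ} (hp : p ∈ W) (hq : q ∈ W)
    (h1 : b₁ ≤ p) (h2 : p ≤ q) (h3 : q ≤ b₂) : cell ε u₀ p ≤ cell ε u₀ q := by
  rw [HeightSum.cell_sub h.height_sum hp hq h2 fun r hr h4 h5 => by
    rw [hc.right_sgn r hr (h1.trans h4) (h5.trans h3), hc.right_sgn p hp h1 (h2.trans h3)]]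
  omega

/-- The cells of two colliding fronts of opposite sign overlap. -/
theorem IsCollision.cell_right_of_neg (h : IsWaveRep ε u₀ v W y)
    (hc : IsCollision f ε u₀ v W y a₁ a₂ b₁ b₂) (hsg : sgn ε u₀ b₁ = -sgn ε u₀ a₁) :
    cell ε u₀ b₁ = -cell ε u₀ a₂ - 1 := by
  have h1 := h.height_sum b₁ hc.hb₁
  -- No wave lies between `a₂` and `b₁`, so their heights differ by the single sign of `b₁`.
  have h2 : W.filter (fun p => p ≤ b₁) = insert b₁ (W.filter fun p => p ≤ a₂) := by
    ext p
    simp only [Finset.mem_insert, Finset.mem_filter]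
    constructor
    · rintro ⟨hp, hle⟩
      rcases hc.dichotomy p hp with h3 | h3
      · exact Or.inr ⟨hp, h3⟩
      · exact Or.inl (le_antisymm hle h3)
    · rintro (rfl | ⟨hp, h3⟩)
      · exact ⟨hc.hb₁, le_rfl⟩
      · exact ⟨hp, h3.trans hc.hab.le⟩
  have hnot : b₁ ∉ W.filter fun p => p ≤ a₂ := by
    have := hc.hab
    simp only [Finset.mem_filter, not_and]
    omega
  rw [h2, Finset.sum_insert hnot, ← h.height_sum a₂ hc.ha₂,
    height_eq, height_eq ε u₀ a₂, hsg, hc.left_sgn a₂ hc.ha₂ hc.ha le_rfl] at h1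
  have h3 := sgn_ne_zero ε u₀ a₁
  have h4 : sgn ε u₀ a₁ * (cell ε u₀ b₁ + cell ε u₀ a₂ + 1) = 0 := by linarith
  rcases mul_eq_zero.1 h4 with h5 | h5
  · exact absurd h5 h3
  · omega

/-- Which waves survive a collision of two fronts of opposite sign. -/
theorem IsCollision.survives_iff (hε : 0 < ε) (h : IsWaveRep ε u₀ v W y)
    (hne : (meetingTimes f ε v).Nonempty) (hc : IsCollision f ε u₀ v W y a₁ a₂ b₁ b₂)
    (hsg : sgn ε u₀ b₁ = -sgn ε u₀ a₁) {p : ℕ} (hp : p ∈ W) (h1 : a₁ ≤ p) (h2 : p ≤ b₂) :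
    Survives ε u₀ (evolve f ε v (firstMeeting f ε v))
        (advance f ε u₀ v y (firstMeeting f ε v) p) p ↔
      if p ≤ a₂ then cell ε u₀ p < -cell ε u₀ b₂ - 1 else -cell ε u₀ a₁ ≤ cell ε u₀ p := by
  have hT := (h.firstMeeting_mem hε hne).1
  have hmono := fun p (hp : p ∈ W) q (hq : q ∈ W) hpq => h.advance_mono (f := f) hε hne hp hq hpq
  have hmem := hc.mem_iff
  have hev := h.evolve_eq (f := f) hε hT
  set T := firstMeeting f ε v
  set z := advance f ε u₀ v y T with hz
  have hvl : Function.leftLim (evolve f ε v T) (z p) = (sgn ε u₀ a₁ * cell ε u₀ a₁ : ℤ) * ε := by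
    have hv : evolve f ε v T = fun x => ((0 + ∑ s ∈ W with z s ≤ x, sgn ε u₀ s : ℤ) : ℝ) * ε := by
      ext x; rw [hev x, zero_add]
    rw [hv, leftLim_sum, zero_add]
    congr 2
    have e1 := h.height_sum a₁ hc.ha₁
    have e2 : W.filter (fun q => q ≤ a₁) = insert a₁ (W.filter fun q => z q < z p) := by
      ext q
      simp only [Finset.mem_insert, Finset.mem_filter]
      constructor
      · rintro ⟨hq, hle⟩
        rcases eq_or_lt_of_le hle with rfl | hlt
        · exact Or.inl rfl
        · refine Or.inr ⟨hq, lt_of_le_of_ne (hmono q hq p hp (by omega)) fun heq => ?_⟩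
          have := (hmem q hq).1 (heq.trans ((hmem p hp).2 ⟨h1, h2⟩))
          omega
      · rintro (rfl | ⟨hq, hlt⟩)
        · exact ⟨hc.ha₁, le_rfl⟩
        · refine ⟨hq, ?_⟩
          by_contra hcon
          have := hmono a₁ hc.ha₁ q hq (by omega)
          have := (hmem p hp).2 ⟨h1, h2⟩
          linarith
    have e3 : a₁ ∉ W.filter fun q => z q < z p := by
      rw [Finset.mem_filter, (hmem p hp).2 ⟨h1, h2⟩]
      simp
    rw [e2, Finset.sum_insert e3, height_eq] at e1
    linarith
  have hvr : evolve f ε v T (z p) = (-(sgn ε u₀ a₁ * (cell ε u₀ b₂ + 1)) : ℤ) * ε := by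
    rw [hev]
    congr 2
    have e1 := h.height_sum b₂ hc.hb₂
    have e2 : W.filter (fun q => q ≤ b₂) = W.filter fun q => z q ≤ z p := by
      ext q
      simp only [Finset.mem_filter, and_congr_right_iff]
      intro hq
      have hzb : z b₂ = z p := ((hmem b₂ hc.hb₂).2 ⟨h1.trans h2, le_rfl⟩).trans
        ((hmem p hp).2 ⟨h1, h2⟩).symm
      constructor
      · intro hle
        exact (hmono q hq b₂ hc.hb₂ hle).trans hzb.le
      · intro hle
        by_contra hcon
        have e3 := hmono b₂ hc.hb₂ q hq (by omega)
        have e4 : z q = z a₁ := (le_antisymm hle (hzb ▸ e3)).trans ((hmem p hp).2 ⟨h1, h2⟩)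
        have := (hmem q hq).1 e4
        omega
    rw [e2, height_eq, hc.right_sgn b₂ hc.hb₂ hc.hb le_rfl, hsg] at e1
    linarith
  have hss : (sgn ε u₀ a₁ * sgn ε u₀ a₁ : ℝ) = 1 := by exact_mod_cast sgn_mul_self ε u₀ a₁
  unfold Survives
  rw [hvl, hvr, h.waveSign_eq p hp, h.rightState_eq p hp, height_eq]
  have hcast : ∀ m n : ℤ, (m * ε : ℝ) ≤ n * ε ↔ m ≤ n := fun m n =>
    (mul_le_mul_iff_left₀ hε).trans Int.cast_le
  split_ifs with hpa
  · rw [hc.left_sgn p hp h1 hpa]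
    have e1 : ((sgn ε u₀ a₁ : ℤ) : ℝ) * ((sgn ε u₀ a₁ * cell ε u₀ a₁ : ℤ) * ε) =
        (cell ε u₀ a₁ : ℤ) * ε := by
      push_cast; linear_combination (cell ε u₀ a₁ * ε : ℝ) * hss
    have e2 : ((sgn ε u₀ a₁ : ℤ) : ℝ) * ((sgn ε u₀ a₁ * (cell ε u₀ p + 1) : ℤ) * ε) =
        (cell ε u₀ p + 1 : ℤ) * ε := by
      push_cast; linear_combination ((cell ε u₀ p + 1) * ε : ℝ) * hss
    have e3 : ((sgn ε u₀ a₁ : ℤ) : ℝ) * ((-(sgn ε u₀ a₁ * (cell ε u₀ b₂ + 1)) : ℤ) * ε) =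
        (-(cell ε u₀ b₂ + 1) : ℤ) * ε := by
      push_cast; linear_combination (-(cell ε u₀ b₂ + 1) * ε : ℝ) * hss
    have e4 : ((cell ε u₀ p + 1 : ℤ) : ℝ) * ε - ε = (cell ε u₀ p : ℤ) * ε := by push_cast; ring
    rw [e1, e2, e3, e4, hcast, hcast]
    have := hc.cell_left_le h hc.ha₁ hp le_rfl h1 hpa
    omega
  · have hpb : b₁ ≤ p := (hc.dichotomy p hp).resolve_left hpa
    rw [hc.right_sgn p hp hpb h2, hsg]
    have e1 : ((-sgn ε u₀ a₁ : ℤ) : ℝ) * ((sgn ε u₀ a₁ * cell ε u₀ a₁ : ℤ) * ε) =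
        (-cell ε u₀ a₁ : ℤ) * ε := by
      push_cast; linear_combination (-cell ε u₀ a₁ * ε : ℝ) * hss
    have e2 : ((-sgn ε u₀ a₁ : ℤ) : ℝ) * ((-sgn ε u₀ a₁ * (cell ε u₀ p + 1) : ℤ) * ε) =
        (cell ε u₀ p + 1 : ℤ) * ε := by
      push_cast; linear_combination ((cell ε u₀ p + 1) * ε : ℝ) * hss
    have e3 : ((-sgn ε u₀ a₁ : ℤ) : ℝ) * ((-(sgn ε u₀ a₁ * (cell ε u₀ b₂ + 1)) : ℤ) * ε) =
        (cell ε u₀ b₂ + 1 : ℤ) * ε := by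
      push_cast; linear_combination ((cell ε u₀ b₂ + 1) * ε : ℝ) * hss
    have e4 : ((cell ε u₀ p + 1 : ℤ) : ℝ) * ε - ε = (cell ε u₀ p : ℤ) * ε := by push_cast; ring
    rw [e1, e2, e3, e4, hcast, hcast]
    have := hc.cell_right_le h hp hc.hb₂ hpb h2 le_rfl
    omega

theorem IsCollision.mem_survivors (hε : 0 < ε) (h : IsWaveRep ε u₀ v W y)
    (hne : (meetingTimes f ε v).Nonempty) (hc : IsCollision f ε u₀ v W y a₁ a₂ b₁ b₂)
    (hsg : sgn ε u₀ b₁ = -sgn ε u₀ a₁) (p : ℕ) :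
    p ∈ survivors f ε u₀ v W y ↔ p ∈ W ∧ (a₁ ≤ p → p ≤ b₂ →
      if p ≤ a₂ then cell ε u₀ p < -cell ε u₀ b₂ - 1 else -cell ε u₀ a₁ ≤ cell ε u₀ p) := by
  rw [mem_survivors_iff, and_congr_right_iff]
  intro hp
  rw [hc.points, Set.mem_singleton_iff, hc.mem_iff p hp]
  constructor
  · intro hnot h1 h2
    rw [← hc.survives_iff hε h hne hsg hp h1 h2]
    by_contra hcon
    exact hnot ⟨⟨h1, h2⟩, hcon⟩
  · rintro hh ⟨⟨h1, h2⟩, hnot⟩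
    exact hnot ((hc.survives_iff hε h hne hsg hp h1 h2).2 (hh h1 h2))

/-- The signs of the removed waves add up to zero. -/
theorem IsCollision.sum_removed (hε : 0 < ε) (h : IsWaveRep ε u₀ v W y)
    (hne : (meetingTimes f ε v).Nonempty) (hc : IsCollision f ε u₀ v W y a₁ a₂ b₁ b₂)
    (hsg : sgn ε u₀ b₁ = -sgn ε u₀ a₁) :
    ∑ p ∈ W \ survivors f ε u₀ v W y, sgn ε u₀ p = 0 := by
  have hcb := hc.cell_right_of_neg h hsg
  have hca := hc.cell_left_le h hc.ha₁ hc.ha₂ le_rfl hc.ha le_rfl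
  have hcb' := hc.cell_right_le h hc.hb₁ hc.hb₂ le_rfl hc.hb le_rfl
  have imgA := HeightSum.image_cell h.height_sum hc.ha₁ hc.ha₂ hc.ha hc.left_sgn
  have imgB := HeightSum.image_cell h.height_sum hc.hb₁ hc.hb₂ hc.hb hc.right_sgn
  have hab := hc.hab
  have h1a := hc.ha
  have h1b := hc.hb
  have hsplit : W \ survivors f ε u₀ v W y =
      ((W.filter fun p => a₁ ≤ p ∧ p ≤ a₂).filter fun p => -cell ε u₀ b₂ - 1 ≤ cell ε u₀ p) ∪
      ((W.filter fun p => b₁ ≤ p ∧ p ≤ b₂).filter fun p => cell ε u₀ p < -cell ε u₀ a₁) := by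
    ext p
    rw [Finset.mem_sdiff, hc.mem_survivors hε h hne hsg]
    simp only [Finset.mem_union, Finset.mem_filter]
    by_cases hp : p ∈ W
    · rcases hc.dichotomy p hp with h3 | h3
      · simp only [hp, true_and, if_pos h3]; omega
      · rw [if_neg (by omega)]; simp only [hp, true_and]; omega
    · simp [hp]
  have hdisj : Disjoint
      ((W.filter fun p => a₁ ≤ p ∧ p ≤ a₂).filter fun p => -cell ε u₀ b₂ - 1 ≤ cell ε u₀ p)
      ((W.filter fun p => b₁ ≤ p ∧ p ≤ b₂).filter fun p => cell ε u₀ p < -cell ε u₀ a₁) := by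
    rw [Finset.disjoint_left]
    intro p hp hp'
    simp only [Finset.mem_filter] at hp hp'
    omega
  -- Waves of a block are counted through their cells, which fill an integer interval without
  -- repetition.
  have hcard : ∀ (B : Finset ℕ) (lo hi lo' hi' : ℤ) (P : ℤ → Prop) [DecidablePred P],
      B.image (cell ε u₀) = Finset.Icc lo hi → Set.InjOn (cell ε u₀) B →
      (∀ n, (lo ≤ n ∧ n ≤ hi) ∧ P n ↔ lo' ≤ n ∧ n ≤ hi') →
      (B.filter fun p => P (cell ε u₀ p)).card = (hi' + 1 - lo').toNat := by
    intro B lo hi lo' hi' P _ himg hinj hP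
    rw [← Int.card_Icc, ← Finset.card_image_of_injOn (f := cell ε u₀)
      (hinj.mono (by intro p hp; exact (Finset.mem_filter.1 hp).1))]
    congr 1
    ext n
    rw [Finset.mem_Icc, ← hP, ← Finset.mem_Icc, ← himg]
    simp only [Finset.mem_image, Finset.mem_filter]
    constructor
    · rintro ⟨p, ⟨hp, hpp⟩, rfl⟩; exact ⟨⟨p, hp, rfl⟩, hpp⟩
    · rintro ⟨⟨p, hp, rfl⟩, hpp⟩; exact ⟨p, ⟨hp, hpp⟩, rfl⟩
  have cardA := hcard _ _ _ (max (cell ε u₀ a₁) (-cell ε u₀ b₂ - 1)) (cell ε u₀ a₂)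
    (fun n => -cell ε u₀ b₂ - 1 ≤ n) imgA.1 imgA.2 (by intro n; omega)
  have cardB := hcard _ _ _ (cell ε u₀ b₁) (min (cell ε u₀ b₂) (-cell ε u₀ a₁ - 1))
    (fun n => n < -cell ε u₀ a₁) imgB.1 imgB.2 (by intro n; omega)
  rw [hsplit, Finset.sum_union hdisj, Finset.sum_congr rfl (g := fun _ => sgn ε u₀ a₁),
    Finset.sum_const, cardA, Finset.sum_congr rfl (g := fun _ => -sgn ε u₀ a₁), Finset.sum_const,
    cardB, nsmul_eq_mul, nsmul_eq_mul]
  -- By `hcb` the removed cells on the two sides are mirror images of each other: they are the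
  -- overlap of the two jumps.
  · have : (cell ε u₀ a₂ + 1 - max (cell ε u₀ a₁) (-cell ε u₀ b₂ - 1)).toNat =
        (min (cell ε u₀ b₂) (-cell ε u₀ a₁ - 1) + 1 - cell ε u₀ b₁).toNat := by omega
    rw [this]; ring
  · intro p hp
    simp only [Finset.mem_filter] at hp
    rw [hc.right_sgn p hp.1.1 hp.1.2.1 hp.1.2.2, hsg]
  · intro p hp
    simp only [Finset.mem_filter] at hp
    exact hc.left_sgn p hp.1.1 hp.1.2.1 hp.1.2.2

/-- A wave that stays after a cancellation is not in the middle of the removed ones. -/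
theorem IsCollision.removed_block (hε : 0 < ε) (h : IsWaveRep ε u₀ v W y)
    (hne : (meetingTimes f ε v).Nonempty) (hc : IsCollision f ε u₀ v W y a₁ a₂ b₁ b₂)
    (hsg : sgn ε u₀ b₁ = -sgn ε u₀ a₁) {s p q : ℕ} (hs : s ∈ survivors f ε u₀ v W y)
    (hp : p ∈ W \ survivors f ε u₀ v W y) (hq : q ∈ W \ survivors f ε u₀ v W y) (hps : p ≤ s) :
    q < s := by
  have hab := hc.hab
  have hcb' := hc.cell_right_le h hc.hb₁ hc.hb₂ le_rfl hc.hb le_rfl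
  rw [Finset.mem_sdiff] at hp hq
  have hne1 : q ≠ s := by rintro rfl; exact hq.2 hs
  by_contra hcon
  have hsq : s < q := by omega
  have hs' := (hc.mem_survivors hε h hne hsg s).1 hs
  have hp' := hp.2
  have hq' := hq.2
  rw [hc.mem_survivors hε h hne hsg] at hp' hq'
  have hpC : a₁ ≤ p ∧ p ≤ b₂ := by
    by_contra hcon2; exact hp' ⟨hp.1, fun h1 h2 => absurd ⟨h1, h2⟩ hcon2⟩
  have hqC : a₁ ≤ q ∧ q ≤ b₂ := by
    by_contra hcon2; exact hq' ⟨hq.1, fun h1 h2 => absurd ⟨h1, h2⟩ hcon2⟩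
  have hsS := hs'.2 (by omega) (by omega)
  simp only [hp.1, hq.1, hpC, hqC, true_and, forall_true_left] at hp' hq'
  rcases hc.dichotomy s hs'.1 with h3 | h3
  · rw [if_pos h3] at hsS
    rw [if_pos (hps.trans h3)] at hp'
    have := hc.cell_left_le h hp.1 hs'.1 hpC.1 hps h3
    omega
  · rw [if_neg (by omega)] at hsS hq'
    have := hc.cell_right_le h hs'.1 hq.1 h3 hsq.le hqC.2
    omega

/-- After a cancellation, the waves at one point come from one front. -/
theorem IsCollision.sameFront_of_survivors (hε : 0 < ε) (h : IsWaveRep ε u₀ v W y)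
    (hne : (meetingTimes f ε v).Nonempty) (hc : IsCollision f ε u₀ v W y a₁ a₂ b₁ b₂)
    (hsg : sgn ε u₀ b₁ = -sgn ε u₀ a₁) {p q : ℕ} (hp : p ∈ survivors f ε u₀ v W y)
    (hq : q ∈ survivors f ε u₀ v W y) (heq : advance f ε u₀ v y (firstMeeting f ε v) p =
      advance f ε u₀ v y (firstMeeting f ε v) q) : SameFront f ε u₀ v y p q := by
  have hab := hc.hab
  have hp' := (hc.mem_survivors hε h hne hsg p).1 hp
  have hq' := (hc.mem_survivors hε h hne hsg q).1 hq
  rcases hc.single p hp'.1 q hq'.1 heq with h1 | h1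
  · exact h1
  · have hpC := (hc.mem_iff p hp'.1).1 h1
    have hqC := (hc.mem_iff q hq'.1).1 (heq ▸ h1)
    have hpS := hp'.2 hpC.1 hpC.2
    have hqS := hq'.2 hqC.1 hqC.2
    -- Only the front with more waves can keep any of them, so survivors cannot come from both
    -- sides.
    have hmix : ∀ p ∈ W, ∀ q ∈ W, a₁ ≤ p → p ≤ a₂ → b₁ ≤ q → q ≤ b₂ →
        cell ε u₀ p < -cell ε u₀ b₂ - 1 → -cell ε u₀ a₁ ≤ cell ε u₀ q → False := by
      intro p hp q hq h1 h2 h3 h4 h5 h6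
      have := hc.cell_left_le h hc.ha₁ hp le_rfl h1 h2
      have := hc.cell_right_le h hq hc.hb₂ h3 h4 le_rfl
      omega
    rcases hc.dichotomy p hp'.1 with h3 | h3 <;> rcases hc.dichotomy q hq'.1 with h4 | h4
    · exact ((hc.left_iff p hp'.1).2 ⟨hpC.1, h3⟩).trans ((hc.left_iff q hq'.1).2 ⟨hqC.1, h4⟩).symm
    · rw [if_pos h3] at hpS
      rw [if_neg (by omega)] at hqS
      exact (hmix p hp'.1 q hq'.1 hpC.1 h3 h4 hqC.2 hpS hqS).elim
    · rw [if_neg (by omega)] at hpS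
      rw [if_pos h4] at hqS
      exact (hmix q hq'.1 p hp'.1 hqC.1 h4 h3 hpC.2 hqS hpS).elim
    · exact ((hc.right_iff p hp'.1).2 ⟨h3, hpC.2⟩).trans
        ((hc.right_iff q hq'.1).2 ⟨h4, hqC.2⟩).symm

/-- Two waves that stay after a cancellation and are separated by a removed wave are separated by
waves of both signs. -/
theorem IsCollision.exists_between (hε : 0 < ε) (h : IsWaveRep ε u₀ v W y)
    (hne : (meetingTimes f ε v).Nonempty) (hc : IsCollision f ε u₀ v W y a₁ a₂ b₁ b₂)
    (hsg : sgn ε u₀ b₁ = -sgn ε u₀ a₁) {s s' p : ℕ} (hs : s ∈ survivors f ε u₀ v W y)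
    (hs' : s' ∈ survivors f ε u₀ v W y) (hp : p ∈ W \ survivors f ε u₀ v W y) (h1 : s < p)
    (h2 : p < s') : ∃ q ∈ W, ∃ r ∈ W, s < q ∧ q < s' ∧ s < r ∧ r < s' ∧
      sgn ε u₀ q ≠ sgn ε u₀ r := by
  have hcb := hc.cell_right_of_neg h hsg
  have hca := hc.cell_left_le h hc.ha₁ hc.ha₂ le_rfl hc.ha le_rfl
  have hcb' := hc.cell_right_le h hc.hb₁ hc.hb₂ le_rfl hc.hb le_rfl
  have hab := hc.hab
  have h1a := hc.ha
  have h1b := hc.hb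
  -- The adjacent waves `a₂` and `b₁` always cancel, and they provide the two signs.
  have ha₂ : a₂ ∈ W \ survivors f ε u₀ v W y := by
    rw [Finset.mem_sdiff, hc.mem_survivors hε h hne hsg, if_pos le_rfl]
    exact ⟨hc.ha₂, fun hh => by have := hh.2 hc.ha (by omega); omega⟩
  have hb₁ : b₁ ∈ W \ survivors f ε u₀ v W y := by
    rw [Finset.mem_sdiff, hc.mem_survivors hε h hne hsg, if_neg (by omega)]
    exact ⟨hc.hb₁, fun hh => by have := hh.2 (by omega) hc.hb; omega⟩
  have hlow : ∀ q ∈ W \ survivors f ε u₀ v W y, s < q := by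
    intro q hq
    by_contra hcon
    have := hc.removed_block hε h hne hsg hs hq hp (by omega)
    omega
  refine ⟨a₂, hc.ha₂, b₁, hc.hb₁, hlow _ ha₂, hc.removed_block hε h hne hsg hs' hp ha₂ h2.le,
    hlow _ hb₁, hc.removed_block hε h hne hsg hs' hp hb₁ h2.le, ?_⟩
  rw [hsg, hc.left_sgn a₂ hc.ha₂ hc.ha le_rfl]
  have := sgn_ne_zero ε u₀ a₁
  omega

/-- The removed waves sit at one point, no survivor is numbered among them, and their signs add up
to zero. The partial sums of signs that define the values and the heights contain all of them or
none, so deleting them changes nothing. -/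
theorem IsCollision.isWaveRep_of_sgn_neg (hε : 0 < ε) (h : IsWaveRep ε u₀ v W y)
    (hne : (meetingTimes f ε v).Nonempty) (hc : IsCollision f ε u₀ v W y a₁ a₂ b₁ b₂)
    (hsg : sgn ε u₀ b₁ = -sgn ε u₀ a₁) :
    IsWaveRep ε u₀ (evolve f ε v (firstMeeting f ε v)) (survivors f ε u₀ v W y)
        (advance f ε u₀ v y (firstMeeting f ε v)) := by
  have hT := (h.firstMeeting_mem hε hne).1
  have hsub : survivors f ε u₀ v W y ⊆ W := fun p hp =>
    ((hc.mem_survivors hε h hne hsg p).1 hp).1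
  have hzero := hc.sum_removed hε h hne hsg
  have hD : ∀ p ∈ W \ survivors f ε u₀ v W y, advance f ε u₀ v y (firstMeeting f ε v) p =
      advance f ε u₀ v y (firstMeeting f ε v) a₁ := by
    intro p hp
    rw [Finset.mem_sdiff, hc.mem_survivors hε h hne hsg] at hp
    rw [hc.mem_iff p hp.1]
    by_contra hcon2
    exact hp.2 ⟨hp.1, fun h1 h2 => absurd ⟨h1, h2⟩ hcon2⟩
  have hsum : ∀ (P : ℕ → Prop) [DecidablePred P], (∀ p ∈ W \ survivors f ε u₀ v W y, P p) ∨
      (∀ p ∈ W \ survivors f ε u₀ v W y, ¬ P p) →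
      ∑ p ∈ survivors f ε u₀ v W y with P p, sgn ε u₀ p = ∑ p ∈ W with P p, sgn ε u₀ p := by
    intro P _ hP
    have h1 : ∑ p ∈ (W \ survivors f ε u₀ v W y) with P p, sgn ε u₀ p = 0 := by
      rcases hP with hP | hP
      · rw [Finset.filter_true_of_mem hP, hzero]
      · rw [Finset.filter_false_of_mem hP, Finset.sum_empty]
    simp only [Finset.sum_filter] at h1 ⊢
    rw [← Finset.sum_sdiff hsub, h1, zero_add]
  refine ⟨fun s hs => h.waveSign_eq s (hsub hs), fun s hs => h.rightState_eq s (hsub hs), ?_,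
    fun s hs s' hs' hle => h.advance_mono hε hne (hsub hs) (hsub hs') hle, ?_, ?_⟩
  · intro x
    rw [h.evolve_eq hε hT x, hsum]
    by_cases hx : advance f ε u₀ v y (firstMeeting f ε v) a₁ ≤ x
    · left; intro p hp; rw [hD p hp]; exact hx
    · right; intro p hp; rw [hD p hp]; exact hx
  · intro s hs s' hs' heq
    exact h.same s (hsub hs) s' (hsub hs')
      (hc.sameFront_of_survivors hε h hne hsg hs hs' heq).1
  · intro s hs
    rw [h.height_sum s (hsub hs), hsum]
    by_cases hex : ∃ p ∈ W \ survivors f ε u₀ v W y, p ≤ s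
    · obtain ⟨p, hp, hps⟩ := hex
      left; intro q hq
      exact (hc.removed_block hε h hne hsg hs hp hq hps).le
    · right; push Not at hex
      intro p hp; exact not_le.2 (hex p hp)

theorem IsCollision.sgn_cases (_ : IsCollision f ε u₀ v W y a₁ a₂ b₁ b₂) :
    sgn ε u₀ a₁ = sgn ε u₀ b₁ ∨ sgn ε u₀ b₁ = -sgn ε u₀ a₁ := by
  rcases sgn_eq ε u₀ a₁ with h1 | h1 <;> rcases sgn_eq ε u₀ b₁ with h2 | h2 <;> rw [h1, h2] <;>
    simp

theorem IsWaveRep.isWaveRep_survivors (hε : 0 < ε) (h : IsWaveRep ε u₀ v W y)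
    (hne : (meetingTimes f ε v).Nonempty) (hbin : (colliding f ε v).ncard = 2) :
    IsWaveRep ε u₀ (evolve f ε v (firstMeeting f ε v)) (survivors f ε u₀ v W y)
      (advance f ε u₀ v y (firstMeeting f ε v)) := by
  obtain ⟨a₁, a₂, b₁, b₂, hc⟩ := h.exists_isCollision hε hne hbin
  rcases hc.sgn_cases with hsg | hsg
  · obtain ⟨h1, h2⟩ := hc.isWaveRep_of_sgn_eq hε h hne hsg
    rw [h2]; exact h1
  · exact hc.isWaveRep_of_sgn_neg hε h hne hsg

end Step

end WavefrontTracking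

namespace WavefrontTracking

/-! ### The waves of the datum -/

/-- A property that is locally constant on the line and holds somewhere holds everywhere. -/
theorem forall_of_locally_iff {P : ℝ → Prop}
    (h : ∀ x, ∃ l < x, ∃ r, x < r ∧ ∀ y ∈ Ioo l r, P y ↔ P x) {x₀ : ℝ} (h₀ : P x₀) (x : ℝ) :
    P x := by
  -- Taking `Q` true and `Q` false shows that the set where `P` holds is both open and closed.
  have hopen : ∀ Q : Prop, IsOpen {x | P x ↔ Q} := by
    intro Q
    rw [isOpen_iff_mem_nhds]
    intro z hz
    obtain ⟨l, hl, r, hr, hlr⟩ := h z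
    filter_upwards [Ioo_mem_nhds hl hr] with y hy
    exact (hlr y hy).trans hz
  have hclopen : IsClopen {x | P x ↔ True} := by
    refine ⟨⟨?_⟩, hopen True⟩
    have : {x | P x ↔ True}ᶜ = {x | P x ↔ False} := by ext z; simp
    rw [this]
    exact hopen False
  rcases isClopen_iff.1 hclopen with hemp | huniv
  · have : x₀ ∈ {x | P x ↔ True} := iff_true_intro h₀
    rw [hemp] at this
    exact this.elim
  · have : x ∈ {x | P x ↔ True} := by rw [huniv]; trivial
    exact of_iff_true this

section Datum

variable {ε : ℝ} {u₀ : ℝ → ℝ}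

theorem eq_of_abs_sub_lt (hε : 0 < ε) (hgrid : ∀ x, ∃ m : ℤ, u₀ x = m * ε) {x y : ℝ}
    (h : |u₀ x - u₀ y| < ε) : u₀ x = u₀ y := by
  obtain ⟨m, hm⟩ := hgrid x
  obtain ⟨n, hn⟩ := hgrid y
  rw [hm, hn, ← sub_mul, abs_mul, abs_of_pos hε] at h
  have h1 : |(m - n : ℝ)| < 1 := by
    by_contra hcon
    push Not at hcon
    nlinarith
  have h2 : |m - n| < 1 := by exact_mod_cast h1
  have h3 : m = n := by rw [Int.abs_lt_one_iff] at h2; omega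
  rw [hm, hn, h3]

theorem totVar_mono (hBV : BoundedVariationOn u₀ univ) {x y : ℝ} (hxy : x ≤ y) :
    totVar u₀ x ≤ totVar u₀ y :=
  ENNReal.toReal_mono (hBV.mono (subset_univ _)) (eVariationOn.mono _ (Iic_subset_Iic.2 hxy))

/-- The datum and its variation are constant on both sides of each point. -/
theorem exists_constant (hε : 0 < ε) (hgrid : ∀ x, ∃ m : ℤ, u₀ x = m * ε)
    (hBV : BoundedVariationOn u₀ univ) (hright : ∀ x, ContinuousWithinAt u₀ (Ici x) x) (x : ℝ) :
    ∃ l < x, ∃ r, x < r ∧ (∀ y ∈ Ioo l x, u₀ y = Function.leftLim u₀ x ∧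
        totVar u₀ y = totVar u₀ x - |u₀ x - Function.leftLim u₀ x|) ∧
      ∀ y ∈ Ico x r, u₀ y = u₀ x ∧ totVar u₀ y = totVar u₀ x := by
  have hl : ∃ l < x, ∀ y ∈ Ioo l x, u₀ y = Function.leftLim u₀ x := by
    have ht := hBV.tendsto_leftLim x
    have hev : ∀ᶠ y in nhdsWithin x (Iio x), |u₀ y - Function.leftLim u₀ x| < ε / 2 := by
      have := Metric.tendsto_nhds.1 ht (ε / 2) (by linarith)
      simpa [Real.dist_eq] using this
    obtain ⟨l, hl, hsub⟩ := mem_nhdsLT_iff_exists_Ioo_subset.1 hev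
    have hl' : l < x := hl
    have hconst : ∀ y ∈ Ioo l x, u₀ y = u₀ ((l + x) / 2) := by
      intro y hy
      have h1 : |u₀ y - Function.leftLim u₀ x| < ε / 2 := hsub hy
      have h2 : |u₀ ((l + x) / 2) - Function.leftLim u₀ x| < ε / 2 :=
        hsub ⟨by linarith, by linarith⟩
      refine eq_of_abs_sub_lt hε hgrid ?_
      rw [abs_lt] at *
      constructor <;> linarith
    have hlim : Function.leftLim u₀ x = u₀ ((l + x) / 2) := by
      apply leftLim_eq_of_tendsto
      apply Filter.Tendsto.congr' _ tendsto_const_nhds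
      filter_upwards [Ioo_mem_nhdsLT hl'] with y hy
      exact (hconst y hy).symm
    exact ⟨l, hl', fun y hy => by rw [hconst y hy, hlim]⟩
  have hr : ∃ r, x < r ∧ ∀ y ∈ Ico x r, u₀ y = u₀ x := by
    have hev : ∀ᶠ y in nhdsWithin x (Ici x), |u₀ y - u₀ x| < ε := by
      have := Metric.tendsto_nhds.1 (hright x) ε hε
      simpa [Real.dist_eq] using this
    obtain ⟨r, hr, hsub⟩ := mem_nhdsGE_iff_exists_Ico_subset.1 hev
    exact ⟨r, hr, fun y hy => eq_of_abs_sub_lt hε hgrid (hsub hy)⟩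
  obtain ⟨l, hl, hl'⟩ := hl
  obtain ⟨r, hr, hr'⟩ := hr
  refine ⟨l, hl, r, hr, fun y hy => ⟨hl' y hy, ?_⟩, fun y hy => ⟨hr' y hy, ?_⟩⟩
  -- The variation on `[y, x)` vanishes, so up to `x` only the jump at `x` is added to the variation
  -- up to `y`.
  · have h1 : Iio x = Iic y ∪ Ico y x := by
      ext w; simp only [mem_Iio, mem_union, mem_Iic, mem_Ico]
      constructor
      · intro hw; rcases le_total w y with h | h
        · exact Or.inl h
        · exact Or.inr ⟨h, hw⟩
      · rintro (h | h)
        · exact h.trans_lt hy.2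
        · exact h.2
    have h2 : eVariationOn u₀ (Ico y x) = 0 := by
      apply eVariationOn.constant_on
      rintro _ ⟨w, hw, rfl⟩ _ ⟨w', hw', rfl⟩
      rw [hl' w ⟨hy.1.trans_le hw.1, hw.2⟩, hl' w' ⟨hy.1.trans_le hw'.1, hw'.2⟩]
    have h3 := hBV.eVariationOn_Iic_eq_Iio_add_edist (a := x)
    rw [h1, eVariationOn.union u₀ isGreatest_Iic (isLeast_Ico hy.2), h2, add_zero] at h3
    unfold totVar
    rw [h3, ENNReal.toReal_add (hBV.mono (subset_univ _)) (edist_ne_top _ _), edist_dist,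
      ENNReal.toReal_ofReal dist_nonneg, Real.dist_eq]
    ring
  · have h2 : eVariationOn u₀ (Icc x y) = 0 := by
      apply eVariationOn.constant_on
      rintro _ ⟨w, hw, rfl⟩ _ ⟨w', hw', rfl⟩
      rw [hr' w ⟨hw.1, hw.2.trans_lt hy.2⟩, hr' w' ⟨hw'.1, hw'.2.trans_lt hy.2⟩]
    have h3 : eVariationOn u₀ (Iic x ∪ Icc x y) = _ :=
      eVariationOn.union u₀ isGreatest_Iic (isLeast_Icc hy.1)
    rw [Iic_union_Icc_eq_Iic hy.1, h2, add_zero] at h3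
    unfold totVar
    rw [h3]

theorem initPos_eq (hBV : BoundedVariationOn u₀ univ) {l x : ℝ} (hl : l < x) {c : ℝ}
    (hc : ∀ y ∈ Ioo l x, totVar u₀ y = c) {s : ℕ} (h1 : c < ε * s) (h2 : ε * s ≤ totVar u₀ x) :
    initPos ε u₀ s = x := by
  apply IsLeast.csInf_eq
  refine ⟨h2, fun y hy => ?_⟩
  by_contra hcon
  push Not at hcon
  have h3 : totVar u₀ (max y ((l + x) / 2)) = c :=
    hc _ ⟨lt_max_of_lt_right (by linarith), max_lt hcon (by linarith)⟩
  have h4 := totVar_mono hBV (le_max_left y ((l + x) / 2))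
  have hy' : ε * s ≤ totVar u₀ y := hy
  linarith

theorem sgn_of_initPos {s : ℕ} {x : ℝ} (h : initPos ε u₀ s = x)
    (hne : u₀ x - Function.leftLim u₀ x ≠ 0) :
    |u₀ x - Function.leftLim u₀ x| * sgn ε u₀ s = u₀ x - Function.leftLim u₀ x ∧
      waveSign ε u₀ s = sgn ε u₀ s := by
  unfold sgn
  have hw : waveSign ε u₀ s = Real.sign (u₀ x - Function.leftLim u₀ x) := by
    unfold waveSign; rw [h]
  rw [hw]
  rcases lt_or_gt_of_ne hne with h1 | h1
  · rw [Real.sign_of_neg h1, if_neg (by norm_num), abs_of_neg h1]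
    push_cast
    exact ⟨by ring, rfl⟩
  · rw [Real.sign_of_pos h1, if_pos rfl, abs_of_pos h1]
    push_cast
    exact ⟨by ring, rfl⟩

/-- The waves numbered from `m + 1` to `n` all sit at one jump and carry its sign. The factor given
by the size of the jump avoids writing that sign as a quotient. -/
theorem sum_sgn_of_initPos {x : ℝ} (hne : u₀ x - Function.leftLim u₀ x ≠ 0) {m n : ℕ}
    (hmn : m ≤ n) (h : ∀ s, m < s → s ≤ n → initPos ε u₀ s = x) :
    |u₀ x - Function.leftLim u₀ x| * (∑ s ∈ Finset.Icc 1 n, sgn ε u₀ s : ℤ) =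
      |u₀ x - Function.leftLim u₀ x| * (∑ s ∈ Finset.Icc 1 m, sgn ε u₀ s : ℤ) +
        (n - m) * (u₀ x - Function.leftLim u₀ x) := by
  induction n, hmn using Nat.le_induction with
  | base => simp
  | succ k hk ih =>
    rw [Finset.sum_Icc_succ_top (by omega), Int.cast_add, mul_add,
      ih fun s h1 h2 => h s h1 (by omega),
      (sgn_of_initPos (h (k + 1) (by omega) le_rfl) hne).1]
    push_cast; ring

/-- The datum and its variation in terms of the waves. -/
theorem exists_count_datum (hε : 0 < ε) (hgrid : ∀ x, ∃ m : ℤ, u₀ x = m * ε)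
    (hBV : BoundedVariationOn u₀ univ) (hright : ∀ x, ContinuousWithinAt u₀ (Ici x) x)
    (hsupp : HasCompactSupport u₀) (x : ℝ) :
    ∃ n : ℕ, totVar u₀ x = n * ε ∧ u₀ x = (∑ s ∈ Finset.Icc 1 n, sgn ε u₀ s : ℤ) * ε := by
  obtain ⟨R, hR, hzero⟩ := hsupp.exists_pos_le_norm
  -- Connectedness replaces an enumeration of the jumps. The property is locally constant, since
  -- crossing a jump of size `j ε` uses exactly `j` consecutive waves, and it holds with `n = 0` at
  -- `-R`.
  refine forall_of_locally_iff (P := fun x => ∃ n : ℕ, totVar u₀ x = n * ε ∧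
    u₀ x = (∑ s ∈ Finset.Icc 1 n, sgn ε u₀ s : ℤ) * ε) (fun x => ?_) (x₀ := -R) ⟨0, ?_, ?_⟩ x
  · obtain ⟨l, hl, r, hr, hleft, hright'⟩ := exists_constant hε hgrid hBV hright x
    refine ⟨l, hl, r, hr, fun y hy => ?_⟩
    rcases le_or_gt x y with hxy | hxy
    · rw [(hright' y ⟨hxy, hy.2⟩).1, (hright' y ⟨hxy, hy.2⟩).2]
    · obtain ⟨h1, h2⟩ := hleft y ⟨hy.1, hxy⟩
      by_cases hJ : u₀ x - Function.leftLim u₀ x = 0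
      · rw [h2, h1, hJ, abs_zero, sub_zero, show Function.leftLim u₀ x = u₀ x by linarith]
      obtain ⟨k₁, hk₁⟩ := hgrid x
      obtain ⟨k₂, hk₂⟩ := hgrid y
      have hJk : u₀ x - Function.leftLim u₀ x = (k₁ - k₂ : ℤ) * ε := by
        rw [← h1, hk₁, hk₂]; push_cast; ring
      have hJa : |u₀ x - Function.leftLim u₀ x| = ((k₁ - k₂).natAbs : ℝ) * ε := by
        rw [hJk, abs_mul, abs_of_pos hε, Nat.cast_natAbs, Int.cast_abs]
      have hJpos : 0 < |u₀ x - Function.leftLim u₀ x| := abs_pos.2 hJ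
      set j := (k₁ - k₂).natAbs with hj
      have hnum : ∀ n : ℕ, totVar u₀ y = n * ε →
          (∑ s ∈ Finset.Icc 1 (n + j), sgn ε u₀ s : ℤ) * ε =
            (∑ s ∈ Finset.Icc 1 n, sgn ε u₀ s : ℤ) * ε + (u₀ x - Function.leftLim u₀ x) := by
        intro n hn
        have h3 := sum_sgn_of_initPos hJ (Nat.le_add_right n j) fun s hs1 hs2 =>
          initPos_eq (ε := ε) hBV hl (c := n * ε)
            (fun w hw => by rw [(hleft w hw).2, ← h2, hn])
            (by rw [mul_comm ε]; exact mul_lt_mul_of_pos_right (by exact_mod_cast hs1) hε)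
            (by
              have h4 : totVar u₀ x = ((n + j : ℕ) : ℝ) * ε := by
                push_cast; linarith
              rw [h4, mul_comm ε]
              exact mul_le_mul_of_nonneg_right (by exact_mod_cast hs2) hε.le)
        have h5 : (((n + j : ℕ) : ℝ) - n) * ε = |u₀ x - Function.leftLim u₀ x| := by
          rw [hJa]; push_cast; ring
        have h6 : |u₀ x - Function.leftLim u₀ x| *
            ((∑ s ∈ Finset.Icc 1 (n + j), sgn ε u₀ s : ℤ) * ε) =
            |u₀ x - Function.leftLim u₀ x| * ((∑ s ∈ Finset.Icc 1 n, sgn ε u₀ s : ℤ) * ε +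
              (u₀ x - Function.leftLim u₀ x)) := by
          linear_combination ε * h3 + (u₀ x - Function.leftLim u₀ x) * h5
        exact mul_left_cancel₀ hJpos.ne' h6
      constructor
      · rintro ⟨n, hn1, hn2⟩
        refine ⟨n + j, by push_cast; linarith, ?_⟩
        rw [hnum n hn1, ← hn2, h1]; ring
      · rintro ⟨n, hn1, hn2⟩
        -- Going back across the jump takes `j` waves away; the variation before the jump is
        -- nonnegative, so there are that many.
        have hjn : j ≤ n := by
          have h3 : 0 ≤ totVar u₀ y := ENNReal.toReal_nonneg
          rw [h2, hn1, hJa, ← sub_mul] at h3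
          have h4 := nonneg_of_mul_nonneg_left h3 hε
          exact_mod_cast (sub_nonneg.1 h4)
        have h5 : totVar u₀ y = (n - j : ℕ) * ε := by
          rw [h2, hn1, hJa]; push_cast [hjn]; ring
        refine ⟨n - j, h5, ?_⟩
        have h6 := hnum (n - j) h5
        rw [Nat.sub_add_cancel hjn, ← hn2] at h6
        rw [h1]; linarith
  · unfold totVar
    rw [eVariationOn.constant_on]
    · simp
    · rintro _ ⟨w, hw, rfl⟩ _ ⟨w', hw', rfl⟩
      have hw1 : w ≤ -R := hw
      have hw2 : w' ≤ -R := hw'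
      rw [hzero w (by rw [Real.norm_eq_abs, abs_of_neg (by linarith)]; linarith),
        hzero w' (by rw [Real.norm_eq_abs, abs_of_neg (by linarith)]; linarith)]
  · rw [hzero _ (by rw [norm_neg, Real.norm_eq_abs, abs_of_pos hR])]
    simp

theorem totVar_le (hBV : BoundedVariationOn u₀ univ) (x : ℝ) :
    totVar u₀ x ≤ (eVariationOn u₀ univ).toReal :=
  ENNReal.toReal_mono hBV (eVariationOn.mono _ (subset_univ _))

/-- The initial position of a wave is the point where its variation is reached. -/
theorem isLeast_initPos (hε : 0 < ε) (hgrid : ∀ x, ∃ m : ℤ, u₀ x = m * ε)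
    (hBV : BoundedVariationOn u₀ univ) (hright : ∀ x, ContinuousWithinAt u₀ (Ici x) x)
    (hsupp : HasCompactSupport u₀) {s : ℕ} (hs : s ∈ waves ε u₀) :
    IsLeast {x | ε * s ≤ totVar u₀ x} (initPos ε u₀ s) := by
  obtain ⟨R, hR, hzero⟩ := hsupp.exists_pos_le_norm
  have hs' := Finset.mem_Icc.1 hs
  have hsε : ε * s ≤ (eVariationOn u₀ univ).toReal := by
    have h1 : (s : ℝ) ≤ (eVariationOn u₀ univ).toReal / ε :=
      (Nat.le_floor_iff (div_nonneg ENNReal.toReal_nonneg hε.le)).1 hs'.2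
    rw [le_div_iff₀ hε] at h1
    linarith
  have hspos : (0 : ℝ) < ε * s := mul_pos hε (by exact_mod_cast hs'.1)
  have hne : {x | ε * s ≤ totVar u₀ x}.Nonempty := by
    refine ⟨R, ?_⟩
    have h1 : eVariationOn u₀ (Iic R ∪ Ici R) = _ :=
      eVariationOn.union u₀ isGreatest_Iic isLeast_Ici
    rw [Iic_union_Ici, eVariationOn.constant_on (f := u₀) (s := Ici R), add_zero] at h1
    · change _ ≤ totVar u₀ R
      unfold totVar
      rw [← h1]; exact hsε
    · rintro _ ⟨w, hw, rfl⟩ _ ⟨w', hw', rfl⟩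
      have hw1 : R ≤ w := hw
      have hw2 : R ≤ w' := hw'
      rw [hzero w (by rw [Real.norm_eq_abs, abs_of_pos (by linarith)]; linarith),
        hzero w' (by rw [Real.norm_eq_abs, abs_of_pos (by linarith)]; linarith)]
  have hbdd : BddBelow {x | ε * s ≤ totVar u₀ x} := by
    refine ⟨-R, fun x hx => ?_⟩
    by_contra hcon
    push Not at hcon
    have hx' : ε * s ≤ totVar u₀ x := hx
    have h0 : totVar u₀ x = 0 := by
      unfold totVar
      rw [eVariationOn.constant_on]
      · simp
      · rintro _ ⟨w, hw, rfl⟩ _ ⟨w', hw', rfl⟩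
        have hw1 : w ≤ x := hw
        have hw2 : w' ≤ x := hw'
        rw [hzero w (by rw [Real.norm_eq_abs, abs_of_neg (by linarith)]; linarith),
          hzero w' (by rw [Real.norm_eq_abs, abs_of_neg (by linarith)]; linarith)]
    linarith
  refine ⟨?_, fun x hx => csInf_le hbdd hx⟩
  -- The variation is constant immediately to the right of the infimum and some point of the set
  -- lies there, so the infimum is attained.
  obtain ⟨l, hl, r, hr, -, hright'⟩ := exists_constant hε hgrid hBV hright (initPos ε u₀ s)
  obtain ⟨w, hw, hwr⟩ := exists_lt_of_csInf_lt hne hr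
  have hw2 : initPos ε u₀ s ≤ w := csInf_le hbdd hw
  change _ ≤ totVar u₀ _
  rw [← (hright' w ⟨hw2, hwr⟩).2]
  exact hw

/-- The waves of the datum make up the datum. -/
theorem isWaveRep_datum (hε : 0 < ε) (hgrid : ∀ x, ∃ m : ℤ, u₀ x = m * ε)
    (hBV : BoundedVariationOn u₀ univ) (hright : ∀ x, ContinuousWithinAt u₀ (Ici x) x)
    (hsupp : HasCompactSupport u₀) : IsWaveRep ε u₀ u₀ (waves ε u₀) (initPos ε u₀) := by
  have hiff : ∀ s ∈ waves ε u₀, ∀ x, initPos ε u₀ s ≤ x ↔ ε * s ≤ totVar u₀ x := by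
    intro s hs x
    have hl := isLeast_initPos hε hgrid hBV hright hsupp hs
    exact ⟨fun h => le_trans hl.1 (totVar_mono hBV h), fun h => hl.2 h⟩
  have key : ∀ s ∈ waves ε u₀, waveSign ε u₀ s = sgn ε u₀ s ∧
      rightState ε u₀ s = (∑ p ∈ Finset.Icc 1 s, sgn ε u₀ p : ℤ) * ε := by
    intro s hs
    have hlst := isLeast_initPos hε hgrid hBV hright hsupp hs
    obtain ⟨l, hl, r, hr, hleft, -⟩ := exists_constant hε hgrid hBV hright (initPos ε u₀ s)
    set x := initPos ε u₀ s with hx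
    have hsx : ε * s ≤ totVar u₀ x := hlst.1
    -- The midpoint samples the constant state left of the jump: `n` waves are used up before `x`,
    -- and `s` is one of those sitting at `x`.
    obtain ⟨n, hn1, hn2⟩ := exists_count_datum hε hgrid hBV hright hsupp ((l + x) / 2)
    have hmid : (l + x) / 2 ∈ Ioo l x := ⟨by linarith, by linarith⟩
    have hlow : ∀ y ∈ Ioo l x, totVar u₀ y = n * ε := by
      intro y hy; rw [(hleft y hy).2, ← (hleft _ hmid).2, hn1]
    have hns : (n : ℝ) * ε < ε * s := by
      by_contra hcon
      push Not at hcon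
      have := hlst.2 (show (l + x) / 2 ∈ {x | ε * s ≤ totVar u₀ x} by
        change _ ≤ totVar u₀ _; rw [hn1]; exact hcon)
      linarith [hmid.2]
    have hns' : n < s := by
      rw [mul_comm ε] at hns
      exact_mod_cast lt_of_mul_lt_mul_right hns hε.le
    have hJ : u₀ x - Function.leftLim u₀ x ≠ 0 := by
      intro h0
      have h1 := (hleft _ hmid).2
      rw [h0, abs_zero, sub_zero, hn1] at h1
      linarith
    have hpos : ∀ p, n < p → p ≤ s → initPos ε u₀ p = x := by
      intro p h1 h2
      refine initPos_eq hBV hl hlow ?_ (le_trans ?_ hsx)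
      · rw [mul_comm ε]; exact mul_lt_mul_of_pos_right (by exact_mod_cast h1) hε
      · exact mul_le_mul_of_nonneg_left (by exact_mod_cast h2) hε.le
    have hsg := sgn_of_initPos hx.symm hJ
    refine ⟨hsg.2, ?_⟩
    have hll : Function.leftLim (totVar u₀) x = n * ε := by
      apply leftLim_eq_of_tendsto
      apply Filter.Tendsto.congr' _ tendsto_const_nhds
      filter_upwards [Ioo_mem_nhdsLT hl] with y hy
      exact (hlow y hy).symm
    have hul : Function.leftLim u₀ x = (∑ p ∈ Finset.Icc 1 n, sgn ε u₀ p : ℤ) * ε := by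
      rw [← hn2, (hleft _ hmid).1]
    have hsum := sum_sgn_of_initPos hJ hns'.le hpos
    have hJpos : 0 < |u₀ x - Function.leftLim u₀ x| := abs_pos.2 hJ
    unfold rightState
    rw [← hx, hll, hsg.2, hul]
    refine mul_left_cancel₀ hJpos.ne' ?_
    linear_combination (ε * s - n * ε) * hsg.1 - ε * hsum
  have hheight : ∀ s ∈ waves ε u₀, height ε u₀ s = ∑ p ∈ Finset.Icc 1 s, sgn ε u₀ p := by
    intro s hs
    unfold height
    rw [(key s hs).2, mul_div_cancel_right₀ _ hε.ne', round_intCast]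
  refine ⟨fun s hs => (key s hs).1, fun s hs => ?_, fun x => ?_, fun s hs s' hs' hle => ?_,
    fun s hs s' hs' heq => ?_, fun s hs => ?_⟩
  · rw [(key s hs).2, hheight s hs]
  · obtain ⟨n, hn1, hn2⟩ := exists_count_datum hε hgrid hBV hright hsupp x
    rw [hn2]
    congr 3
    ext s
    rw [Finset.mem_filter]
    have hle : ε * s ≤ totVar u₀ x ↔ s ≤ n := by
      rw [hn1, mul_comm ε, mul_le_mul_iff_left₀ hε, Nat.cast_le]
    constructor
    · intro hs
      have hs' := Finset.mem_Icc.1 hs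
      have hsw : s ∈ waves ε u₀ := by
        refine Finset.mem_Icc.2 ⟨hs'.1, Nat.le_floor ?_⟩
        rw [le_div_iff₀ hε, mul_comm]
        exact (hle.2 hs'.2).trans (totVar_le hBV x)
      exact ⟨hsw, (hiff s hsw x).2 (hle.2 hs'.2)⟩
    · rintro ⟨hs, hsx⟩
      exact Finset.mem_Icc.2 ⟨(Finset.mem_Icc.1 hs).1, hle.1 ((hiff s hs x).1 hsx)⟩
  · rw [hiff s hs]
    have h1 : ε * s' ≤ totVar u₀ (initPos ε u₀ s') :=
      (isLeast_initPos hε hgrid hBV hright hsupp hs').1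
    refine le_trans (mul_le_mul_of_nonneg_left (by exact_mod_cast hle) hε.le) h1
  · unfold sgn waveSign
    rw [heq]
  · rw [hheight s hs]
    congr 1
    ext p
    have h2 := Finset.mem_Icc.1 hs
    unfold waves
    rw [Finset.mem_filter, Finset.mem_Icc, Finset.mem_Icc]
    omega

end Datum

end WavefrontTracking

/-! ### Speeds after an interaction, and the sequence of collision stages. -/

namespace WavefrontTracking

theorem IsWaveRep.congr {ε : ℝ} {u₀ v : ℝ → ℝ} {W : Finset ℕ} {y y' : ℕ → ℝ}
    (h : IsWaveRep ε u₀ v W y) (heq : ∀ s ∈ W, y' s = y s) : IsWaveRep ε u₀ v W y' := by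
  refine ⟨h.waveSign_eq, h.rightState_eq, fun x => ?_, fun s hs s' hs' hle => ?_,
    fun s hs s' hs' hy => ?_, h.height_sum⟩
  · rw [h.val x]
    congr 3
    exact Finset.filter_congr fun s hs => by rw [heq s hs]
  · rw [heq s hs, heq s' hs']; exact h.mono s hs s' hs' hle
  · rw [heq s hs, heq s' hs'] at hy; exact h.same s hs s' hs' hy

/-- If the flux over a jump is above its chord, all waves of the jump have the chord speed. -/
theorem IsWaveRep.speedAt_of_isChord {f : ℝ → ℝ} {ε : ℝ} {u₀ v : ℝ → ℝ} {W : Finset ℕ}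
    {y : ℕ → ℝ} (hε : 0 < ε) (h : IsWaveRep ε u₀ v W y) {s a b : ℕ} (hs : s ∈ W) (ha : a ∈ W)
    (hb : b ∈ W) (has : a ≤ s) (hsb : s ≤ b) (hblock : ∀ p ∈ W, y p = y s ↔ a ≤ p ∧ p ≤ b) {ρ : ℝ}
    (hch : IsChord (gridFlux f ε (sgn ε u₀ s)) (cell ε u₀ a) (cell ε u₀ b + 1) ρ) :
    speedAt f ε u₀ v (y s) s = ρ := by
  obtain ⟨a', ha', b', hb', hya', hyb', -, -, hblock', -, -, hsp, -, -⟩ := h.exists_jump f hε hs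
  have haa : a' = a := le_antisymm
    ((hblock' a ha).1 ((hblock a ha).2 ⟨le_rfl, has.trans hsb⟩)).1 ((hblock a' ha').1 hya').1
  have hbb : b' = b := le_antisymm ((hblock b' hb').1 hyb').2
    ((hblock' b hb).1 ((hblock b hb).2 ⟨has.trans hsb, le_rfl⟩)).2
  subst haa hbb
  obtain ⟨-, h1, h2, h3⟩ := hsp s hs rfl
  exact h3.unique (hch.isEnvSlope h1 (Int.lt_add_one_of_le h2))

/-- Speeds after an interaction. -/
theorem IsCollision.speedAt_of_sgn_eq {f : ℝ → ℝ} {ε : ℝ} {u₀ v : ℝ → ℝ} {W : Finset ℕ}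
    {y : ℕ → ℝ} {a₁ a₂ b₁ b₂ : ℕ} (hε : 0 < ε) (h : IsWaveRep ε u₀ v W y)
    (hne : (meetingTimes f ε v).Nonempty) (hc : IsCollision f ε u₀ v W y a₁ a₂ b₁ b₂)
    (hsg : sgn ε u₀ a₁ = sgn ε u₀ b₁) {z : ℕ → ℝ}
    (hz : ∀ s ∈ W, z s = advance f ε u₀ v y (firstMeeting f ε v) s) :
    cell ε u₀ b₁ = cell ε u₀ a₂ + 1 ∧
    IsChord (gridFlux f ε (sgn ε u₀ a₁)) (cell ε u₀ a₁) (cell ε u₀ b₂ + 1)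
      ((speedAt f ε u₀ v (y a₁) a₁ * (cell ε u₀ b₁ - cell ε u₀ a₁) +
        speedAt f ε u₀ v (y b₁) b₁ * (cell ε u₀ b₂ + 1 - cell ε u₀ b₁)) /
          (cell ε u₀ b₂ + 1 - cell ε u₀ a₁)) ∧
    (∀ p ∈ W, a₁ ≤ p → p ≤ b₂ →
      speedAt f ε u₀ (evolve f ε v (firstMeeting f ε v)) (z p) p =
        (speedAt f ε u₀ v (y a₁) a₁ * (cell ε u₀ b₁ - cell ε u₀ a₁) +
          speedAt f ε u₀ v (y b₁) b₁ * (cell ε u₀ b₂ + 1 - cell ε u₀ b₁)) /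
            (cell ε u₀ b₂ + 1 - cell ε u₀ a₁)) ∧
    ∀ p ∈ W, ¬ (a₁ ≤ p ∧ p ≤ b₂) →
      speedAt f ε u₀ (evolve f ε v (firstMeeting f ε v)) (z p) p = speedAt f ε u₀ v (y p) p := by
  have hrep := (hc.isWaveRep_of_sgn_eq hε h hne hsg).1.congr hz
  have hab := hc.hab
  have hcell : cell ε u₀ b₁ = cell ε u₀ a₂ + 1 := by
    refine HeightSum.cell_succ h.height_sum hc.ha₂ hc.hb₁ hab (fun p hp hpp => ?_) ?_
    · have := hc.dichotomy p hp; omega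
    · rw [← hsg, hc.left_sgn a₂ hc.ha₂ hc.ha le_rfl]
  have hchA := hc.left_chord
  have hchB := hc.right_chord
  rw [← hcell] at hchA
  rw [← hsg] at hchB
  have h1 := hc.cell_left_le h hc.ha₁ hc.ha₂ le_rfl hc.ha le_rfl
  have h2 := hc.cell_right_le h hc.hb₁ hc.hb₂ le_rfl hc.hb le_rfl
  -- The left front is the faster one because the fronts collide; this is the drop of slope that
  -- makes the two chords merge.
  have hch := hchA.merge hchB (by omega) (by omega) hc.speed_lt.le
  push_cast at hch
  refine ⟨hcell, hch, fun p hp hp1 hp2 => ?_, fun p hp hpn => ?_⟩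
  · refine hrep.speedAt_of_isChord hε hp hc.ha₁ hc.hb₂ hp1 hp2 (fun q hq => ?_) ?_
    · rw [hz q hq, hz p hp, (hc.mem_iff p hp).2 ⟨hp1, hp2⟩, hc.mem_iff q hq]
    · have : sgn ε u₀ p = sgn ε u₀ a₁ := by
        rcases hc.dichotomy p hp with h3 | h3
        · exact hc.left_sgn p hp hp1 h3
        · rw [hc.right_sgn p hp h3 hp2, hsg]
      rw [this]; exact hch
  -- Away from the collision, each jump of the new profile is exactly one old front. It is spanned
  -- by a chord, so it keeps its speed.
  · obtain ⟨a, ha, b, hb, -, -, hap, hpb, hblock, -, hchp⟩ := h.exists_front_ends f hε hp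
    refine hrep.speedAt_of_isChord hε hp ha hb hap hpb (fun q hq => ?_) hchp
    rw [hz q hq, hz p hp, ← hblock q hq]
    constructor
    · intro heq
      rcases hc.single q hq p hp heq with h3 | h3
      · exact h3
      · rw [heq, hc.mem_iff p hp] at h3; exact absurd h3 hpn
    · intro hsf; exact hsf.advance_eq _

/-! ### The stages of the wavefront tracking solution -/

/-- The standing assumptions on the datum. -/
structure IsDatum (f : ℝ → ℝ) (ε : ℝ) (u₀ : ℝ → ℝ) : Prop where
  eps_pos : 0 < ε
  grid : ∀ x, ∃ m : ℤ, u₀ x = m * ε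
  bv : BoundedVariationOn u₀ univ
  right : ∀ x, ContinuousWithinAt u₀ (Ici x) x
  supp : HasCompactSupport u₀
  bin : BinaryCollisions f ε u₀

open Classical in
/-- The waves present at the `j`-th collision time. -/
noncomputable def stageWaves (f : ℝ → ℝ) (ε : ℝ) (u₀ : ℝ → ℝ) (j : ℕ) : Finset ℕ :=
  (waves ε u₀).filter fun s => stagePos f ε u₀ j s ≠ ⊤

/-- The positions of the waves at the `j`-th collision time. -/
noncomputable def stageY (f : ℝ → ℝ) (ε : ℝ) (u₀ : ℝ → ℝ) (j s : ℕ) : ℝ :=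
  (stagePos f ε u₀ j s).untopD 0

variable {f : ℝ → ℝ} {ε : ℝ} {u₀ : ℝ → ℝ}

theorem mem_stageWaves {j s : ℕ} :
    s ∈ stageWaves f ε u₀ j ↔ s ∈ waves ε u₀ ∧ stagePos f ε u₀ j s ≠ ⊤ := by
  classical
  unfold stageWaves
  rw [Finset.mem_filter]

theorem stagePos_eq {j s : ℕ} (hs : s ∈ stageWaves f ε u₀ j) :
    stagePos f ε u₀ j s = (stageY f ε u₀ j s : ℝ) := by
  unfold stageY
  cases h : stagePos f ε u₀ j s with
  | top => exact absurd h (mem_stageWaves.1 hs).2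
  | coe a => rfl

theorem Occurs.mono {i j : ℕ} (h : Occurs f ε u₀ j) (hij : i ≤ j) : Occurs f ε u₀ i :=
  fun k hk => h k (hk.trans_le hij)

theorem profile_succ {j : ℕ} (h : Occurs f ε u₀ (j + 1)) :
    profile f ε u₀ (j + 1) =
      evolve f ε (profile f ε u₀ j) (firstMeeting f ε (profile f ε u₀ j)) := by
  rw [profile, if_pos (h j (Nat.lt_succ_self j))]

theorem stagePos_succ {j s : ℕ} (h : Occurs f ε u₀ (j + 1)) (hs : s ∈ stageWaves f ε u₀ j) :
    (s ∈ survivors f ε u₀ (profile f ε u₀ j) (stageWaves f ε u₀ j) (stageY f ε u₀ j) →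
      stagePos f ε u₀ (j + 1) s = (advance f ε u₀ (profile f ε u₀ j) (stageY f ε u₀ j)
        (firstMeeting f ε (profile f ε u₀ j)) s : ℝ)) ∧
    (s ∉ survivors f ε u₀ (profile f ε u₀ j) (stageWaves f ε u₀ j) (stageY f ε u₀ j) →
      stagePos f ε u₀ (j + 1) s = ⊤) := by
  rw [mem_survivors_iff, stagePos, if_neg (mem_stageWaves.1 hs).2, ← profile_succ h]
  constructor
  · rintro ⟨-, h2⟩
    exact if_neg h2
  · intro h2
    have h3 : _ ∧ _ := not_not.1 fun hcon => h2 ⟨hs, hcon⟩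
    exact if_pos h3

theorem stageWaves_succ {j : ℕ} (h : Occurs f ε u₀ (j + 1)) :
    stageWaves f ε u₀ (j + 1) =
      survivors f ε u₀ (profile f ε u₀ j) (stageWaves f ε u₀ j) (stageY f ε u₀ j) := by
  ext s
  rw [mem_stageWaves]
  by_cases hs : s ∈ stageWaves f ε u₀ j
  · obtain ⟨h1, h2⟩ := stagePos_succ h hs
    constructor
    · rintro ⟨-, h3⟩
      by_contra h4
      exact h3 (h2 h4)
    · intro h3
      exact ⟨(mem_stageWaves.1 hs).1, by rw [h1 h3]; exact WithTop.coe_ne_top⟩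
  · constructor
    · rintro ⟨h1, h2⟩
      rw [mem_stageWaves] at hs
      have h3 : stagePos f ε u₀ j s = ⊤ := by
        by_contra h3; exact hs ⟨h1, h3⟩
      exact absurd (by rw [stagePos, if_pos h3]) h2
    · intro h1
      exact absurd ((mem_survivors_iff s).1 h1).1 hs

theorem stageY_succ {j s : ℕ} (h : Occurs f ε u₀ (j + 1)) (hs : s ∈ stageWaves f ε u₀ (j + 1)) :
    stageY f ε u₀ (j + 1) s = advance f ε u₀ (profile f ε u₀ j) (stageY f ε u₀ j)
      (firstMeeting f ε (profile f ε u₀ j)) s := by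
  rw [stageWaves_succ h] at hs
  have := (stagePos_succ h ((mem_survivors_iff s).1 hs).1).1 hs
  unfold stageY at this ⊢
  rw [this]
  rfl

theorem stageWaves_succ_subset {j : ℕ} (h : Occurs f ε u₀ (j + 1)) :
    stageWaves f ε u₀ (j + 1) ⊆ stageWaves f ε u₀ j := by
  rw [stageWaves_succ h]
  exact fun s hs => ((mem_survivors_iff s).1 hs).1

theorem stageWaves_subset {i j : ℕ} (h : Occurs f ε u₀ j) (hij : i ≤ j) :
    stageWaves f ε u₀ j ⊆ stageWaves f ε u₀ i := by
  induction j, hij using Nat.le_induction with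
  | base => exact Finset.Subset.refl _
  | succ k _ ih => exact (stageWaves_succ_subset h).trans (ih (h.mono (Nat.le_succ k)))

/-- At each collision time, the waves make up the profile. -/
theorem IsDatum.isWaveRep (D : IsDatum f ε u₀) {j : ℕ} (h : Occurs f ε u₀ j) :
    IsWaveRep ε u₀ (profile f ε u₀ j) (stageWaves f ε u₀ j) (stageY f ε u₀ j) := by
  induction j with
  | zero =>
    have h1 : stageWaves f ε u₀ 0 = waves ε u₀ := by
      ext s; rw [mem_stageWaves]
      exact ⟨And.left, fun hs => ⟨hs, WithTop.coe_ne_top⟩⟩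
    have h2 : stageY f ε u₀ 0 = initPos ε u₀ := rfl
    rw [h1, h2]
    exact isWaveRep_datum D.eps_pos D.grid D.bv D.right D.supp
  | succ j ih =>
    have hrep := ih (h.mono (Nat.le_succ j))
    have hne := h j (Nat.lt_succ_self j)
    have := hrep.isWaveRep_survivors D.eps_pos hne (D.bin j h)
    rw [← stageWaves_succ h, ← profile_succ h] at this
    exact this.congr fun s hs => stageY_succ h hs

theorem IsDatum.firstMeeting_pos (D : IsDatum f ε u₀) {j : ℕ} (h : Occurs f ε u₀ (j + 1)) :
    0 < firstMeeting f ε (profile f ε u₀ j) :=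
  ((D.isWaveRep (h.mono (Nat.le_succ j))).firstMeeting_mem D.eps_pos (h j (Nat.lt_succ_self j))).1

theorem IsDatum.time_lt (D : IsDatum f ε u₀) {i j : ℕ} (h : Occurs f ε u₀ j) (hij : i < j) :
    time f ε u₀ i < time f ε u₀ j := by
  induction j, hij using Nat.le_induction with
  | base => rw [time]; linarith [D.firstMeeting_pos h]
  | succ k _ ih =>
    rw [time]
    linarith [D.firstMeeting_pos h, ih (h.mono (Nat.le_succ k))]

/-- The supremum of naturals in `stage` is meaningful only for a bounded set; strict monotonicity of
the collision times provides the bound `j`. -/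
theorem IsDatum.stage_spec (D : IsDatum f ε u₀) {j : ℕ} (h : Occurs f ε u₀ j) {r : ℝ}
    (h0 : 0 ≤ r) (hr : r ≤ time f ε u₀ j) :
    stage f ε u₀ r ≤ j ∧ time f ε u₀ (stage f ε u₀ r) ≤ r ∧
      (stage f ε u₀ r < j → r < time f ε u₀ (stage f ε u₀ r + 1)) := by
  set A := {i | Occurs f ε u₀ i ∧ time f ε u₀ i ≤ r} with hA
  have hbound : ∀ i ∈ A, i ≤ j := by
    rintro i ⟨hi, hir⟩
    by_contra hcon
    linarith [D.time_lt hi (not_le.1 hcon)]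
  have hne : A.Nonempty := ⟨0, fun i hi => absurd hi (Nat.not_lt_zero i), h0⟩
  have hmem : sSup A ∈ A := Nat.sSup_mem hne ⟨j, hbound⟩
  change sSup A ≤ j ∧ time f ε u₀ (sSup A) ≤ r ∧ (sSup A < j → r < time f ε u₀ (sSup A + 1))
  refine ⟨hbound _ hmem, hmem.2, fun hlt => ?_⟩
  by_contra hcon
  have : sSup A + 1 ∈ A := ⟨h.mono hlt, not_lt.1 hcon⟩
  have := le_csSup (a := sSup A + 1) ⟨j, hbound⟩ this
  omega

theorem IsDatum.time_nonneg (D : IsDatum f ε u₀) {j : ℕ} (h : Occurs f ε u₀ j) :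
    0 ≤ time f ε u₀ j := by
  rcases Nat.eq_zero_or_pos j with rfl | hj
  · exact le_rfl
  · exact (D.time_lt h hj).le

theorem IsDatum.stage_time (D : IsDatum f ε u₀) {j : ℕ} (h : Occurs f ε u₀ j) :
    stage f ε u₀ (time f ε u₀ j) = j := by
  obtain ⟨h1, h2, h3⟩ := D.stage_spec h (D.time_nonneg h) le_rfl
  by_contra hne
  have hlt : stage f ε u₀ (time f ε u₀ j) < j := lt_of_le_of_ne h1 hne
  have h4 := h3 hlt
  rcases eq_or_lt_of_le (Nat.succ_le_of_lt hlt) with h5 | h5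
  · rw [Nat.succ_eq_add_one] at h5
    rw [h5] at h4
    exact lt_irrefl _ h4
  · exact lt_asymm h4 (D.time_lt h h5)

theorem pos_of_mem {t : ℝ} {s : ℕ} (hs : s ∈ stageWaves f ε u₀ (stage f ε u₀ t)) :
    pos f ε u₀ t s = (stageY f ε u₀ (stage f ε u₀ t) s +
      stageSpeed f ε u₀ (stage f ε u₀ t) s * (t - time f ε u₀ (stage f ε u₀ t)) : ℝ) := by
  unfold pos speed
  rw [stagePos_eq hs]
  rfl

theorem IsDatum.realWaves_time (D : IsDatum f ε u₀) {j : ℕ} (h : Occurs f ε u₀ j) :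
    realWaves f ε u₀ (time f ε u₀ j) = stageWaves f ε u₀ j := by
  ext s
  classical
  unfold realWaves
  rw [Finset.mem_filter, mem_stageWaves, and_congr_right_iff]
  intro _
  unfold pos
  rw [D.stage_time h]
  cases stagePos f ε u₀ j s <;> simp

/-- The waves `s` and `s'` have been at the same point at one of the first collision times. -/
def Met (f : ℝ → ℝ) (ε : ℝ) (u₀ : ℝ → ℝ) (j s s' : ℕ) : Prop :=
  ∃ k ≤ j, stageY f ε u₀ k s = stageY f ε u₀ k s'

/-- Strictly between collisions only waves of one front share a point, and these already shared it
at the preceding collision time. The continuum of times thus reduces to finitely many stages. -/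
theorem IsDatum.interacted_iff (D : IsDatum f ε u₀) {j : ℕ} (h : Occurs f ε u₀ j) (s s' : ℕ) :
    Interacted f ε u₀ (time f ε u₀ j) s s' ↔
      s ∈ stageWaves f ε u₀ j ∧ s' ∈ stageWaves f ε u₀ j ∧ Met f ε u₀ j s s' := by
  unfold Interacted
  rw [D.realWaves_time h]
  refine and_congr_right fun hs => and_congr_right fun hs' => ?_
  constructor
  · rintro ⟨r, hr0, hrj, heq⟩
    obtain ⟨h1, h2, h3⟩ := D.stage_spec h hr0 hrj
    have e1 := pos_of_mem (t := r) (stageWaves_subset h h1 hs)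
    have e2 := pos_of_mem (t := r) (stageWaves_subset h h1 hs')
    rw [e1, e2, WithTop.coe_inj] at heq
    set k := stage f ε u₀ r
    refine ⟨k, h1, ?_⟩
    rcases eq_or_lt_of_le h2 with h4 | h4
    · rw [← h4] at heq
      linarith
    · have hkj : k < j := by
        refine lt_of_le_of_ne h1 fun hk => ?_
        rw [hk] at h4; linarith
      have h5 := h3 hkj
      rw [time] at h5
      have hk : Occurs f ε u₀ k := h.mono h1
      exact ((D.isWaveRep hk).eq_of_advance_eq (f := f) D.eps_pos (τ := r - time f ε u₀ k)
        (by linarith) (by linarith) (stageWaves_subset h h1 hs) (stageWaves_subset h h1 hs')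
        heq).1
  · rintro ⟨k, hk, heq⟩
    have hkO := h.mono hk
    refine ⟨time f ε u₀ k, D.time_nonneg hkO, ?_, ?_⟩
    · rcases eq_or_lt_of_le hk with rfl | hlt
      · exact le_rfl
      · exact (D.time_lt h hlt).le
    · have e0 := D.stage_time hkO
      have e1 := pos_of_mem (t := time f ε u₀ k) (s := s)
        (by rw [e0]; exact stageWaves_subset h hk hs)
      have e2 := pos_of_mem (t := time f ε u₀ k) (s := s')
        (by rw [e0]; exact stageWaves_subset h hk hs')
      rw [e1, e2, e0, heq]
      simp

theorem Met.symm {j s s' : ℕ} (h : Met f ε u₀ j s s') : Met f ε u₀ j s' s := by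
  obtain ⟨k, hk, heq⟩ := h
  exact ⟨k, hk, heq.symm⟩

theorem met_refl (j s : ℕ) : Met f ε u₀ j s s := ⟨0, Nat.zero_le j, rfl⟩

theorem met_succ {j s s' : ℕ} : Met f ε u₀ (j + 1) s s' ↔
    Met f ε u₀ j s s' ∨ stageY f ε u₀ (j + 1) s = stageY f ε u₀ (j + 1) s' := by
  constructor
  · rintro ⟨k, hk, heq⟩
    rcases Nat.le_succ_iff.1 hk with h1 | rfl
    · exact Or.inl ⟨k, h1, heq⟩
    · exact Or.inr heq
  · rintro (⟨k, hk, heq⟩ | heq)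
    · exact ⟨k, hk.trans (Nat.le_succ j), heq⟩
    · exact ⟨j + 1, le_rfl, heq⟩

/-- Waves never change their order, so when the outer two were together, everything between them was
at the same point. -/
theorem IsDatum.met_of_between (D : IsDatum f ε u₀) {j : ℕ} (h : Occurs f ε u₀ j) {p q r t : ℕ}
    (hp : p ∈ stageWaves f ε u₀ j) (hq : q ∈ stageWaves f ε u₀ j) (hr : r ∈ stageWaves f ε u₀ j)
    (ht : t ∈ stageWaves f ε u₀ j) (hpt : Met f ε u₀ j p t) (h1 : p ≤ q) (h2 : q ≤ t)
    (h3 : p ≤ r) (h4 : r ≤ t) : Met f ε u₀ j q r := by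
  obtain ⟨k, hk, heq⟩ := hpt
  have hsub := stageWaves_subset h hk
  have hmono := (D.isWaveRep (h.mono hk)).mono
  have e1 := hmono p (hsub hp) q (hsub hq) h1
  have e2 := hmono q (hsub hq) t (hsub ht) h2
  have e3 := hmono p (hsub hp) r (hsub hr) h3
  have e4 := hmono r (hsub hr) t (hsub ht) h4
  exact ⟨k, hk, by linarith⟩

theorem IsDatum.sgn_eq_of_met (D : IsDatum f ε u₀) {j : ℕ} (h : Occurs f ε u₀ j) {p q : ℕ}
    (hp : p ∈ stageWaves f ε u₀ j) (hq : q ∈ stageWaves f ε u₀ j) (hpq : Met f ε u₀ j p q) :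
    sgn ε u₀ p = sgn ε u₀ q := by
  obtain ⟨k, hk, heq⟩ := hpq
  have hsub := stageWaves_subset h hk
  exact (D.isWaveRep (h.mono hk)).same p (hsub hp) q (hsub hq) heq

theorem IsDatum.sgn_between (D : IsDatum f ε u₀) {j : ℕ} (h : Occurs f ε u₀ j) {p t : ℕ}
    (hp : p ∈ stageWaves f ε u₀ j) (ht : t ∈ stageWaves f ε u₀ j) (hpt : Met f ε u₀ j p t) :
    ∀ q ∈ stageWaves f ε u₀ j, p ≤ q → q ≤ t → sgn ε u₀ q = sgn ε u₀ p := fun _ hq h1 h2 =>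
  D.sgn_eq_of_met h hq hp
    (D.met_of_between h hp hq hp ht hpt h1 h2 le_rfl (h1.trans h2))

theorem IsDatum.cell_lt_of_met (D : IsDatum f ε u₀) {j : ℕ} (h : Occurs f ε u₀ j) {p t : ℕ}
    (hp : p ∈ stageWaves f ε u₀ j) (ht : t ∈ stageWaves f ε u₀ j) (hpt : Met f ε u₀ j p t)
    (hlt : p < t) : cell ε u₀ p < cell ε u₀ t :=
  HeightSum.cell_lt (D.isWaveRep h).height_sum hp ht hlt (D.sgn_between h hp ht hpt)

end WavefrontTracking

/-! ### The contact property at states separating fronts that have met. -/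

namespace WavefrontTracking

variable {f : ℝ → ℝ} {ε : ℝ} {u₀ : ℝ → ℝ}

/-- The flux at both ends of the cell of the wave `p` lies above the line of slope `μ` through the
left end of the cell of the wave `s`. -/
def CellAbove (f : ℝ → ℝ) (ε : ℝ) (u₀ : ℝ → ℝ) (S : ℤ) (s : ℕ) (μ : ℝ) (p : ℕ) : Prop :=
  gridFlux f ε S (cell ε u₀ s) + μ * (cell ε u₀ p - cell ε u₀ s) ≤ gridFlux f ε S (cell ε u₀ p) ∧
  gridFlux f ε S (cell ε u₀ s) + μ * ((cell ε u₀ p + 1 : ℤ) - cell ε u₀ s) ≤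
    gridFlux f ε S (cell ε u₀ p + 1)

/-- Neighbouring waves of different fronts that have met are separated by a point of contact of
the flux with its envelope over the waves that have met both. -/
def HasContact (f : ℝ → ℝ) (ε : ℝ) (u₀ : ℝ → ℝ) (j : ℕ) : Prop :=
  ∀ s ∈ stageWaves f ε u₀ j, ∀ s' ∈ stageWaves f ε u₀ j, s < s' →
    (∀ p ∈ stageWaves f ε u₀ j, ¬ (s < p ∧ p < s')) → Met f ε u₀ j s s' →
    ¬ SameFront f ε u₀ (profile f ε u₀ j) (stageY f ε u₀ j) s s' →
    ∃ μ : ℝ, ∀ p ∈ stageWaves f ε u₀ j, Met f ε u₀ j p s → Met f ε u₀ j p s' →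
      CellAbove f ε u₀ (sgn ε u₀ s) s' μ p

theorem exists_pred (W : Finset ℕ) {p a : ℕ} (hp : p ∈ W) (hpa : p < a) :
    ∃ q ∈ W, p ≤ q ∧ q < a ∧ ∀ r ∈ W, ¬ (q < r ∧ r < a) := by
  have hmem : p ∈ W.filter fun q => q < a := Finset.mem_filter.2 ⟨hp, hpa⟩
  have hne : (W.filter fun q => q < a).Nonempty := ⟨p, hmem⟩
  have h1 := Finset.mem_filter.1 ((W.filter fun q => q < a).max'_mem hne)
  refine ⟨_, h1.1, Finset.le_max' _ _ hmem, h1.2, fun r hr hcon => ?_⟩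
  have := Finset.le_max' (W.filter fun q => q < a) r (Finset.mem_filter.2 ⟨hr, hcon.2⟩)
  omega

theorem exists_succ (W : Finset ℕ) {p a : ℕ} (hp : p ∈ W) (hpa : a < p) :
    ∃ q ∈ W, q ≤ p ∧ a < q ∧ ∀ r ∈ W, ¬ (a < r ∧ r < q) := by
  have hmem : p ∈ W.filter fun q => a < q := Finset.mem_filter.2 ⟨hp, hpa⟩
  have hne : (W.filter fun q => a < q).Nonempty := ⟨p, hmem⟩
  have h1 := Finset.mem_filter.1 ((W.filter fun q => a < q).min'_mem hne)
  refine ⟨_, h1.1, Finset.min'_le _ _ hmem, h1.2, fun r hr hcon => ?_⟩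
  have := Finset.min'_le (W.filter fun q => a < q) r (Finset.mem_filter.2 ⟨hr, hcon.1⟩)
  omega

/-- A line of slope `μ` through a point above which a line of slope `τ` passes. -/
theorem line_le_of_le {F : ℤ → ℝ} {a b n : ℤ} {μ τ : ℝ} (h1 : F b + τ * (a - b) ≤ F a)
    (h2 : F a + μ * (b - a) ≤ F b) (h3 : F a + μ * (n - a) ≤ F n)
    (h : n ≤ a ∧ a < b ∨ b < a ∧ a ≤ n) : F b + τ * (n - b) ≤ F n := by
  rcases h with ⟨hn, hab⟩ | ⟨hba, hn⟩
  · have hn' : (n : ℝ) ≤ a := by exact_mod_cast hn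
    have hab' : (0 : ℝ) < b - a := sub_pos.2 (by exact_mod_cast hab)
    have h4 : 0 ≤ (τ - μ) * (b - a) := by linarith
    have h5 := nonneg_of_mul_nonneg_left h4 hab'
    nlinarith
  · have hn' : (a : ℝ) ≤ n := by exact_mod_cast hn
    have hab' : (0 : ℝ) < a - b := sub_pos.2 (by exact_mod_cast hba)
    have h4 : 0 ≤ (μ - τ) * (a - b) := by linarith
    have h5 := nonneg_of_mul_nonneg_left h4 hab'
    nlinarith

/-- The whole cell of `p` has to lie beyond the contact point at `a`; this is why `+ 1` appears on
the left side only. -/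
theorem CellAbove.extend {S : ℤ} {a s p : ℕ} {μ τ : ℝ}
    (h1 : gridFlux f ε S (cell ε u₀ s) + τ * (cell ε u₀ a - cell ε u₀ s) ≤
      gridFlux f ε S (cell ε u₀ a))
    (h2 : gridFlux f ε S (cell ε u₀ a) + μ * (cell ε u₀ s - cell ε u₀ a) ≤
      gridFlux f ε S (cell ε u₀ s))
    (h3 : CellAbove f ε u₀ S a μ p)
    (h : cell ε u₀ p + 1 ≤ cell ε u₀ a ∧ cell ε u₀ a < cell ε u₀ s ∨
      cell ε u₀ s < cell ε u₀ a ∧ cell ε u₀ a ≤ cell ε u₀ p) : CellAbove f ε u₀ S s τ p :=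
  ⟨line_le_of_le h1 h2 h3.1 (by omega), line_le_of_le h1 h2 h3.2 (by omega)⟩

/-- The inductive step for neighbouring waves at different points. -/
theorem IsDatum.hasContact_of_ne (D : IsDatum f ε u₀) {j : ℕ} (h : Occurs f ε u₀ (j + 1))
    (ih : HasContact f ε u₀ j) {s s' : ℕ} (hs : s ∈ stageWaves f ε u₀ (j + 1))
    (hs' : s' ∈ stageWaves f ε u₀ (j + 1)) (hlt : s < s')
    (hcons : ∀ p ∈ stageWaves f ε u₀ (j + 1), ¬ (s < p ∧ p < s'))
    (hmet : Met f ε u₀ (j + 1) s s')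
    (hy : stageY f ε u₀ (j + 1) s ≠ stageY f ε u₀ (j + 1) s') :
    ∃ μ : ℝ, ∀ p ∈ stageWaves f ε u₀ (j + 1), Met f ε u₀ (j + 1) p s → Met f ε u₀ (j + 1) p s' →
      CellAbove f ε u₀ (sgn ε u₀ s) s' μ p := by
  have hj := h.mono (Nat.le_succ j)
  have hne := h j (Nat.lt_succ_self j)
  have hrep := D.isWaveRep hj
  have hrep' := D.isWaveRep h
  have hsub := stageWaves_succ_subset h
  obtain ⟨a₁, a₂, b₁, b₂, hc⟩ := hrep.exists_isCollision D.eps_pos hne (D.bin j h)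
  have hmet' : Met f ε u₀ j s s' := (met_succ.1 hmet).resolve_right hy
  -- The two waves were already neighbours. A wave removed between them would mean waves of both
  -- signs between them, while waves that have met enclose waves of one sign only.
  have hcons' : ∀ p ∈ stageWaves f ε u₀ j, ¬ (s < p ∧ p < s') := by
    rintro p hp ⟨h1, h2⟩
    have hpn : p ∉ stageWaves f ε u₀ (j + 1) := fun hp' => hcons p hp' ⟨h1, h2⟩
    rw [stageWaves_succ h] at hs hs' hpn
    rcases hc.sgn_cases with hsg | hsg
    · rw [(hc.isWaveRep_of_sgn_eq D.eps_pos hrep hne hsg).2] at hpn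
      exact hpn hp
    · obtain ⟨q, hq, r, hr, e1, e2, e3, e4, e5⟩ := hc.exists_between D.eps_pos hrep hne hsg hs hs'
        (Finset.mem_sdiff.2 ⟨hp, hpn⟩) h1 h2
      rw [← stageWaves_succ h] at hs hs'
      have hb := D.sgn_between hj (hsub hs) (hsub hs') hmet'
      exact e5 ((hb q hq e1.le e2.le).trans (hb r hr e3.le e4.le).symm)
  obtain ⟨μ, hμ⟩ := ih s (hsub hs) s' (hsub hs') hlt hcons' hmet' fun hsf => hy (by
    rw [stageY_succ h hs, stageY_succ h hs']; exact hsf.advance_eq _)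
  refine ⟨μ, fun p hp h1 h2 => ?_⟩
  have hle := hrep'.mono s hs s' hs' hlt.le
  -- A wave that reaches one of the two only now lies on the outer side of it. It had met the
  -- farther one before, hence by the order also the nearer one, so the common history has not
  -- grown.
  rcases met_succ.1 h1 with h3 | h3
  · rcases met_succ.1 h2 with h4 | h4
    · exact hμ p (hsub hp) h3 h4
    · have h5 : s < p := hrep'.lt_of_pos_lt hs hp (by rw [h4]; exact lt_of_le_of_ne hle hy)
      have h6 : s' ≤ p := by
        by_contra hcon; exact hcons p hp ⟨h5, not_le.1 hcon⟩
      exact hμ p (hsub hp) h3 (D.met_of_between hj (hsub hs) (hsub hp) (hsub hs') (hsub hp)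
        h3.symm h5.le le_rfl hlt.le h6)
  · have h4 : Met f ε u₀ j p s' :=
      (met_succ.1 h2).resolve_right fun h4 => hy (h3.symm.trans h4)
    have h5 : p < s' := hrep'.lt_of_pos_lt hp hs' (by rw [h3]; exact lt_of_le_of_ne hle hy)
    have h6 : p ≤ s := by
      by_contra hcon; exact hcons p hp ⟨not_le.1 hcon, h5⟩
    exact hμ p (hsub hp) (D.met_of_between hj (hsub hp) (hsub hp) (hsub hs) (hsub hs')
      h4 le_rfl h5.le h6 hlt.le) h4

/-- The inductive step for neighbouring waves at one point. -/
theorem IsDatum.hasContact_of_eq (D : IsDatum f ε u₀) {j : ℕ} (h : Occurs f ε u₀ (j + 1))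
    (ih : HasContact f ε u₀ j) {s s' : ℕ} (hs : s ∈ stageWaves f ε u₀ (j + 1))
    (hs' : s' ∈ stageWaves f ε u₀ (j + 1)) (hlt : s < s')
    (hcons : ∀ p ∈ stageWaves f ε u₀ (j + 1), ¬ (s < p ∧ p < s'))
    (hnot : ¬ SameFront f ε u₀ (profile f ε u₀ (j + 1)) (stageY f ε u₀ (j + 1)) s s')
    (hy : stageY f ε u₀ (j + 1) s = stageY f ε u₀ (j + 1) s') :
    ∃ μ : ℝ, ∀ p ∈ stageWaves f ε u₀ (j + 1), Met f ε u₀ (j + 1) p s → Met f ε u₀ (j + 1) p s' →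
      CellAbove f ε u₀ (sgn ε u₀ s) s' μ p := by
  have hj := h.mono (Nat.le_succ j)
  have hne := h j (Nat.lt_succ_self j)
  have hrep := D.isWaveRep hj
  have hrep' := D.isWaveRep h
  have hsub := stageWaves_succ_subset h
  obtain ⟨a₁, a₂, b₁, b₂, hc⟩ := hrep.exists_isCollision D.eps_pos hne (D.bin j h)
  have hyz : ∀ p ∈ stageWaves f ε u₀ (j + 1), stageY f ε u₀ (j + 1) p = _ := fun p hp =>
    stageY_succ h hp
  rcases hc.sgn_cases with hsg | hsg
  -- After an interaction the waves at each point form a single front, so there is no pair to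
  -- consider.
  · exfalso
    have hW := (hc.isWaveRep_of_sgn_eq D.eps_pos hrep hne hsg).2
    rw [← stageWaves_succ h] at hW
    obtain ⟨-, -, h1, h2⟩ := hc.speedAt_of_sgn_eq D.eps_pos hrep hne hsg
      (z := stageY f ε u₀ (j + 1)) fun p hp => hyz p (by rw [hW]; exact hp)
    rw [← profile_succ h] at h1 h2
    apply hnot
    refine ⟨hy, ?_⟩
    rw [hyz s hs, hyz s' hs'] at hy
    by_cases hsC : a₁ ≤ s ∧ s ≤ b₂
    · have hs'C := (hc.mem_iff s' (hsub hs')).1 (hy.symm.trans ((hc.mem_iff s (hsub hs)).2 hsC))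
      rw [h1 s (hsub hs) hsC.1 hsC.2, h1 s' (hsub hs') hs'C.1 hs'C.2]
    · have hs'C : ¬ (a₁ ≤ s' ∧ s' ≤ b₂) := by
        rw [← hc.mem_iff s' (hsub hs'), ← hy, hc.mem_iff s (hsub hs)]; exact hsC
      rw [h2 s (hsub hs) hsC, h2 s' (hsub hs') hs'C]
      rcases hc.single s (hsub hs) s' (hsub hs') hy with h3 | h3
      · exact h3.2
      · exact absurd ((hc.mem_iff s (hsub hs)).1 h3) hsC
  -- After a cancellation the waves at a point come from one old front, which may now split. At the
  -- split the slope of the new envelope jumps, so it touches the flux there over the present jump.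
  obtain ⟨a, ha, b, hb, hya, hyb, has, hsb, hblock, -, -, hsp, -, hle⟩ :=
    hrep'.exists_jump f D.eps_pos hs
  have hcell : cell ε u₀ s' = cell ε u₀ s + 1 :=
    HeightSum.cell_succ hrep'.height_sum hs hs' hlt hcons (hsp s' hs' hy.symm).1
  have hcontact : ∀ n, cell ε u₀ a ≤ n → n ≤ cell ε u₀ b + 1 →
      gridFlux f ε (sgn ε u₀ s) (cell ε u₀ s') +
        speedAt f ε u₀ (profile f ε u₀ (j + 1)) (stageY f ε u₀ (j + 1) s') s' *
          (n - cell ε u₀ s') ≤ gridFlux f ε (sgn ε u₀ s) n := by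
    intro n h1 h2
    have h3 := (hsp s' hs' hy.symm).2.2.2
    rw [hcell] at h3 ⊢
    exact (hsp s hs rfl).2.2.2.contact h3 (fun heq => hnot ⟨hy, heq⟩) n h1 h2
  set τ := speedAt f ε u₀ (profile f ε u₀ (j + 1)) (stageY f ε u₀ (j + 1) s') s'
  -- The same line works for the whole history. For waves outside the present jump, it is compared
  -- with the contact line at the edge of the old front.
  refine ⟨τ, fun p hp h1 h2 => ?_⟩
  by_cases hpy : stageY f ε u₀ (j + 1) p = stageY f ε u₀ (j + 1) s
  · obtain ⟨-, h3, h4, -⟩ := hsp p hp hpy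
    exact ⟨hcontact _ h3 (by omega), hcontact _ (by omega) (by omega)⟩
  have hps : Met f ε u₀ j p s := (met_succ.1 h1).resolve_right hpy
  have hps' : Met f ε u₀ j p s' :=
    (met_succ.1 h2).resolve_right fun h3 => hpy (h3.trans hy.symm)
  obtain ⟨c, hcW, d, hdW, hcs, hds, hcs1, hsd1, hfb, -, -⟩ :=
    hrep.exists_front_ends f D.eps_pos (hsub hs)
  have hfront : ∀ q ∈ stageWaves f ε u₀ (j + 1),
      SameFront f ε u₀ (profile f ε u₀ j) (stageY f ε u₀ j) q s →
        stageY f ε u₀ (j + 1) q = stageY f ε u₀ (j + 1) s := by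
    intro q hq hsf
    rw [hyz q hq, hyz s hs]; exact hsf.advance_eq _
  have hs'X : s' ≤ d := by
    rw [hyz s hs, hyz s' hs'] at hy
    rw [stageWaves_succ h] at hs hs'
    exact ((hfb s' ((mem_survivors_iff s').1 hs').1).1
      (hc.sameFront_of_survivors D.eps_pos hrep hne hsg hs hs' hy).symm).2
  -- Since `p` and `s` have met, no wave between them can have been cancelled: both signs would be
  -- present there.
  have hstay : ∀ q ∈ stageWaves f ε u₀ j, p < q ∧ q < s ∨ s < q ∧ q < p →
      q ∈ stageWaves f ε u₀ (j + 1) := by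
    intro q hq hpq
    by_contra hqn
    rw [stageWaves_succ h] at hs hp hqn
    have hq' := Finset.mem_sdiff.2 ⟨hq, hqn⟩
    rcases hpq with ⟨h3, h4⟩ | ⟨h3, h4⟩
    · obtain ⟨q', hq', r, hr, e1, e2, e3, e4, e5⟩ :=
        hc.exists_between D.eps_pos hrep hne hsg hp hs hq' h3 h4
      rw [← stageWaves_succ h] at hs hp
      have hb := D.sgn_between hj (hsub hp) (hsub hs) hps
      exact e5 ((hb q' hq' e1.le e2.le).trans (hb r hr e3.le e4.le).symm)
    · obtain ⟨q', hq', r, hr, e1, e2, e3, e4, e5⟩ :=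
        hc.exists_between D.eps_pos hrep hne hsg hs hp hq' h3 h4
      rw [← stageWaves_succ h] at hs hp
      have hb := D.sgn_between hj (hsub hs) (hsub hp) hps.symm
      exact e5 ((hb q' hq' e1.le e2.le).trans (hb r hr e3.le e4.le).symm)
  rcases lt_trichotomy p s with hps1 | rfl | hps1
  · have hpc : p < c := by
      by_contra hcon
      exact hpy (hfront p hp ((hfb p (hsub hp)).2 ⟨not_lt.1 hcon, by omega⟩))
    have hc' : c ∈ stageWaves f ε u₀ (j + 1) := by
      rcases eq_or_lt_of_le hcs1 with rfl | hlt1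
      · exact hs
      · exact hstay c hcW (Or.inl ⟨hpc, hlt1⟩)
    -- The induction hypothesis applies at the left edge `c` of the old front. Comparing its line
    -- with the new one at the two contacts gives `μ ≤ τ`, so left of `c` the new line stays below
    -- the old one.
    obtain ⟨q, hq, hpq, hqc, hqcons⟩ := exists_pred (stageWaves f ε u₀ j) (hsub hp) hpc
    have hmet : ∀ r ∈ stageWaves f ε u₀ j, ∀ t ∈ stageWaves f ε u₀ j, p ≤ r → r ≤ s → p ≤ t →
        t ≤ s → Met f ε u₀ j r t := fun r hr t ht e1 e2 e3 e4 =>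
      D.met_of_between hj (hsub hp) hr ht (hsub hs) hps e1 e2 e3 e4
    obtain ⟨μ, hμ⟩ := ih q hq c hcW hqc hqcons
      (hmet q hq c hcW hpq (by omega) hpc.le hcs1) (fun hsf => by
        have := (hfb q hq).1 (hsf.trans hcs); omega)
    rw [D.sgn_eq_of_met hj hq (hsub hs) (hmet q hq s (hsub hs) hpq (by omega) (by omega) le_rfl)]
      at hμ
    have k1 := hμ p (hsub hp) (hmet p (hsub hp) q hq le_rfl hps1.le hpq (by omega))
      (hmet p (hsub hp) c hcW le_rfl hps1.le hpc.le hcs1)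
    have k2 := (hμ s (hsub hs) (hmet s (hsub hs) q hq hps1.le le_rfl hpq (by omega))
      (hmet s (hsub hs) c hcW hps1.le le_rfl hpc.le hcs1)).2
    rw [← hcell] at k2
    have hca := hsp c hc' (hfront c hc' hcs)
    have hcs2 := (hle c hc' s hs (hfront c hc' hcs) rfl).1 hcs1
    have hpc2 := D.cell_lt_of_met hj (hsub hp) hcW
      (hmet p (hsub hp) c hcW le_rfl hps1.le hpc.le hcs1) hpc
    exact CellAbove.extend (hcontact _ hca.2.1 (by omega)) k2 k1 (Or.inl (by omega))
  · exact absurd rfl hpy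
  · have hdp : d < p := by
      by_contra hcon
      exact hpy (hfront p hp ((hfb p (hsub hp)).2 ⟨by omega, not_lt.1 hcon⟩))
    have hd' : d ∈ stageWaves f ε u₀ (j + 1) := hstay d hdW (Or.inr ⟨by omega, hdp⟩)
    -- Mirror case, with `τ ≤ μ`: the known contact is the left end of the cell of `q`, one past the
    -- cell of `d`.
    obtain ⟨q, hq, hqp, hdq, hqcons⟩ := exists_succ (stageWaves f ε u₀ j) (hsub hp) hdp
    have hmet : ∀ r ∈ stageWaves f ε u₀ j, ∀ t ∈ stageWaves f ε u₀ j, s ≤ r → r ≤ p → s ≤ t →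
        t ≤ p → Met f ε u₀ j r t := fun r hr t ht e1 e2 e3 e4 =>
      D.met_of_between hj (hsub hs) hr ht (hsub hp) hps.symm e1 e2 e3 e4
    obtain ⟨μ, hμ⟩ := ih d hdW q hq hdq hqcons
      (hmet d hdW q hq hsd1 hdp.le (by omega) hqp) (fun hsf => by
        have := (hfb q hq).1 (hsf.symm.trans hds); omega)
    rw [D.sgn_eq_of_met hj hdW (hsub hs) (hmet d hdW s (hsub hs) hsd1 hdp.le le_rfl hps1.le)]
      at hμ
    have k1 := hμ p (hsub hp) (hmet p (hsub hp) d hdW hps1.le le_rfl hsd1 hdp.le)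
      (hmet p (hsub hp) q hq hps1.le le_rfl (by omega) hqp)
    have k2 := (hμ s' (hsub hs') (hmet s' (hsub hs') d hdW hlt.le (by omega) hsd1 hdp.le)
      (hmet s' (hsub hs') q hq hlt.le (by omega) (by omega) hqp)).1
    have hcd := hsp d hd' (hfront d hd' hds)
    have hdq2 : cell ε u₀ q = cell ε u₀ d + 1 :=
      HeightSum.cell_succ hrep.height_sum hdW hq hdq hqcons
        (D.sgn_eq_of_met hj hq hdW (hmet q hq d hdW (by omega) hqp hsd1 hdp.le))
    have hsd2 := (hle s' hs' d hd' hy.symm (hfront d hd' hds)).1 hs'X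
    have hqp2 : cell ε u₀ q ≤ cell ε u₀ p := by
      rcases eq_or_lt_of_le hqp with rfl | hqp
      · exact le_rfl
      · exact (D.cell_lt_of_met hj hq (hsub hp)
          (hmet q hq p (hsub hp) (by omega) hqp.le hps1.le le_rfl) hqp).le
    refine CellAbove.extend ?_ k2 k1 (Or.inr ⟨by omega, hqp2⟩)
    exact hcontact _ (by omega) (by omega)

/-- Initially, waves that have met lie in one jump, and its fronts are separated by contact points
of the envelope over that jump. Later, neighbours at different points inherit their contact, and
neighbours at one point are separated by a fresh split. -/
theorem IsDatum.hasContact (D : IsDatum f ε u₀) {j : ℕ} (h : Occurs f ε u₀ j) :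
    HasContact f ε u₀ j := by
  induction j with
  | zero =>
    intro s hs s' hs' hlt hcons hmet hnot
    have hrep := D.isWaveRep h
    obtain ⟨k, hk, hy⟩ := hmet
    obtain rfl : k = 0 := by omega
    obtain ⟨a, ha, b, hb, hya, hyb, has, hsb, hblock, -, -, hsp, -, -⟩ :=
      hrep.exists_jump f D.eps_pos hs
    have hcell : cell ε u₀ s' = cell ε u₀ s + 1 :=
      HeightSum.cell_succ hrep.height_sum hs hs' hlt hcons (hsp s' hs' hy.symm).1
    refine ⟨speedAt f ε u₀ (profile f ε u₀ 0) (stageY f ε u₀ 0 s') s', fun p hp h1 _ => ?_⟩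
    obtain ⟨k, hk, hpy⟩ := h1
    obtain rfl : k = 0 := by omega
    obtain ⟨-, h3, h4, -⟩ := hsp p hp hpy
    have h5 := (hsp s' hs' hy.symm).2.2.2
    unfold CellAbove
    rw [hcell] at h5 ⊢
    have h6 := fun n => (hsp s hs rfl).2.2.2.contact h5 (fun heq => hnot ⟨hy, heq⟩) n
    exact ⟨h6 _ h3 (by omega), h6 _ (by omega) (by omega)⟩
  | succ j ih =>
    intro s hs s' hs' hlt hcons hmet hnot
    by_cases hy : stageY f ε u₀ (j + 1) s = stageY f ε u₀ (j + 1) s'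
    · exact D.hasContact_of_eq h (ih (h.mono (Nat.le_succ j))) hs hs' hlt hcons hnot hy
    · exact D.hasContact_of_ne h (ih (h.mono (Nat.le_succ j))) hs hs' hlt hcons hmet hy

end WavefrontTracking

namespace WavefrontTracking

/-! ### Slopes of chords -/

section Slopes

variable {f : ℝ → ℝ} {ε : ℝ}

/-- Slopes of adjacent chords differ at most by the Lipschitz constant of `f'` times the total
length. -/
theorem gridFlux_slope_sub_le (hf : ContDiff ℝ 2 f)
    (hf'' : BddAbove (range fun u => |deriv (deriv f) u|)) (hε : 0 < ε) {S : ℤ}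
    (hS : S = 1 ∨ S = -1) {x y z : ℤ} (hxy : x < y) (hyz : y < z) :
    (gridFlux f ε S y - gridFlux f ε S x) / (y - x) -
      (gridFlux f ε S z - gridFlux f ε S y) / (z - y) ≤
        (⨆ u, |deriv (deriv f) u|) * ε * (z - x) := by
  have hdf : Differentiable ℝ f := hf.differentiable (by norm_num)
  have hdf' : Differentiable ℝ (deriv f) :=
    ((contDiff_succ_iff_deriv (n := 1)).1 hf).2.2.differentiable (by norm_num)
  have hSS : (S : ℝ) * S = 1 := by rcases hS with rfl | rfl <;> norm_num
  have hSabs : |(S : ℝ)| = 1 := by rcases hS with rfl | rfl <;> norm_num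
  -- With this normalisation the sign and `ε` cancel, and the derivative in the index variable is
  -- `f'` itself.
  have hder : ∀ t : ℝ, HasDerivAt (fun t : ℝ => S * f (S * t * ε) / ε)
      (deriv f (S * t * ε)) t := by
    intro t
    have h1 : HasDerivAt (fun t : ℝ => (S : ℝ) * t * ε) (S * ε) t := by
      have := ((hasDerivAt_id t).const_mul (S : ℝ)).mul_const ε
      simpa using this
    have h2 := (((hdf (S * t * ε)).hasDerivAt.comp t h1).const_mul (S : ℝ)).div_const ε
    refine h2.congr_deriv ?_
    rw [div_eq_iff hε.ne']
    linear_combination (deriv f (S * t * ε) * ε) * hSS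
  have hcont : Continuous fun t : ℝ => (S * f (S * t * ε) / ε : ℝ) :=
    continuous_iff_continuousAt.2 fun t => (hder t).continuousAt
  have hxy' : (x : ℝ) < y := by exact_mod_cast hxy
  have hyz' : (y : ℝ) < z := by exact_mod_cast hyz
  obtain ⟨ξ, hξ, hξ'⟩ := exists_hasDerivAt_eq_slope _ _ hxy' hcont.continuousOn fun t _ => hder t
  obtain ⟨η, hη, hη'⟩ := exists_hasDerivAt_eq_slope _ _ hyz' hcont.continuousOn fun t _ => hder t
  have hlip := convex_univ.norm_image_sub_le_of_norm_deriv_le (f := deriv f)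
    (C := ⨆ u, |deriv (deriv f) u|) (x := (S * η * ε : ℝ)) (y := (S * ξ * ε : ℝ))
    (fun w _ => hdf' w) (fun w _ => le_ciSup hf'' w) (mem_univ _) (mem_univ _)
  unfold gridFlux
  rw [← hξ', ← hη']
  rw [Real.norm_eq_abs, Real.norm_eq_abs] at hlip
  have hM : 0 ≤ ⨆ u, |deriv (deriv f) u| := Real.iSup_nonneg fun u => abs_nonneg _
  have h3 : |(S * ξ * ε - S * η * ε : ℝ)| ≤ ε * (z - x) := by
    have : (S * ξ * ε - S * η * ε : ℝ) = S * (ε * (ξ - η)) := by ring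
    rw [this, abs_mul, hSabs, one_mul, abs_mul, abs_of_pos hε]
    refine mul_le_mul_of_nonneg_left ?_ hε.le
    rw [abs_le]
    constructor <;> linarith [hξ.1, hξ.2, hη.1, hη.2]
  calc deriv f (S * ξ * ε) - deriv f (S * η * ε)
      ≤ |deriv f (S * ξ * ε) - deriv f (S * η * ε)| := le_abs_self _
    _ ≤ _ := hlip
    _ ≤ (⨆ u, |deriv (deriv f) u|) * (ε * (z - x)) := mul_le_mul_of_nonneg_left h3 hM
    _ = _ := by ring

/-- With `p` and `q` the slopes over the two parts, the difference is `(p - q) (y - x) / (z - x)`.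
The total length in the bound for `p - q` cancels, so only the added length counts. -/
theorem gridFlux_slope_left (hf : ContDiff ℝ 2 f)
    (hf'' : BddAbove (range fun u => |deriv (deriv f) u|)) (hε : 0 < ε) {S : ℤ}
    (hS : S = 1 ∨ S = -1) {x y z : ℤ} (hxy : x ≤ y) (hyz : y < z) :
    (gridFlux f ε S z - gridFlux f ε S x) / (z - x) -
      (gridFlux f ε S z - gridFlux f ε S y) / (z - y) ≤
        (⨆ u, |deriv (deriv f) u|) * ε * (y - x) := by
  rcases eq_or_lt_of_le hxy with rfl | hxy
  · simp
  have h := gridFlux_slope_sub_le hf hf'' hε hS hxy hyz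
  have hxy' : (0 : ℝ) < y - x := sub_pos.2 (by exact_mod_cast hxy)
  have hyz' : (0 : ℝ) < z - y := sub_pos.2 (by exact_mod_cast hyz)
  have hxz : (0 : ℝ) < z - x := by linarith
  set F := gridFlux f ε S
  set p := (F y - F x) / ((y : ℝ) - x) with hp
  set q := (F z - F y) / ((z : ℝ) - y) with hq
  have hp' : p * (y - x) = F y - F x := div_mul_cancel₀ _ hxy'.ne'
  have hq' : q * (z - y) = F z - F y := div_mul_cancel₀ _ hyz'.ne'
  have h2 : (F z - F x) / ((z : ℝ) - x) - q = (p - q) * (y - x) / (z - x) := by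
    field_simp; linarith
  rw [h2, div_le_iff₀ hxz]
  nlinarith

theorem gridFlux_slope_right (hf : ContDiff ℝ 2 f)
    (hf'' : BddAbove (range fun u => |deriv (deriv f) u|)) (hε : 0 < ε) {S : ℤ}
    (hS : S = 1 ∨ S = -1) {x y z : ℤ} (hxy : x < y) (hyz : y ≤ z) :
    (gridFlux f ε S y - gridFlux f ε S x) / (y - x) -
      (gridFlux f ε S z - gridFlux f ε S x) / (z - x) ≤
        (⨆ u, |deriv (deriv f) u|) * ε * (z - y) := by
  rcases eq_or_lt_of_le hyz with rfl | hyz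
  · simp
  have h := gridFlux_slope_sub_le hf hf'' hε hS hxy hyz
  have hxy' : (0 : ℝ) < y - x := sub_pos.2 (by exact_mod_cast hxy)
  have hyz' : (0 : ℝ) < z - y := sub_pos.2 (by exact_mod_cast hyz)
  have hxz : (0 : ℝ) < z - x := by linarith
  set F := gridFlux f ε S
  set p := (F y - F x) / ((y : ℝ) - x) with hp
  set q := (F z - F y) / ((z : ℝ) - y) with hq
  have hp' : p * (y - x) = F y - F x := div_mul_cancel₀ _ hxy'.ne'
  have hq' : q * (z - y) = F z - F y := div_mul_cancel₀ _ hyz'.ne'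
  have h2 : p - (F z - F x) / ((z : ℝ) - x) = (p - q) * (z - y) / (z - x) := by
    field_simp; linarith
  rw [h2, div_le_iff₀ hxz]
  nlinarith

end Slopes

/-! ### Artificial speeds and weights -/

section Weights

variable {f : ℝ → ℝ} {ε : ℝ} {u₀ : ℝ → ℝ}

theorem stateSet_of_pos {I : Finset ℕ} (hsg : ∀ p ∈ I, sgn ε u₀ p = 1)
    (hws : ∀ p ∈ I, waveSign ε u₀ p = sgn ε u₀ p)
    (hrs : ∀ p ∈ I, rightState ε u₀ p = height ε u₀ p * ε) :
    stateSet ε u₀ I = ⋃ p ∈ I, Ioc (cell ε u₀ p * ε) ((cell ε u₀ p + 1 : ℤ) * ε) := by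
  unfold stateSet waveCell
  refine iUnion₂_congr fun p hp => ?_
  rw [hws p hp, hrs p hp, height_eq, hsg p hp, if_pos (by norm_num)]
  congr 1 <;> push_cast <;> ring

theorem stateSet_of_neg {I : Finset ℕ} (hsg : ∀ p ∈ I, sgn ε u₀ p = -1)
    (hws : ∀ p ∈ I, waveSign ε u₀ p = sgn ε u₀ p)
    (hrs : ∀ p ∈ I, rightState ε u₀ p = height ε u₀ p * ε) :
    stateSet ε u₀ I = ⋃ p ∈ I, Ico ((-(cell ε u₀ p + 1) : ℤ) * ε) ((-cell ε u₀ p : ℤ) * ε) := by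
  unfold stateSet waveCell
  refine iUnion₂_congr fun p hp => ?_
  rw [hws p hp, hrs p hp, height_eq, hsg p hp, if_neg (by norm_num)]
  congr 1 <;> push_cast <;> ring

/-- The artificial speeds are slopes of the envelope over the states of the waves. -/
theorem exists_artSpeed (f : ℝ → ℝ) (hε : 0 < ε) {I : Finset ℕ} (hne : I.Nonempty) {S : ℤ}
    (hsg : ∀ p ∈ I, sgn ε u₀ p = S) (hws : ∀ p ∈ I, waveSign ε u₀ p = sgn ε u₀ p)
    (hrs : ∀ p ∈ I, rightState ε u₀ p = height ε u₀ p * ε) :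
    ∃ α β : ℤ, (∀ p ∈ I, α ≤ cell ε u₀ p ∧ cell ε u₀ p + 1 ≤ β) ∧ (∃ p ∈ I, cell ε u₀ p = α) ∧
      (∃ p ∈ I, cell ε u₀ p + 1 = β) ∧
      ∀ s ∈ I, IsEnvSlope (gridFlux f ε S) α β (cell ε u₀ s) (artSpeed f ε u₀ I s) := by
  obtain ⟨a, ha, hmin⟩ := Finset.exists_min_image I (cell ε u₀) hne
  obtain ⟨b, hb, hmax⟩ := Finset.exists_max_image I (cell ε u₀) hne
  refine ⟨cell ε u₀ a, cell ε u₀ b + 1, fun p hp => ⟨hmin p hp, by have := hmax p hp; omega⟩,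
    ⟨a, ha, rfl⟩, ⟨b, hb, rfl⟩, fun s hs => ?_⟩
  obtain ⟨σ, hσ⟩ := exists_isEnvSlope (gridFlux f ε S) (hmin s hs)
    (Int.lt_add_one_of_le (hmax s hs))
  have hcast : ∀ m n : ℤ, m ≤ n → (m * ε : ℝ) ≤ n * ε := fun m n hmn =>
    mul_le_mul_of_nonneg_right (by exact_mod_cast hmn) hε.le
  have hcast' : ∀ m n : ℤ, m < n → (m * ε : ℝ) < n * ε := fun m n hmn =>
    mul_lt_mul_of_pos_right (by exact_mod_cast hmn) hε
  suffices artSpeed f ε u₀ I s = σ by rw [this]; exact hσ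
  unfold artSpeed
  rw [hws s hs, hrs s hs, height_eq, hsg s hs]
  rcases sgn_eq ε u₀ s with h1 | h1
  · obtain rfl : S = 1 := (hsg s hs).symm.trans h1
    have hset := stateSet_of_pos hsg hws hrs
    have hsub : ∀ p ∈ I, Ioc (cell ε u₀ p * ε : ℝ) ((cell ε u₀ p + 1 : ℤ) * ε) ⊆
        stateSet ε u₀ I := fun p hp w hw => by
      rw [hset]; exact mem_iUnion₂.2 ⟨p, hp, hw⟩
    have hnes : (stateSet ε u₀ I).Nonempty :=
      ⟨_, hsub a ha (right_mem_Ioc.2 (hcast' _ _ (by omega)))⟩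
    -- No absence of gaps is needed: the extreme cells alone determine the infimum and the supremum
    -- of the union.
    have hinf : sInf (stateSet ε u₀ I) = cell ε u₀ a * ε := by
      refine IsGLB.csInf_eq ⟨fun w hw => ?_, fun w hw => ?_⟩ hnes
      · rw [hset] at hw
        obtain ⟨p, hp, hw⟩ := mem_iUnion₂.1 hw
        exact (hcast _ _ (hmin p hp)).trans hw.1.le
      · exact (isGLB_Ioc (hcast' _ _ (by omega))).2 (lowerBounds_mono_set (hsub a ha) hw)
    have hsup : sSup (stateSet ε u₀ I) = (cell ε u₀ b + 1 : ℤ) * ε := by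
      refine IsLUB.csSup_eq ⟨fun w hw => ?_, fun w hw => ?_⟩ hnes
      · rw [hset] at hw
        obtain ⟨p, hp, hw⟩ := mem_iUnion₂.1 hw
        have := hmax p hp
        exact hw.2.trans (hcast _ _ (by omega))
      · exact (isLUB_Ioc (hcast' _ _ (by omega))).2 (upperBounds_mono_set (hsub b hb) hw)
    rw [if_pos (by norm_num), hinf, hsup]
    exact convSlope_gridFlux hε hσ (by push_cast; ring)
  · obtain rfl : S = -1 := (hsg s hs).symm.trans h1
    have hset := stateSet_of_neg hsg hws hrs
    have hsub : ∀ p ∈ I, Ico ((-(cell ε u₀ p + 1) : ℤ) * ε : ℝ) ((-cell ε u₀ p : ℤ) * ε) ⊆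
        stateSet ε u₀ I := fun p hp w hw => by
      rw [hset]; exact mem_iUnion₂.2 ⟨p, hp, hw⟩
    have hnes : (stateSet ε u₀ I).Nonempty :=
      ⟨_, hsub a ha (left_mem_Ico.2 (hcast' _ _ (by omega)))⟩
    have hinf : sInf (stateSet ε u₀ I) = (-(cell ε u₀ b + 1) : ℤ) * ε := by
      refine IsGLB.csInf_eq ⟨fun w hw => ?_, fun w hw => ?_⟩ hnes
      · rw [hset] at hw
        obtain ⟨p, hp, hw⟩ := mem_iUnion₂.1 hw
        have := hmax p hp
        exact (hcast _ _ (by omega)).trans hw.1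
      · exact (isGLB_Ico (hcast' _ _ (by omega))).2 (lowerBounds_mono_set (hsub b hb) hw)
    have hsup : sSup (stateSet ε u₀ I) = (-cell ε u₀ a : ℤ) * ε := by
      refine IsLUB.csSup_eq ⟨fun w hw => ?_, fun w hw => ?_⟩ hnes
      · rw [hset] at hw
        obtain ⟨p, hp, hw⟩ := mem_iUnion₂.1 hw
        have := hmin p hp
        exact hw.2.le.trans (hcast _ _ (by omega))
      · exact (isLUB_Ico (hcast' _ _ (by omega))).2 (upperBounds_mono_set (hsub a ha) hw)
    rw [if_neg (by norm_num), hinf, hsup]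
    exact concSlope_gridFlux hε hσ (by push_cast; ring)

theorem IsDatum.mem_history (D : IsDatum f ε u₀) {j : ℕ} (h : Occurs f ε u₀ j) {s s' : ℕ}
    (hs : s ∈ stageWaves f ε u₀ j) (hs' : s' ∈ stageWaves f ε u₀ j) (p : ℕ) :
    p ∈ history f ε u₀ (time f ε u₀ j) s s' ↔
      p ∈ stageWaves f ε u₀ j ∧ Met f ε u₀ j p s ∧ Met f ε u₀ j p s' := by
  classical
  unfold history
  rw [Finset.mem_filter, D.realWaves_time h, D.interacted_iff h, D.interacted_iff h]
  tauto

/-- The artificial speeds given by the common history of two waves that have met. -/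
theorem IsDatum.exists_artSpeed_history (D : IsDatum f ε u₀) {j : ℕ} (h : Occurs f ε u₀ j)
    {s s' : ℕ} (hs : s ∈ stageWaves f ε u₀ j) (hs' : s' ∈ stageWaves f ε u₀ j)
    (hmet : Met f ε u₀ j s s') :
    ∃ α β : ℤ, (∀ p ∈ history f ε u₀ (time f ε u₀ j) s s',
        α ≤ cell ε u₀ p ∧ cell ε u₀ p + 1 ≤ β) ∧
      (∃ p ∈ history f ε u₀ (time f ε u₀ j) s s', cell ε u₀ p = α) ∧
      (∃ p ∈ history f ε u₀ (time f ε u₀ j) s s', cell ε u₀ p + 1 = β) ∧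
      IsEnvSlope (gridFlux f ε (sgn ε u₀ s)) α β (cell ε u₀ s)
        (artSpeed f ε u₀ (history f ε u₀ (time f ε u₀ j) s s') s) ∧
      IsEnvSlope (gridFlux f ε (sgn ε u₀ s)) α β (cell ε u₀ s')
        (artSpeed f ε u₀ (history f ε u₀ (time f ε u₀ j) s s') s') := by
  have hrep := D.isWaveRep h
  have hmem := D.mem_history h hs hs'
  have h1 : s ∈ history f ε u₀ (time f ε u₀ j) s s' := (hmem s).2 ⟨hs, met_refl j s, hmet⟩
  have h2 : s' ∈ history f ε u₀ (time f ε u₀ j) s s' := (hmem s').2 ⟨hs', hmet.symm, met_refl j s'⟩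
  obtain ⟨α, β, e1, e2, e3, e4⟩ := exists_artSpeed f D.eps_pos ⟨s, h1⟩ (S := sgn ε u₀ s)
    (fun p hp => D.sgn_eq_of_met h ((hmem p).1 hp).1 hs ((hmem p).1 hp).2.1)
    (fun p hp => hrep.waveSign_eq p ((hmem p).1 hp).1)
    (fun p hp => hrep.rightState_eq p ((hmem p).1 hp).1)
  exact ⟨α, β, e1, e2, e3, e4 s h1, e4 s' h2⟩

theorem IsDatum.weight_of_met (D : IsDatum f ε u₀) {j : ℕ} (h : Occurs f ε u₀ j)
    {s s' : ℕ} (hs : s ∈ stageWaves f ε u₀ j) (hs' : s' ∈ stageWaves f ε u₀ j)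
    (hmet : Met f ε u₀ j s s') :
    weight f ε u₀ (time f ε u₀ j) s s' =
      |artSpeed f ε u₀ (history f ε u₀ (time f ε u₀ j) s s') s' -
        artSpeed f ε u₀ (history f ε u₀ (time f ε u₀ j) s s') s| /
      |rightState ε u₀ s' - (rightState ε u₀ s - waveSign ε u₀ s * ε)| :=
  if_pos ((D.interacted_iff h s s').2 ⟨hs, hs', hmet⟩)

theorem IsDatum.weight_of_not_met (D : IsDatum f ε u₀) {j : ℕ} (h : Occurs f ε u₀ j)
    {s s' : ℕ} (hmet : ¬ Met f ε u₀ j s s') :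
    weight f ε u₀ (time f ε u₀ j) s s' = ⨆ u, |deriv (deriv f) u| :=
  if_neg fun hcon => hmet ((D.interacted_iff h s s').1 hcon).2.2

/-- The weight of a pair that has met decreases as long as no wave is removed. -/
theorem IsDatum.weight_anti (D : IsDatum f ε u₀) {j : ℕ} (h : Occurs f ε u₀ (j + 1))
    (hW : stageWaves f ε u₀ (j + 1) = stageWaves f ε u₀ j) {s s' : ℕ}
    (hs : s ∈ stageWaves f ε u₀ j) (hs' : s' ∈ stageWaves f ε u₀ j) (hlt : s < s')
    (hmet : Met f ε u₀ j s s') :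
    weight f ε u₀ (time f ε u₀ (j + 1)) s s' ≤ weight f ε u₀ (time f ε u₀ j) s s' := by
  have hj := h.mono (Nat.le_succ j)
  have hsW : s ∈ stageWaves f ε u₀ (j + 1) := by rw [hW]; exact hs
  have hsW' : s' ∈ stageWaves f ε u₀ (j + 1) := by rw [hW]; exact hs'
  have hmet' : Met f ε u₀ (j + 1) s s' := met_succ.2 (Or.inl hmet)
  rw [D.weight_of_met h hsW hsW' hmet', D.weight_of_met hj hs hs' hmet]
  obtain ⟨α, β, -, ⟨p, hp, rfl⟩, ⟨q, hq, rfl⟩, e1, e2⟩ := D.exists_artSpeed_history hj hs hs' hmet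
  obtain ⟨α', β', hb, -, -, e1', e2'⟩ := D.exists_artSpeed_history h hsW hsW' hmet'
  have hsub : ∀ r ∈ history f ε u₀ (time f ε u₀ j) s s',
      r ∈ history f ε u₀ (time f ε u₀ (j + 1)) s s' := by
    intro r hr
    rw [D.mem_history hj hs hs'] at hr
    rw [D.mem_history h hsW hsW', hW]
    exact ⟨hr.1, met_succ.2 (Or.inl hr.2.1), met_succ.2 (Or.inl hr.2.2)⟩
  have hcell := (D.cell_lt_of_met hj hs hs' hmet hlt).le
  have h1 := e1'.mono e2' hcell
  -- The denominator of the weight does not depend on time, and the numerator is a difference of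
  -- slopes over a larger interval.
  have h2 := e1.sub_le_sub e2 e1' e2' (hb p (hsub p hp)).1 (hb q (hsub q hq)).2 hcell
  refine div_le_div_of_nonneg_right ?_ (abs_nonneg _)
  rw [abs_of_nonneg (by linarith), abs_of_nonneg (by linarith)]
  exact h2

/-- The weight of a pair of waves of a jump that is spanned by a chord is zero. -/
theorem IsDatum.weight_eq_zero (D : IsDatum f ε u₀) {j : ℕ} (h : Occurs f ε u₀ j) {s s' a b : ℕ}
    (hs : s ∈ stageWaves f ε u₀ j) (hs' : s' ∈ stageWaves f ε u₀ j) (hlt : s < s')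
    (ha : a ∈ stageWaves f ε u₀ j) (hb : b ∈ stageWaves f ε u₀ j) (has : a ≤ s) (hsb : s' ≤ b)
    (hy : stageY f ε u₀ j a = stageY f ε u₀ j b) {ρ : ℝ}
    (hch : IsChord (gridFlux f ε (sgn ε u₀ s)) (cell ε u₀ a) (cell ε u₀ b + 1) ρ) :
    weight f ε u₀ (time f ε u₀ j) s s' = 0 := by
  have hmet : ∀ q ∈ stageWaves f ε u₀ j, ∀ r ∈ stageWaves f ε u₀ j, a ≤ q → q ≤ b → a ≤ r →
      r ≤ b → Met f ε u₀ j q r := fun q hq r hr h1 h2 h3 h4 =>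
    D.met_of_between h ha hq hr hb ⟨j, le_rfl, hy⟩ h1 h2 h3 h4
  have hcell : ∀ q ∈ stageWaves f ε u₀ j, ∀ r ∈ stageWaves f ε u₀ j, a ≤ q → q ≤ r → r ≤ b →
      cell ε u₀ q ≤ cell ε u₀ r := by
    intro q hq r hr h1 h2 h3
    rcases eq_or_lt_of_le h2 with rfl | h2
    · exact le_rfl
    · exact (D.cell_lt_of_met h hq hr (hmet q hq r hr h1 (by omega) (by omega) h3) h2).le
  have hss := hmet s hs s' hs' has (by omega) (by omega) hsb
  rw [D.weight_of_met h hs hs' hss]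
  obtain ⟨α, β, hbd, -, -, e1, e2⟩ := D.exists_artSpeed_history h hs hs' hss
  have haI := hbd a ((D.mem_history h hs hs' a).2 ⟨ha, hmet a ha s hs le_rfl (by omega) has
    (by omega), hmet a ha s' hs' le_rfl (by omega) (by omega) hsb⟩)
  have hbI := hbd b ((D.mem_history h hs hs' b).2 ⟨hb, hmet b hb s hs (by omega) le_rfl has
    (by omega), hmet b hb s' hs' (by omega) le_rfl (by omega) hsb⟩)
  have c1 := hcell a ha s hs le_rfl has (by omega)
  have c2 := hcell s hs s' hs' has hlt.le hsb
  have c3 := hcell s' hs' b hb (by omega) hsb le_rfl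
  have h1 := e1.mono e2 c2
  -- The chord has the same slope on both cells, and the history contains its interval, so the
  -- difference there is at most zero.
  have h2 := (hch.isEnvSlope c1 (by omega)).sub_le_sub (hch.isEnvSlope (by omega : cell ε u₀ a ≤
    cell ε u₀ s') (by omega)) e1 e2 haI.1 hbI.2 c2
  have h3 : artSpeed f ε u₀ (history f ε u₀ (time f ε u₀ j) s s') s' -
        artSpeed f ε u₀ (history f ε u₀ (time f ε u₀ j) s s') s = 0 := by linarith
  rw [h3, abs_zero, zero_div]

end Weights

end WavefrontTracking

namespace WavefrontTracking

/-! ### The interaction estimate -/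

/-- In the application `l`, `r` are the sizes of the fronts, `x`, `w` count their waves that have
not met the opposite neighbour, and `x r + (l - x) w` counts pairs that have not met. After `d` is
replaced by its bound and `K` divided out, the gap between the sides is `x r (r - w) + l w (l - x)`.
-/
theorem mul_le_of_le_add {d K l r x w : ℝ} (hK : 0 ≤ K) (hx : 0 ≤ x) (hxl : x ≤ l) (hw : 0 ≤ w)
    (hwr : w ≤ r) (h : d ≤ K * (x + w)) :
    d * (l * r) ≤ K * (x * r + (l - x) * w) * (l + r) := by
  have hl : 0 ≤ l := hx.trans hxl
  have hr : 0 ≤ r := hw.trans hwr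
  have h1 : d * (l * r) ≤ K * (x + w) * (l * r) :=
    mul_le_mul_of_nonneg_right h (mul_nonneg hl hr)
  have h2 : 0 ≤ x * r * (r - w) := mul_nonneg (mul_nonneg hx hr) (sub_nonneg.2 hwr)
  have h3 : 0 ≤ l * w * (l - x) := mul_nonneg (mul_nonneg hl hw) (sub_nonneg.2 hxl)
  have h4 : (x + w) * (l * r) ≤ (x * r + (l - x) * w) * (l + r) := by linarith
  calc d * (l * r) ≤ K * (x + w) * (l * r) := h1
    _ = K * ((x + w) * (l * r)) := by ring
    _ ≤ K * ((x * r + (l - x) * w) * (l + r)) := mul_le_mul_of_nonneg_left h4 hK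
    _ = _ := by ring

theorem HeightSum.card_block {ε : ℝ} {u₀ : ℝ → ℝ} {W : Finset ℕ} (h : HeightSum ε u₀ W) {s s' : ℕ}
    (hs : s ∈ W) (hs' : s' ∈ W) (hle : s ≤ s')
    (hsg : ∀ p ∈ W, s ≤ p → p ≤ s' → sgn ε u₀ p = sgn ε u₀ s) :
    ((W.filter fun p => s ≤ p ∧ p ≤ s').card : ℤ) = cell ε u₀ s' + 1 - cell ε u₀ s := by
  obtain ⟨h1, h2⟩ := h.image_cell hs hs' hle hsg
  have h3 := Finset.card_image_of_injOn h2
  rw [h1, Int.card_Icc] at h3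
  have h4 := h.cell_sub hs hs' hle hsg
  omega

theorem slope_le_of_line {F : ℤ → ℝ} {x z : ℤ} {μ : ℝ} (hxz : x < z)
    (h : F z + μ * (x - z) ≤ F x) : (F z - F x) / (z - x) ≤ μ := by
  have : (0 : ℝ) < z - x := sub_pos.2 (by exact_mod_cast hxz)
  rw [div_le_iff₀ this]; linarith

theorem le_slope_of_line {F : ℤ → ℝ} {x z : ℤ} {μ : ℝ} (hxz : x < z)
    (h : F x + μ * (z - x) ≤ F z) : μ ≤ (F z - F x) / (z - x) := by
  have : (0 : ℝ) < z - x := sub_pos.2 (by exact_mod_cast hxz)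
  rw [le_div_iff₀ this]; linarith

theorem IsChord.slope_eq {F : ℤ → ℝ} {a b : ℤ} {σ : ℝ} (h : IsChord F a b σ) (hab : a < b) :
    (F b - F a) / (b - a) = σ := by
  have : (0 : ℝ) < b - a := sub_pos.2 (by exact_mod_cast hab)
  rw [div_eq_iff this.ne']; linarith [h.1]

variable {f : ℝ → ℝ} {ε : ℝ} {u₀ : ℝ → ℝ}

/-- The difference of the speeds of two interacting fronts is controlled by the number of pairs of
waves which have not met before. -/
theorem IsDatum.speed_sub_le (D : IsDatum f ε u₀) (hf : ContDiff ℝ 2 f)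
    (hf'' : BddAbove (range fun u => |deriv (deriv f) u|)) {j : ℕ} (h : Occurs f ε u₀ (j + 1))
    {a₁ a₂ b₁ b₂ : ℕ} (hc : IsCollision f ε u₀ (profile f ε u₀ j) (stageWaves f ε u₀ j)
      (stageY f ε u₀ j) a₁ a₂ b₁ b₂) (hsg : sgn ε u₀ a₁ = sgn ε u₀ b₁) :
    ∃ P : Finset (ℕ × ℕ), (∀ x ∈ P, (x.1 ∈ stageWaves f ε u₀ j ∧ a₁ ≤ x.1 ∧ x.1 ≤ a₂) ∧
        (x.2 ∈ stageWaves f ε u₀ j ∧ b₁ ≤ x.2 ∧ x.2 ≤ b₂) ∧ ¬ Met f ε u₀ j x.1 x.2) ∧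
      (speedAt f ε u₀ (profile f ε u₀ j) (stageY f ε u₀ j a₁) a₁ -
        speedAt f ε u₀ (profile f ε u₀ j) (stageY f ε u₀ j b₁) b₁) *
          (((cell ε u₀ b₁ : ℝ) - cell ε u₀ a₁) * (cell ε u₀ b₂ + 1 - cell ε u₀ b₁)) ≤
        (⨆ u, |deriv (deriv f) u|) * ε * P.card *
          (((cell ε u₀ b₁ : ℝ) - cell ε u₀ a₁) + (cell ε u₀ b₂ + 1 - cell ε u₀ b₁)) := by
  have hj := h.mono (Nat.le_succ j)
  have hne := h j (Nat.lt_succ_self j)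
  have hrep := D.isWaveRep hj
  have hS := sgn_eq ε u₀ a₁
  have hab := hc.hab
  have h1a := hc.ha
  have h1b := hc.hb
  obtain ⟨hcell, -, -, -⟩ := hc.speedAt_of_sgn_eq D.eps_pos hrep hne hsg
    (z := advance f ε u₀ (profile f ε u₀ j) (stageY f ε u₀ j)
      (firstMeeting f ε (profile f ε u₀ j))) fun _ _ => rfl
  have hchA := hc.left_chord
  have hchB := hc.right_chord
  rw [← hcell] at hchA
  rw [← hsg] at hchB
  have hca := hc.cell_left_le hrep hc.ha₁ hc.ha₂ le_rfl h1a le_rfl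
  have hcb := hc.cell_right_le hrep hc.hb₁ hc.hb₂ le_rfl h1b le_rfl
  have hM : 0 ≤ (⨆ u, |deriv (deriv f) u|) * ε :=
    mul_nonneg (Real.iSup_nonneg fun u => abs_nonneg _) D.eps_pos.le
  have cardA := HeightSum.card_block hrep.height_sum hc.ha₁ hc.ha₂ h1a hc.left_sgn
  have cardB := HeightSum.card_block hrep.height_sum hc.hb₁ hc.hb₂ h1b hc.right_sgn
  have hs1 := hchA.slope_eq (by omega)
  have hs2 := hchB.slope_eq (by omega)
  set W := stageWaves f ε u₀ j with hW
  set A := W.filter fun p => a₁ ≤ p ∧ p ≤ a₂ with hA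
  set B := W.filter fun p => b₁ ≤ p ∧ p ≤ b₂ with hB
  set σ₁ := speedAt f ε u₀ (profile f ε u₀ j) (stageY f ε u₀ j a₁) a₁
  set σ₂ := speedAt f ε u₀ (profile f ε u₀ j) (stageY f ε u₀ j b₁) b₁
  set M := ⨆ u, |deriv (deriv f) u|
  have cardA' : (A.card : ℝ) = (cell ε u₀ b₁ : ℝ) - cell ε u₀ a₁ := by
    have : (A.card : ℤ) = cell ε u₀ b₁ - cell ε u₀ a₁ := by omega
    exact_mod_cast this
  have cardB' : (B.card : ℝ) = (cell ε u₀ b₂ : ℝ) + 1 - cell ε u₀ b₁ := by exact_mod_cast cardB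
  by_cases hmet : Met f ε u₀ j a₂ b₁
  · classical
    -- Two extreme waves are selected: `c`, the first of the left front that has met `b₁`, and `d`,
    -- the last of the right front that has met `a₂`.
    have hLne : (A.filter fun p => Met f ε u₀ j p b₁).Nonempty :=
      ⟨a₂, Finset.mem_filter.2 ⟨Finset.mem_filter.2 ⟨hc.ha₂, h1a, le_rfl⟩, hmet⟩⟩
    have hRne : (B.filter fun p => Met f ε u₀ j a₂ p).Nonempty :=
      ⟨b₁, Finset.mem_filter.2 ⟨Finset.mem_filter.2 ⟨hc.hb₁, le_rfl, h1b⟩, hmet⟩⟩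
    have hcm := Finset.min'_mem _ hLne
    have hdm := Finset.max'_mem _ hRne
    have hcmin : ∀ p ∈ A.filter (fun p => Met f ε u₀ j p b₁),
        (A.filter fun p => Met f ε u₀ j p b₁).min' hLne ≤ p := fun p hp => Finset.min'_le _ p hp
    have hdmax : ∀ p ∈ B.filter (fun p => Met f ε u₀ j a₂ p),
        p ≤ (B.filter fun p => Met f ε u₀ j a₂ p).max' hRne := fun p hp => Finset.le_max' _ p hp
    generalize (A.filter fun p => Met f ε u₀ j p b₁).min' hLne = c at hcm hcmin
    generalize (B.filter fun p => Met f ε u₀ j a₂ p).max' hRne = d at hdm hdmax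
    obtain ⟨hcA, hcmet⟩ := Finset.mem_filter.1 hcm
    obtain ⟨hdB, hdmet⟩ := Finset.mem_filter.1 hdm
    obtain ⟨hcW, hac, hca₂⟩ := Finset.mem_filter.1 hcA
    obtain ⟨hdW, hbd, hdb₂⟩ := Finset.mem_filter.1 hdB
    have cardc := HeightSum.card_block hrep.height_sum hcW hc.ha₂ hca₂ fun p hp e1 e2 => by
      rw [hc.left_sgn p hp (hac.trans e1) e2, hc.left_sgn c hcW hac hca₂]
    have cardd := HeightSum.card_block hrep.height_sum hc.hb₁ hdW hbd fun p hp e1 e2 =>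
      hc.right_sgn p hp e1 (e2.trans hdb₂)
    have hc1 := hc.cell_left_le hrep hc.ha₁ hcW le_rfl hac hca₂
    have hc2 := hc.cell_left_le hrep hcW hc.ha₂ hac hca₂ le_rfl
    have hd1 := hc.cell_right_le hrep hc.hb₁ hdW le_rfl hbd hdb₂
    have hd2 := hc.cell_right_le hrep hdW hc.hb₂ hbd hdb₂ le_rfl
    have eA : A.filter (fun p => ¬ p < c) = W.filter fun p => c ≤ p ∧ p ≤ a₂ := by
      ext p; simp only [hA, Finset.mem_filter]; constructor
      · rintro ⟨⟨e1, e2, e3⟩, e4⟩; exact ⟨e1, by omega, e3⟩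
      · rintro ⟨e1, e2, e3⟩; exact ⟨⟨e1, by omega, e3⟩, by omega⟩
    have eB : B.filter (fun p => ¬ d < p) = W.filter fun p => b₁ ≤ p ∧ p ≤ d := by
      ext p; simp only [hB, Finset.mem_filter]; constructor
      · rintro ⟨⟨e1, e2, e3⟩, e4⟩; exact ⟨e1, e2, by omega⟩
      · rintro ⟨e1, e2, e3⟩; exact ⟨⟨e1, e2, by omega⟩, by omega⟩
    have sA := Finset.card_filter_add_card_filter_not (s := A) (fun p => p < c)
    have sB := Finset.card_filter_add_card_filter_not (s := B) (fun p => d < p)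
    rw [eB] at sB
    have hx : ((A.filter fun p => p < c).card : ℝ) = (cell ε u₀ c : ℝ) - cell ε u₀ a₁ := by
      rw [eA] at sA
      have : ((A.filter fun p => p < c).card : ℤ) = cell ε u₀ c - cell ε u₀ a₁ := by omega
      exact_mod_cast this
    have hw : ((B.filter fun p => d < p).card : ℝ) = (cell ε u₀ b₂ : ℝ) - cell ε u₀ d := by
      have : ((B.filter fun p => d < p).card : ℤ) = cell ε u₀ b₂ - cell ε u₀ d := by omega
      exact_mod_cast this
    -- Pairs whose left wave comes before `c`, together with the remaining ones whose right wave
    -- comes after `d`. If one of them had met, betweenness would contradict the choice of `c` or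
    -- `d`.
    refine ⟨(A.filter fun p => p < c) ×ˢ B ∪
      (A.filter fun p => ¬ p < c) ×ˢ (B.filter fun p => d < p), ?_, ?_⟩
    · rintro ⟨s, s'⟩ hx
      simp only [Finset.mem_union, Finset.mem_product] at hx
      have hsA : s ∈ A := by
        rcases hx with ⟨e1, -⟩ | ⟨e1, -⟩ <;> exact (Finset.mem_filter.1 e1).1
      have hsB : s' ∈ B := by
        rcases hx with ⟨-, e1⟩ | ⟨-, e1⟩
        · exact e1
        · exact (Finset.mem_filter.1 e1).1
      obtain ⟨hsW, e1, e2⟩ := Finset.mem_filter.1 hsA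
      obtain ⟨hsW', e3, e4⟩ := Finset.mem_filter.1 hsB
      refine ⟨⟨hsW, e1, e2⟩, ⟨hsW', e3, e4⟩, fun hcon => ?_⟩
      rcases hx with ⟨e5, -⟩ | ⟨-, e5⟩
      · have e6 := (Finset.mem_filter.1 e5).2
        have := hcmin s (Finset.mem_filter.2 ⟨hsA, D.met_of_between hj hsW hsW hc.hb₁ hsW' hcon
          le_rfl (by omega) (by omega) e3⟩)
        omega
      · have e6 := (Finset.mem_filter.1 e5).2
        have := hdmax s' (Finset.mem_filter.2 ⟨hsB, D.met_of_between hj hsW hc.ha₂ hsW' hsW' hcon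
          e2 (by omega) (by omega) le_rfl⟩)
        omega
    · have hcard : (((A.filter fun p => p < c) ×ˢ B ∪
          (A.filter fun p => ¬ p < c) ×ˢ (B.filter fun p => d < p)).card : ℝ) =
          ((cell ε u₀ c : ℝ) - cell ε u₀ a₁) * (cell ε u₀ b₂ + 1 - cell ε u₀ b₁) +
            (((cell ε u₀ b₁ : ℝ) - cell ε u₀ a₁) - ((cell ε u₀ c : ℝ) - cell ε u₀ a₁)) *
              ((cell ε u₀ b₂ : ℝ) - cell ε u₀ d) := by
        rw [Finset.card_union_of_disjoint, Finset.card_product, Finset.card_product]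
        · push_cast
          rw [← hx, ← hw, ← cardB', ← cardA', ← sA]
          push_cast
          ring
        · rw [Finset.disjoint_left]
          rintro ⟨s, s'⟩ e1 e2
          simp only [Finset.mem_product, Finset.mem_filter] at e1 e2
          exact e2.1.2 e1.1.2
      rw [hcard]
      -- Both `c` and `d` are in the common history of `a₂` and `b₁`. Hence the slope from `cell c`
      -- to the contact is at most `μ`, and the slope from the contact to `cell d + 1` is at least
      -- `μ`.
      obtain ⟨μ, hμ⟩ := D.hasContact hj a₂ hc.ha₂ b₁ hc.hb₁ hab
        (fun p hp hpp => by have := hc.dichotomy p hp; omega) hmet (fun hsf => by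
          have h2 := (hc.left_iff a₂ hc.ha₂).2 ⟨h1a, le_rfl⟩
          have h3 := hc.pos_lt
          rw [← h2.1, hsf.1] at h3
          exact lt_irrefl _ h3)
      rw [hc.left_sgn a₂ hc.ha₂ h1a le_rfl] at hμ
      have m1 := (hμ c hcW ⟨j, le_rfl, (((hc.left_iff c hcW).2 ⟨hac, hca₂⟩).trans
        ((hc.left_iff a₂ hc.ha₂).2 ⟨h1a, le_rfl⟩).symm).1⟩ hcmet).1
      have m2 := (hμ d hdW hdmet.symm ⟨j, le_rfl, ((hc.right_iff d hdW).2 ⟨hbd, hdb₂⟩).1⟩).2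
      have n1 := slope_le_of_line (by omega) m1
      have n2 := le_slope_of_line (by omega) m2
      -- Passing from these parts to the full fronts costs `M ε` times the number of waves before
      -- `c`, respectively after `d`.
      have k1 := gridFlux_slope_left hf hf'' D.eps_pos hS hc1 (by omega : cell ε u₀ c < cell ε u₀ b₁)
      have k2 := gridFlux_slope_right hf hf'' D.eps_pos hS
        (by omega : cell ε u₀ b₁ < cell ε u₀ d + 1) (by omega : cell ε u₀ d + 1 ≤ cell ε u₀ b₂ + 1)
      rw [hs1] at k1
      rw [hs2] at k2
      push_cast at k2 n2
      have r1 : (cell ε u₀ a₁ : ℝ) ≤ cell ε u₀ c := by exact_mod_cast hc1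
      have r2 : (cell ε u₀ c : ℝ) ≤ cell ε u₀ b₁ := by exact_mod_cast (by omega)
      have r3 : (cell ε u₀ b₁ : ℝ) ≤ cell ε u₀ d := by exact_mod_cast hd1
      have r4 : (cell ε u₀ d : ℝ) ≤ cell ε u₀ b₂ := by exact_mod_cast hd2
      refine mul_le_of_le_add hM (by linarith) (by linarith) (by linarith) (by linarith) ?_
      change _ ≤ M * ε * _ at k1
      change _ ≤ M * ε * _ at k2
      linarith
  -- If the adjacent waves have not met, no pair across the fronts has, and the crude bound by the
  -- full length is enough.
  · refine ⟨A ×ˢ B, ?_, ?_⟩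
    · rintro ⟨s, s'⟩ hx
      obtain ⟨hsA, hsB⟩ := Finset.mem_product.1 hx
      obtain ⟨hsW, e1, e2⟩ := Finset.mem_filter.1 hsA
      obtain ⟨hsW', e3, e4⟩ := Finset.mem_filter.1 hsB
      refine ⟨⟨hsW, e1, e2⟩, ⟨hsW', e3, e4⟩, fun hcon => hmet ?_⟩
      simp only at *
      exact D.met_of_between hj hsW hc.ha₂ hc.hb₁ hsW' hcon e2 (by omega) (by omega) e3
    · have k := gridFlux_slope_sub_le hf hf'' D.eps_pos hS
        (by omega : cell ε u₀ a₁ < cell ε u₀ b₁) (by omega : cell ε u₀ b₁ < cell ε u₀ b₂ + 1)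
      rw [hs1, hs2] at k
      change _ ≤ M * ε * _ at k
      push_cast at k
      rw [Finset.card_product]
      push_cast
      rw [← cardB', ← cardA']
      have hnn : (0 : ℝ) ≤ A.card * B.card := by positivity
      have : σ₁ - σ₂ ≤ M * ε * (A.card + B.card) := by
        rw [cardA', cardB']; linarith
      nlinarith [mul_le_mul_of_nonneg_right this hnn]

theorem IsDatum.speed_time (D : IsDatum f ε u₀) {j : ℕ} (h : Occurs f ε u₀ j) (s : ℕ) :
    speed f ε u₀ (time f ε u₀ j) s =
      speedAt f ε u₀ (profile f ε u₀ j) (stageY f ε u₀ j s) s := by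
  unfold speed stageSpeed
  rw [D.stage_time h]
  rfl

/-- The total change of speed at an interaction. -/
theorem IsDatum.sum_speed_sub (D : IsDatum f ε u₀) {j : ℕ} (h : Occurs f ε u₀ (j + 1))
    {a₁ a₂ b₁ b₂ : ℕ} (hc : IsCollision f ε u₀ (profile f ε u₀ j) (stageWaves f ε u₀ j)
      (stageY f ε u₀ j) a₁ a₂ b₁ b₂) (hsg : sgn ε u₀ a₁ = sgn ε u₀ b₁) :
    (∑ s ∈ stageWaves f ε u₀ j, |speed f ε u₀ (time f ε u₀ (j + 1)) s -
      speed f ε u₀ (time f ε u₀ j) s| * ε) *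
        (((cell ε u₀ b₁ : ℝ) - cell ε u₀ a₁) + (cell ε u₀ b₂ + 1 - cell ε u₀ b₁)) =
      2 * ε * ((speedAt f ε u₀ (profile f ε u₀ j) (stageY f ε u₀ j a₁) a₁ -
        speedAt f ε u₀ (profile f ε u₀ j) (stageY f ε u₀ j b₁) b₁) *
          (((cell ε u₀ b₁ : ℝ) - cell ε u₀ a₁) * (cell ε u₀ b₂ + 1 - cell ε u₀ b₁))) := by
  have hj := h.mono (Nat.le_succ j)
  have hne := h j (Nat.lt_succ_self j)
  have hrep := D.isWaveRep hj
  have hab := hc.hab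
  have h1a := hc.ha
  have h1b := hc.hb
  have hWsurv := (hc.isWaveRep_of_sgn_eq D.eps_pos hrep hne hsg).2
  rw [← stageWaves_succ h] at hWsurv
  obtain ⟨hcell, -, hin, hout⟩ := hc.speedAt_of_sgn_eq D.eps_pos hrep hne hsg
    (z := stageY f ε u₀ (j + 1)) fun p hp => stageY_succ h (by rw [hWsurv]; exact hp)
  rw [← profile_succ h] at hin hout
  have cardA := HeightSum.card_block hrep.height_sum hc.ha₁ hc.ha₂ h1a hc.left_sgn
  have cardB := HeightSum.card_block hrep.height_sum hc.hb₁ hc.hb₂ h1b hc.right_sgn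
  have hca := hc.cell_left_le hrep hc.ha₁ hc.ha₂ le_rfl h1a le_rfl
  have hcb := hc.cell_right_le hrep hc.hb₁ hc.hb₂ le_rfl h1b le_rfl
  have hlt := hc.speed_lt
  have hleft : ∀ s ∈ stageWaves f ε u₀ j, a₁ ≤ s → s ≤ a₂ → _ := fun s hs e1 e2 =>
    ((hc.left_iff s hs).2 ⟨e1, e2⟩).2
  have hright : ∀ s ∈ stageWaves f ε u₀ j, b₁ ≤ s → s ≤ b₂ → _ := fun s hs e1 e2 =>
    ((hc.right_iff s hs).2 ⟨e1, e2⟩).2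
  have cardA' : ((((stageWaves f ε u₀ j).filter fun p => a₁ ≤ p ∧ p ≤ a₂).card : ℕ) : ℝ) =
      (cell ε u₀ b₁ : ℝ) - cell ε u₀ a₁ := by
    have : ((((stageWaves f ε u₀ j).filter fun p => a₁ ≤ p ∧ p ≤ a₂).card : ℕ) : ℤ) =
      cell ε u₀ b₁ - cell ε u₀ a₁ := by omega
    exact_mod_cast this
  have cardB' : ((((stageWaves f ε u₀ j).filter fun p => b₁ ≤ p ∧ p ≤ b₂).card : ℕ) : ℝ) =
      (cell ε u₀ b₂ : ℝ) + 1 - cell ε u₀ b₁ := by exact_mod_cast cardB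
  set σ₁ := speedAt f ε u₀ (profile f ε u₀ j) (stageY f ε u₀ j a₁) a₁
  set σ₂ := speedAt f ε u₀ (profile f ε u₀ j) (stageY f ε u₀ j b₁) b₁
  have hl : (0 : ℝ) < (cell ε u₀ b₁ : ℝ) - cell ε u₀ a₁ :=
    sub_pos.2 (by exact_mod_cast (by omega))
  have hr : (0 : ℝ) < (cell ε u₀ b₂ : ℝ) + 1 - cell ε u₀ b₁ :=
    sub_pos.2 (by exact_mod_cast (by omega))
  set l : ℝ := (cell ε u₀ b₁ : ℝ) - cell ε u₀ a₁ with hldef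
  set r : ℝ := (cell ε u₀ b₂ : ℝ) + 1 - cell ε u₀ b₁ with hrdef
  have hlr : (cell ε u₀ b₂ : ℝ) + 1 - cell ε u₀ a₁ = l + r := by rw [hldef, hrdef]; ring
  rw [hlr] at hin
  -- For the weighted mean, `l (σ₁ - ρ) = r (ρ - σ₂)`: both fronts contribute equally to the total
  -- change, which gives the factor `2`.
  set ρ := (σ₁ * l + σ₂ * r) / (l + r) with hρ
  have hρ' : ρ * (l + r) = σ₁ * l + σ₂ * r := div_mul_cancel₀ _ (by linarith)
  have hρ1 : ρ ≤ σ₁ := by rw [hρ, div_le_iff₀ (by linarith)]; nlinarith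
  have hρ2 : σ₂ ≤ ρ := by rw [hρ, le_div_iff₀ (by linarith)]; nlinarith
  have hterm : ∀ s ∈ stageWaves f ε u₀ j, |speed f ε u₀ (time f ε u₀ (j + 1)) s -
      speed f ε u₀ (time f ε u₀ j) s| * ε =
      (if a₁ ≤ s ∧ s ≤ a₂ then (σ₁ - ρ) * ε else 0) +
        (if b₁ ≤ s ∧ s ≤ b₂ then (ρ - σ₂) * ε else 0) := by
    intro s hs
    rw [D.speed_time h, D.speed_time hj]
    by_cases hC : a₁ ≤ s ∧ s ≤ b₂
    · rw [hin s hs hC.1 hC.2]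
      rcases hc.dichotomy s hs with h3 | h3
      · rw [if_pos ⟨hC.1, h3⟩, if_neg (by omega), hleft s hs hC.1 h3, abs_sub_comm,
          abs_of_nonneg (by linarith), add_zero]
      · rw [if_neg (by omega), if_pos ⟨h3, hC.2⟩, hright s hs h3 hC.2,
          abs_of_nonneg (by linarith), zero_add]
    · rw [hout s hs hC, if_neg (by omega), if_neg (by omega)]
      simp
  rw [Finset.sum_congr rfl hterm, Finset.sum_add_distrib, ← Finset.sum_filter, ← Finset.sum_filter,
    Finset.sum_const, Finset.sum_const, nsmul_eq_mul, nsmul_eq_mul, cardA', cardB']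
  linear_combination (-l * ε + r * ε) * hρ'

end WavefrontTracking

/-! ### Balance of the functional at an interaction point. -/

theorem mainTheorem3
    (f : ℝ → ℝ) (hf : ContDiff ℝ 2 f)
    (hf'' : BddAbove (Set.range fun u => |deriv (deriv f) u|))
    (ε : ℝ) (hε : 0 < ε)
    (u₀ : ℝ → ℝ)
    (hgrid : ∀ x, ∃ m : ℤ, u₀ x = m * ε)
    (hBV : BoundedVariationOn u₀ Set.univ)
    (hright : ∀ x, ContinuousWithinAt u₀ (Set.Ici x) x)
    (hsupp : HasCompactSupport u₀)
    (hbin : WavefrontTracking.BinaryCollisions f ε u₀)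
    (j : ℕ) (hj : WavefrontTracking.IsInteraction f ε u₀ j) :
    ∑ s ∈ WavefrontTracking.realWaves f ε u₀ (WavefrontTracking.time f ε u₀ j),
        |WavefrontTracking.speed f ε u₀ (WavefrontTracking.time f ε u₀ j) s -
          WavefrontTracking.speed f ε u₀ (WavefrontTracking.time f ε u₀ (j - 1)) s| * ε ≤
      2 * (WavefrontTracking.Q f ε u₀ (WavefrontTracking.time f ε u₀ (j - 1)) -
        WavefrontTracking.Q f ε u₀ (WavefrontTracking.time f ε u₀ j)) := by
  open WavefrontTracking in
  have D : IsDatum f ε u₀ := ⟨hε, hgrid, hBV, hright, hsupp, hbin⟩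
  obtain ⟨hj1, h, hsame⟩ := hj
  obtain ⟨i, rfl⟩ : ∃ i, j = i + 1 := ⟨j - 1, by omega⟩
  rw [Nat.add_sub_cancel] at hsame ⊢
  have hi := h.mono (Nat.le_succ i)
  have hne := h i (Nat.lt_succ_self i)
  have hrep := D.isWaveRep hi
  obtain ⟨a₁, a₂, b₁, b₂, hc⟩ := hrep.exists_isCollision hε hne (D.bin i h)
  -- Each front jump is a positive multiple of the sign of its waves, so opposite signs would
  -- contradict the positive product of the jumps.
  have hsg : sgn ε u₀ a₁ = sgn ε u₀ b₁ := by
    rcases hc.sgn_cases with hsg | hsg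
    · exact hsg
    · exfalso
      have h1 := hsame _ hc.left_mem _ hc.right_mem
      obtain ⟨m, hm, e1⟩ := hrep.frontJump_wave (f := f) hε hc.ha₁
      obtain ⟨n, hn, e2⟩ := hrep.frontJump_wave (f := f) hε hc.hb₁
      rw [e1, e2, hsg] at h1
      push_cast at h1
      have h2 : (0 : ℝ) ≤ m * n * (sgn ε u₀ a₁ * ε) ^ 2 := by positivity
      nlinarith
  have hW := (hc.isWaveRep_of_sgn_eq hε hrep hne hsg).2
  rw [← stageWaves_succ h] at hW
  have hca := hc.cell_left_le hrep hc.ha₁ hc.ha₂ le_rfl hc.ha le_rfl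
  have hcb := hc.cell_right_le hrep hc.hb₁ hc.hb₂ le_rfl hc.hb le_rfl
  have hyz : ∀ p ∈ stageWaves f ε u₀ i, stageY f ε u₀ (i + 1) p = _ := fun p hp =>
    stageY_succ h (by rw [hW]; exact hp)
  obtain ⟨hcell, hch, -, -⟩ := hc.speedAt_of_sgn_eq hε hrep hne hsg hyz
  have hab := hc.hab
  have h1a := hc.ha
  have h1b := hc.hb
  have hyC : ∀ p ∈ stageWaves f ε u₀ i,
      stageY f ε u₀ (i + 1) p = stageY f ε u₀ (i + 1) a₁ ↔ a₁ ≤ p ∧ p ≤ b₂ := by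
    intro p hp
    rw [hyz p hp, hyz a₁ hc.ha₁]; exact hc.mem_iff p hp
  have hzero : ∀ s ∈ stageWaves f ε u₀ i, ∀ s' ∈ stageWaves f ε u₀ i, s < s' → a₁ ≤ s → s' ≤ b₂ →
      weight f ε u₀ (time f ε u₀ (i + 1)) s s' = 0 := by
    intro s hs s' hs' hlt e1 e2
    have hss : sgn ε u₀ s = sgn ε u₀ a₁ := by
      rcases hc.dichotomy s hs with h3 | h3
      · exact hc.left_sgn s hs e1 h3
      · rw [hc.right_sgn s hs h3 (by omega), hsg]
    refine D.weight_eq_zero h (a := a₁) (b := b₂) (by rw [hW]; exact hs) (by rw [hW]; exact hs')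
      hlt (by rw [hW]; exact hc.ha₁) (by rw [hW]; exact hc.hb₂) e1 e2
      ((hyC b₂ hc.hb₂).2 ⟨by omega, le_rfl⟩).symm (by rw [hss]; exact hch)
  have hM : 0 ≤ ⨆ u, |deriv (deriv f) u| := Real.iSup_nonneg fun u => abs_nonneg _
  -- A pair that meets just now is at the collision point, so its weight falls from the full norm to
  -- zero.
  have hanti : ∀ s ∈ stageWaves f ε u₀ i, ∀ s' ∈ stageWaves f ε u₀ i, s < s' →
      0 ≤ weight f ε u₀ (time f ε u₀ i) s s' - weight f ε u₀ (time f ε u₀ (i + 1)) s s' := by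
    intro s hs s' hs' hlt
    by_cases hm : Met f ε u₀ i s s'
    · exact sub_nonneg.2 (D.weight_anti h hW hs hs' hlt hm)
    · rw [D.weight_of_not_met hi hm]
      by_cases hm' : Met f ε u₀ (i + 1) s s'
      · have hy := (met_succ.1 hm').resolve_left hm
        have hC : stageY f ε u₀ (i + 1) s = stageY f ε u₀ (i + 1) a₁ := by
          rw [hyz s hs, hyz s' hs'] at hy
          rcases hc.single s hs s' hs' hy with h3 | h3
          · exact absurd ⟨i, le_rfl, h3.1⟩ hm
          · rw [hyz s hs, hyz a₁ hc.ha₁]; exact h3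
        have e1 := (hyC s hs).1 hC
        have e2 := (hyC s' hs').1 (hy.symm.trans hC)
        rw [hzero s hs s' hs' hlt e1.1 e2.2, sub_zero]
        exact hM
      · rw [D.weight_of_not_met h hm', sub_self]
  obtain ⟨P, hP, hest⟩ := D.speed_sub_le hf hf'' h hc hsg
  -- Only the pairs in `P` are kept, each dropping by the full norm of `f''`; all other pairs
  -- contribute nonnegatively.
  have hQ : (⨆ u, |deriv (deriv f) u|) * ε * P.card * ε ≤
      Q f ε u₀ (time f ε u₀ i) - Q f ε u₀ (time f ε u₀ (i + 1)) := by
    unfold Q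
    rw [D.realWaves_time hi, D.realWaves_time h, hW, ← Finset.sum_sub_distrib]
    simp_rw [← Finset.sum_sub_distrib, ← sub_mul, Finset.sum_filter]
    rw [← Finset.sum_product', ← Finset.sum_filter]
    have h1 : (⨆ u, |deriv (deriv f) u|) * ε * P.card * ε =
        ∑ x ∈ P, (weight f ε u₀ (time f ε u₀ i) x.1 x.2 -
          weight f ε u₀ (time f ε u₀ (i + 1)) x.1 x.2) * ε * ε := by
      rw [Finset.sum_congr rfl (g := fun _ => (⨆ u, |deriv (deriv f) u|) * ε * ε),
        Finset.sum_const, nsmul_eq_mul]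
      · ring
      · intro x hx
        obtain ⟨⟨e1, e2, e3⟩, ⟨e4, e5, e6⟩, e7⟩ := hP x hx
        rw [D.weight_of_not_met hi e7, hzero x.1 e1 x.2 e4 (by omega) e2 e6, sub_zero]
    rw [h1]
    refine Finset.sum_le_sum_of_subset_of_nonneg (fun x hx => ?_) fun x hx _ => ?_
    · obtain ⟨⟨e1, e2, e3⟩, ⟨e4, e5, e6⟩, e7⟩ := hP x hx
      rw [Finset.mem_filter, Finset.mem_product]
      exact ⟨⟨e1, e4⟩, by omega⟩
    · rw [Finset.mem_filter, Finset.mem_product] at hx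
      exact mul_nonneg (mul_nonneg (hanti _ hx.1.1 _ hx.1.2 hx.2) hε.le) hε.le
  have hsum := D.sum_speed_sub h hc hsg
  rw [D.realWaves_time h, hW]
  have hl : (0 : ℝ) < (cell ε u₀ b₁ : ℝ) - cell ε u₀ a₁ :=
    sub_pos.2 (by exact_mod_cast (by omega))
  have hr : (0 : ℝ) < (cell ε u₀ b₂ : ℝ) + 1 - cell ε u₀ b₁ :=
    sub_pos.2 (by exact_mod_cast (by omega))
  refine le_trans ?_ (mul_le_mul_of_nonneg_left hQ (by norm_num : (0 : ℝ) ≤ 2))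
  -- The inequality is multiplied by the total number of waves in the two fronts, the factor carried
  -- by both `hsum` and `hest`.
  refine le_of_mul_le_mul_right ?_ (add_pos hl hr)
  rw [hsum]
  have := mul_le_mul_of_nonneg_left hest (by linarith : 0 ≤ 2 * ε)
  linarith
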